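/- **Setting.** Let $\Theta=[\underline\theta,\overline\theta]$, $\underline\theta<\overline\theta$, with a continuous, strictly positive prior density $f$. The sender observes $\theta$ and a private anchor $b=b_0(\theta)+\sigma x$, where $\sigma>0$, $b_0\in C^3(\Theta)$ with $b_0'\ge\underline b_0'>0$, and $x$ is independent of $\theta$ with a strictly positive, strictly log-concave density in $C^4(\mathbb R)$ whose derivatives of orders $1,\dots,4$ are bounded and integrable; $q(\cdot\mid\theta)$ is the density of $b$ given $\theta$. The sender sends a report $r\in\mathbb R$, the receiver then takes an action $a\in\mathbb R$. The receiver gets $U^R(a,\theta)$; the sender gets $U^S(a,\theta;d)-D(r,b)$ with $D(r,b)=c\,\phi(r-b)$, $c>0$, $\phi\in C^5(\mathbb R)$, $\phi(0)=\phi'(0)=0$, $\phi'$ onto, $0<\underline\kappa\le\phi''\le\overline\kappa<\infty$, and $\phi^{(3)},\phi^{(4)},\phi^{(5)}$ bounded; $d\in[0,\bar d_0]$, $\bar d_0>0$. $U^R$ is $C^4$ on $\mathbb R\times\Theta$ and strictly concave in $a$; for each $\theta$ the equation $U^R_1(a,\theta)=0$ has a unique solution $a^R(\theta)$; $A=[a^R(\underline\theta),a^R(\overline\theta)]$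 is nonempty; on $A\times\Theta$, $U^R_{11}\le-\eta<0$ and $U^R_{12}\ge\underline\gamma>0$. *Small bias:* $U^S$ is $C^4$ on $A\times\Theta\times[0,\bar d_0]$ with $U^S_{11}\le-\eta_S<0$ and $U^S_{12}\ge\underline\gamma_S>0$ there; $U^S_1(a^R(\theta),\theta;0)=0$ for all $\theta$; and there is $\hat\delta\in C^2(\Theta)$, $\hat\delta>0$, with $\partial_dU^S_1(a^R(\theta),\theta;d)|_{d=0}=-U^S_{11}(a^R(\theta),\theta;0)\,\hat\delta(\theta)$ for all $\theta$. Let $a^S(\theta;d)$ be the maximizer of $U^S(\cdot,\theta;d)$ on $A$. **Equilibria.** For a set of states $I\subseteq\Theta$, a *regular equilibrium on $I$* (for the prior truncated to $I$) is a pure-strategy perfect Bayesian equilibrium with measurable report rule $R$, action rule $a:\mathbb R\to A$ and beliefs on $I$ after every report, given by Bayes' rule, such that (i) $a$ is continuous, strictly increasing, and $C^3$ off a finite set of kinks, (ii) for all $\theta\in I$ and $b\in\mathbb R$, $R(\theta,b)$ is the unique maximizer of $r\mapsto U^S(a(r),\theta;d)-D(r,b)$, and (iii) the second-order condition there is strict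 whenever $R(\theta,b)$ is not a kink. An *anchor-only equilibrium* is a regular equilibrium on $\Theta$. A *hybrid equilibrium with $N$ labels* consists of cutoffs $\underline\theta=\theta_0<\dots<\theta_N=\overline\theta$, a regular equilibrium $(R_k,a_k)$ on each cell $I_k=[\theta_{k-1},\theta_k)$ ($I_N=[\theta_{N-1},\theta_N]$), such that $\bar V_k(\theta)\ge\bar V_\ell(\theta)$ for all $k,\ell$ and $\theta\in I_k$, where $\bar V_k(\theta)=\int_{\mathbb R}\sup_{r}\{U^S(a_k(r),\theta;d)-D(r,b)\}\,q(b\mid\theta)\,db$. Its *mesh* is $\max_k(\theta_k-\theta_{k-1})$. A hybrid equilibrium is *most informative* at $d$ if no hybrid equilibrium at $d$ has more labels. The surplus $W^i$ of player $i\in\{R,S\}$ in an equilibrium is the ex ante expected payoff (for the sender, net of $D$). The loss is $L^i=W^{i,FB}-W^i$, with $W^{R,FB}=\int_\Theta U^R(a^R(\theta),\theta)f(\theta)\,d\theta$ and $W^{S,FB}(d)=\int_\Theta U^S(a^S(\theta;d),\theta;d)f(\theta)\,d\theta$. Subscripts $A$ and $H$ denote an anchor-only and a hybrid equilibrium. **Theorem.**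 There is $\bar d\in(0,\bar d_0]$ such that: 1. There is $\ell>0$ such that for all $d\in(0,\bar d)$, every anchor-only equilibrium at $d$ has $L^i_A\ge\ell$ for both players. 2. There is $w>0$ such that for all $d\in(0,\bar d)$, every hybrid equilibrium at $d$ with mesh less than $w$ and every anchor-only equilibrium at $d$ satisfy $W^i_H>W^i_A$ for both players. 3. Hybrid losses vanish as $d\downarrow0$ and the mesh tends to $0$: for every $\varepsilon>0$ there are $w>0$ and $d_1\in(0,\bar d_0]$ such that for all $d\in(0,d_1)$ every hybrid equilibrium at $d$ with mesh less than $w$ has $|L_H^i|<\varepsilon$ for both players. If moreover $f$ is Lipschitz on $\Theta$, then: 4. For every $w>0$ there are $n\in\mathbb N$ and $d_1\in(0,\bar d_0]$ such that for all $d\in(0,d_1)$ every hybrid equilibrium at $d$ with at least $n$ labels has mesh less than $w$. 5. Suppose that, for every $n$, hybrid equilibria with at least $n$ labels exist for all sufficiently small $d>0$. Then there is $\bar d'\in(0,\bar d_0]$ such that for every $d\in(0,\bar d')$ a most informative hybrid equilibrium exists, and $W_H^i(d)>W_A^i(d)$, $i\in\{R,S\}$, for every most informative hybrid equilibrium and every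 anchor-only equilibrium at $d$; and $L^i_H(d)\to0$ as $d\downarrow0$, uniformly over most informative hybrid equilibria. -/

import Mathlib

open MeasureTheory ProbabilityTheory Set Filter
open scoped Topology

namespace HardSoft

noncomputable section

/-- The two players. -/
inductive Player where
  | receiver
  | sender

/-- The primitives. The state space is `[lo, hi]` with prior density `f`; `UR a θ` is the
receiver's payoff and `US a θ d` the sender's action payoff at misalignment `d ∈ [0, d₀]`.
The private anchor is `b = b₀ θ + σ x`, where `x` has density `noise`; the message space is the
real line and sending the report `r` at anchor `b` costs `c * φ (r - b)`. -/
structure Model where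
  lo : ℝ
  hi : ℝ
  f : ℝ → ℝ
  UR : ℝ → ℝ → ℝ
  US : ℝ → ℝ → ℝ → ℝ
  d₀ : ℝ
  b₀ : ℝ → ℝ
  σ : ℝ
  noise : ℝ → ℝ
  c : ℝ
  φ : ℝ → ℝ

namespace Model

variable (E : Model)

/-- The state space. -/
def Θ : Set ℝ := Icc E.lo E.hi

/-- The conditional density `q(b | θ)` of the anchor. -/
def q (b θ : ℝ) : ℝ := E.σ⁻¹ * E.noise ((b - E.b₀ θ) / E.σ)

/-- The reporting cost. -/
def D (r b : ℝ) : ℝ := E.c * E.φ (r - b)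

/-! Partial derivatives of the receiver's payoff (actions range over the real line). -/

def UR1 (a θ : ℝ) : ℝ := deriv (fun x => E.UR x θ) a
def UR11 (a θ : ℝ) : ℝ := deriv (fun x => E.UR1 x θ) a
def UR12 (a θ : ℝ) : ℝ := derivWithin (fun ϑ => E.UR1 a ϑ) E.Θ θ

/-- The receiver's ideal action: the solution of `UR1 a θ = 0`
(it exists and is unique under `Model.Assumptions`). -/
def aR (θ : ℝ) : ℝ := Classical.epsilon fun a => E.UR1 a θ = 0

/-- The interval of rationalizable receiver actions. -/
def A : Set ℝ := Icc (E.aR E.lo) (E.aR E.hi)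

/-! Partial derivatives of the sender's action payoff on `A × Θ × [0, d₀]`
(one-sided at the ends of the intervals). -/

def US1 (a θ d : ℝ) : ℝ := derivWithin (fun x => E.US x θ d) E.A a
def US11 (a θ d : ℝ) : ℝ := derivWithin (fun x => E.US1 x θ d) E.A a
def US12 (a θ d : ℝ) : ℝ := derivWithin (fun ϑ => E.US1 a ϑ d) E.Θ θ

/-- The sender's ideal action: the maximizer of `US · θ d` on `A`
(it exists and is unique under `Model.Assumptions`). -/
def aS (θ d : ℝ) : ℝ :=
  Classical.epsilon fun a => a ∈ E.A ∧ IsMaxOn (fun x => E.US x θ d) E.A a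

/-- The assumptions on the primitives: regularity and curvature of the two payoffs, the
additive-anchor and translation-invariant-cost environment, and the small-bias perturbation. -/
structure Assumptions : Prop where
  lo_lt_hi : E.lo < E.hi
  -- prior density
  f_cont : ContinuousOn E.f E.Θ
  f_pos : ∀ θ ∈ E.Θ, 0 < E.f θ
  f_mass : ∫ θ in E.Θ, E.f θ = 1
  -- receiver
  UR_smooth : ContDiffOn ℝ 4 (fun p : ℝ × ℝ => E.UR p.1 p.2) (univ ×ˢ E.Θ)
  UR_concave : ∀ θ ∈ E.Θ, StrictConcaveOn ℝ univ fun a => E.UR a θ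
  aR_unique : ∀ θ ∈ E.Θ, ∃! a, E.UR1 a θ = 0
  A_nonempty : E.aR E.lo ≤ E.aR E.hi
  UR_curv : ∃ η > 0, ∀ a ∈ E.A, ∀ θ ∈ E.Θ, E.UR11 a θ ≤ -η
  UR_cross : ∃ γ > 0, ∀ a ∈ E.A, ∀ θ ∈ E.Θ, γ ≤ E.UR12 a θ
  -- sender, uniformly in the misalignment parameter
  d₀_pos : 0 < E.d₀
  US_smooth : ContDiffOn ℝ 4 (fun p : ℝ × ℝ × ℝ => E.US p.1 p.2.1 p.2.2)
    (E.A ×ˢ E.Θ ×ˢ Icc 0 E.d₀)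
  US_curv : ∃ η > 0, ∀ a ∈ E.A, ∀ θ ∈ E.Θ, ∀ d ∈ Icc 0 E.d₀, E.US11 a θ d ≤ -η
  US_cross : ∃ γ > 0, ∀ a ∈ E.A, ∀ θ ∈ E.Θ, ∀ d ∈ Icc 0 E.d₀, γ ≤ E.US12 a θ d
  -- small bias: alignment at `d = 0` and a positive first-order displacement
  aligned : ∀ θ ∈ E.Θ, E.US1 (E.aR θ) θ 0 = 0
  bias : ∃ δ : ℝ → ℝ, ContDiffOn ℝ 2 δ E.Θ ∧ ∀ θ ∈ E.Θ, 0 < δ θ ∧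
    HasDerivWithinAt (fun d => E.US1 (E.aR θ) θ d) (-E.US11 (E.aR θ) θ 0 * δ θ) (Icc 0 E.d₀) 0
  -- anchor
  σ_pos : 0 < E.σ
  b₀_smooth : ContDiffOn ℝ 3 E.b₀ E.Θ
  b₀_slope : ∃ β > 0, ∀ θ ∈ E.Θ, β ≤ derivWithin E.b₀ E.Θ θ
  noise_smooth : ContDiff ℝ 4 E.noise
  noise_pos : ∀ x, 0 < E.noise x
  noise_integrable : Integrable E.noise
  noise_mass : ∫ x, E.noise x = 1
  noise_logconcave : StrictConcaveOn ℝ univ fun x => Real.log (E.noise x)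
  noise_deriv : ∀ j ∈ Icc 1 4, Integrable (iteratedDeriv j E.noise) ∧
    ∃ K, ∀ x, |iteratedDeriv j E.noise x| ≤ K
  -- reporting cost
  c_pos : 0 < E.c
  φ_smooth : ContDiff ℝ 5 E.φ
  φ_onto : Function.Surjective (deriv E.φ)
  φ_zero : E.φ 0 = 0
  φ_deriv_zero : deriv E.φ 0 = 0
  φ_curv : ∃ κ₁ κ₂ : ℝ, 0 < κ₁ ∧ ∀ u, κ₁ ≤ iteratedDeriv 2 E.φ u ∧ iteratedDeriv 2 E.φ u ≤ κ₂
  φ_higher : ∃ K, ∀ j ∈ Icc 3 5, ∀ u, |iteratedDeriv j E.φ u| ≤ K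

/-- The joint law of state and anchor `(θ, b)` when the prior `f` is truncated to `I`. -/
def joint (I : Set ℝ) : Measure (ℝ × ℝ) :=
  ((volume.restrict I).prod volume).withDensity fun p =>
    ENNReal.ofReal (E.f p.1 / (∫ θ in I, E.f θ) * E.q p.2 p.1)

/-- The sender's payoff from the report `r` at state `θ` and anchor `b`, against the action
rule `a`. -/
def senderObj (d : ℝ) (a : ℝ → ℝ) (θ b r : ℝ) : ℝ := E.US (a r) θ d - E.D r b

/-- The reports at which an action rule fails to be of class `C³`. -/
def kinks (a : ℝ → ℝ) : Set ℝ := {r | ¬ ContDiffAt ℝ 3 a r}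

/-- `(R, a)` is a regular equilibrium of the game with misalignment `d` in which the prior is
truncated to the set of states `I`: a perfect Bayesian equilibrium in pure strategies, with
belief system `μ`, satisfying the three regularity requirements. -/
structure IsRegularEq (d : ℝ) (I : Set ℝ) (R : ℝ → ℝ → ℝ) (a : ℝ → ℝ) : Prop where
  measurable_R : Measurable fun p : ℝ × ℝ => R p.1 p.2
  -- beliefs follow from Bayes' rule, and the action is a best reply to them after every report
  beliefs : ∃ μ : Kernel ℝ ℝ, IsMarkovKernel μ ∧ (∀ r, μ r Iᶜ = 0) ∧
    (E.joint I).map (fun p => (R p.1 p.2, p.1)) =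
      ((E.joint I).map fun p => R p.1 p.2).compProd μ ∧
    ∀ r x, ∫ θ, E.UR x θ ∂(μ r) ≤ ∫ θ, E.UR (a r) θ ∂(μ r)
  -- (i) shape of the action rule
  a_mem : ∀ r, a r ∈ E.A
  a_cont : Continuous a
  a_mono : StrictMono a
  a_kinks : (kinks a).Finite
  -- (ii) the sender's optimal report is unique
  sender_opt : ∀ θ ∈ I, ∀ b r, r ≠ R θ b →
    E.senderObj d a θ b r < E.senderObj d a θ b (R θ b)
  -- (iii) strict second-order condition in the smooth regions
  sender_soc : ∀ θ ∈ I, ∀ b, R θ b ∉ kinks a →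
    iteratedDeriv 2 (E.senderObj d a θ b) (R θ b) < 0

/-- A regular anchor-only equilibrium at misalignment `d`. -/
structure AnchorOnly (d : ℝ) where
  R : ℝ → ℝ → ℝ
  a : ℝ → ℝ
  regular : E.IsRegularEq d E.Θ R a

/-- The `k`-th cell of a partition by cutoffs: half-open, except for the last one. -/
def cell {N : ℕ} (t : Fin (N + 1) → ℝ) (k : Fin N) : Set ℝ :=
  if (k : ℕ) + 1 = N then Icc (t k.castSucc) (t k.succ) else Ico (t k.castSucc) (t k.succ)

/-- The sender's ex ante value at state `θ` of a label followed by the action rule `a`: the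
label is chosen before the anchor is observed. -/
def labelValue (d : ℝ) (a : ℝ → ℝ) (θ : ℝ) : ℝ :=
  ∫ b, (⨆ r, E.senderObj d a θ b r) * E.q b θ

/-- A regular full-label state-cell hybrid equilibrium with `N` labels at misalignment `d`. -/
structure Hybrid (d : ℝ) (N : ℕ) where
  cut : Fin (N + 1) → ℝ
  cut_strictMono : StrictMono cut
  cut_first : cut 0 = E.lo
  cut_last : cut (Fin.last N) = E.hi
  R : Fin N → ℝ → ℝ → ℝ
  a : Fin N → ℝ → ℝ
  regular : ∀ k, E.IsRegularEq d (cell cut k) (R k) (a k)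
  label_ic : ∀ k, ∀ θ ∈ cell cut k, ∀ l, E.labelValue d (a l) θ ≤ E.labelValue d (a k) θ

/-- The payoff of a player from action `a` and report `r` at state `θ` and anchor `b`. -/
def payoff (d a r θ b : ℝ) : Player → ℝ
  | .receiver => E.UR a θ
  | .sender => E.US a θ d - E.D r b

/-- The part of a player's ex ante surplus that accrues at the states in `I`. -/
def surplusOn (d : ℝ) (I : Set ℝ) (R : ℝ → ℝ → ℝ) (a : ℝ → ℝ) (i : Player) : ℝ :=
  ∫ θ in I, (∫ b, E.payoff d (a (R θ b)) (R θ b) θ b i * E.q b θ) * E.f θ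

/-- The ideal-action benchmark of a player, at zero reporting cost. -/
def benchmark (d : ℝ) : Player → ℝ
  | .receiver => ∫ θ in E.Θ, E.UR (E.aR θ) θ * E.f θ
  | .sender => ∫ θ in E.Θ, E.US (E.aS θ d) θ d * E.f θ

variable {E}

/-- Surplus of an anchor-only equilibrium. -/
def AnchorOnly.surplus {d : ℝ} (X : E.AnchorOnly d) (i : Player) : ℝ :=
  E.surplusOn d E.Θ X.R X.a i

/-- Loss of an anchor-only equilibrium relative to the benchmark. -/
def AnchorOnly.loss {d : ℝ} (X : E.AnchorOnly d) (i : Player) : ℝ :=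
  E.benchmark d i - X.surplus i

/-- Surplus of a hybrid equilibrium. -/
def Hybrid.surplus {d : ℝ} {N : ℕ} (H : E.Hybrid d N) (i : Player) : ℝ :=
  ∑ k, E.surplusOn d (cell H.cut k) (H.R k) (H.a k) i

/-- Loss of a hybrid equilibrium relative to the benchmark. -/
def Hybrid.loss {d : ℝ} {N : ℕ} (H : E.Hybrid d N) (i : Player) : ℝ :=
  E.benchmark d i - H.surplus i

/-- Every label of the hybrid equilibrium has width less than `w`. -/
def Hybrid.FinerThan {d : ℝ} {N : ℕ} (H : E.Hybrid d N) (w : ℝ) : Prop :=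
  ∀ k : Fin N, H.cut k.succ - H.cut k.castSucc < w

variable (E)

/-- The largest number of labels in a hybrid equilibrium at misalignment `d` is `N`; the hybrid
equilibria with `N` labels are then the most informative ones. -/
def MaxLabels (d : ℝ) (N : ℕ) : Prop :=
  IsGreatest {n : ℕ | Nonempty (E.Hybrid d n)} N

end Model

end

end HardSoft

open HardSoft

/-! Compactness of `A × Θ × [0, d₀]` turns the assumptions into estimates with common constants `K`
and `κ` (`Bounds`). Everything else is quantitative and uniform over equilibria.

Anchor-only loss. Payoffs are bounded and distortion is quadratically costly, so reports stay within
a fixed distance of the anchor and the equilibrium action is squeezed between `a (b - M)` and `a (b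
+ M)`. The anchor laws of different states, even translated, dominate each other up to a factor and
a small error (`exists_contiguity`). Hence one function `a` would have to approximate `aR θ` and `aR
(θ + ℓ/2)` under comparable laws, which is impossible (`Bounds.exists_anchorOnly_error`). Strong
concavity turns the error into a loss, for the sender up to a term of order `d`.

Hybrid loss. On a cell `[u, v]` the actions lie in `[aR u, aR v]`, and an optimal distortion costs
no more than it gains over truth-telling. Losses are therefore of the order of the mesh plus `d`
(`Hybrid.abs_loss_le`), and the ranking follows since both losses use one benchmark.

Many labels force a small mesh. Adjacent labels are equally good at a cutoff `t`. On cells of width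
at most `h`, with `d ≤ h`, testing Bayes' rule against the sign of the action error shows that the
action is `aR m` up to `O(h ^ 2)` on average, `m` being the prior mean of the cell. The payoff slope
there is `O(h)`, so the label is worth `US (aR m) t d` up to `O(h ^ 3)`
(`IsRegularEq.abs_labelValue_sub_ideal_le`). A second-order expansion, with means close to midpoints
because `f` is Lipschitz, makes adjacent widths agree up to `C * max ^ 2 + C * d`
(`Bounds.exists_width_comparison`). A wide cell has a value strictly below the ideal at its ends, so
its neighbours cannot be very narrow (`Bounds.exists_adjacent_width`). Since the widths have a
bounded sum, a discrete Gronwall argument (`le_of_slow_variation`) spreads a lower bound from one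
wide label to all labels, which bounds their number.

Largest number of labels. For fixed small `d > 0` the sender wants more than `aR t`. The label left
of a cutoff offers less than that, while a very narrow label to the right would offer slightly more
and be strictly better. So all labels but the first have a minimal width, the number of labels is
bounded, and a maximum exists. -/

namespace HardSoft

/-! ### Mean value and Taylor estimates on compact convex sets -/

section Calculus

variable {V W G : Type*} [NormedAddCommGroup V] [NormedSpace ℝ V] [NormedAddCommGroup W]
  [NormedSpace ℝ W] [NormedAddCommGroup G] [NormedSpace ℝ G]

theorem exists_bound_of_continuousOn {X Y : Type*} [TopologicalSpace X] [NormedAddCommGroup Y]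
    {k : Set X} {F : X → Y}
    (hk : IsCompact k) (hF : ContinuousOn F k) : ∃ C, 0 ≤ C ∧ ∀ x ∈ k, ‖F x‖ ≤ C := by
  obtain ⟨C, hC⟩ := hk.exists_bound_of_continuousOn hF
  exact ⟨max C 0, le_max_right _ _, fun x hx => (hC x hx).trans (le_max_left _ _)⟩

/-- The derivative is continuous, hence bounded on the compact set; convexity permits the mean value
inequality. The set `s` of differentiability may exceed `k`, as for the receiver, whose payoff is
smooth in all real actions. -/
theorem exists_lipschitz_of_contDiffOn {s k : Set V} {F : V → W} (hs : UniqueDiffOn ℝ s)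
    (hF : ContDiffOn ℝ 1 F s) (hks : k ⊆ s) (hk : IsCompact k) (hc : Convex ℝ k) :
    ∃ C, 0 ≤ C ∧ ∀ x ∈ k, ∀ y ∈ k, ‖F y - F x‖ ≤ C * ‖y - x‖ := by
  obtain ⟨C, hC0, hC⟩ := exists_bound_of_continuousOn hk
    ((hF.continuousOn_fderivWithin hs le_rfl).mono hks)
  refine ⟨C, hC0, fun x hx y hy => ?_⟩
  exact hc.norm_image_sub_le_of_norm_hasFDerivWithin_le
    (fun z hz => ((hF.differentiableOn one_ne_zero z (hks hz)).hasFDerivWithinAt).mono hks)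
    hC hx hy

theorem exists_taylor_of_contDiffOn {s k : Set V} {F : V → W} (hs : UniqueDiffOn ℝ s)
    (hF : ContDiffOn ℝ 2 F s) (hks : k ⊆ s) (hk : IsCompact k) (hc : Convex ℝ k) :
    ∃ C, 0 ≤ C ∧ ∀ x ∈ k, ∀ y ∈ k,
      ‖F y - F x - fderivWithin ℝ F s x (y - x)‖ ≤ C * ‖y - x‖ ^ 2 := by
  obtain ⟨C, hC0, hC⟩ := exists_lipschitz_of_contDiffOn hs
    (hF.fderivWithin hs (m := 1) (by norm_num)) hks hk hc
  refine ⟨C, hC0, fun x hx y hy => ?_⟩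
  have hseg : segment ℝ x y ⊆ k := hc.segment_subset hx hy
  have h := (convex_segment x y).norm_image_sub_le_of_norm_hasFDerivWithin_le'
    (f := F) (f' := fderivWithin ℝ F s) (φ := fderivWithin ℝ F s x) (C := C * ‖y - x‖)
    (fun z hz => ((hF.differentiableOn two_ne_zero z
      (hks (hseg hz))).hasFDerivWithinAt).mono (hseg.trans hks))
    (fun z hz => by
      refine (hC x hx z (hseg hz)).trans ?_
      gcongr
      simpa [dist_eq_norm] using norm_sub_le_of_mem_segment hz)
    (left_mem_segment ℝ x y) (right_mem_segment ℝ x y)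
  simpa [pow_two, mul_assoc] using h

theorem hasDerivWithinAt_slice_fst {s : Set ℝ} {T : Set G} {F : ℝ × G → W}
    (hF : DifferentiableOn ℝ F (s ×ˢ T)) {p : ℝ × G} (hp : p ∈ s ×ˢ T) :
    HasDerivWithinAt (fun x => F (x, p.2)) (fderivWithin ℝ F (s ×ˢ T) p (1, 0)) s p.1 := by
  have h1 := (hF p hp).hasFDerivWithinAt
  have h2 : HasDerivWithinAt (fun x : ℝ => (x, p.2)) ((1 : ℝ), (0 : G)) s p.1 :=
    ((hasDerivAt_id p.1).prodMk (hasDerivAt_const p.1 p.2)).hasDerivWithinAt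
  exact HasFDerivWithinAt.comp_hasDerivWithinAt (t := s ×ˢ T) p.1 h1 h2
    (fun x hx => ⟨hx, hp.2⟩)

theorem hasDerivWithinAt_slice_snd {T : Set V} {s : Set ℝ} {F : V × ℝ → W}
    (hF : DifferentiableOn ℝ F (T ×ˢ s)) {p : V × ℝ} (hp : p ∈ T ×ˢ s) :
    HasDerivWithinAt (fun x => F (p.1, x)) (fderivWithin ℝ F (T ×ˢ s) p (0, 1)) s p.2 := by
  have h1 := (hF p hp).hasFDerivWithinAt
  have h2 : HasDerivWithinAt (fun x : ℝ => (p.1, x)) ((0 : V), (1 : ℝ)) s p.2 :=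
    ((hasDerivAt_const p.2 p.1).prodMk (hasDerivAt_id p.2)).hasDerivWithinAt
  exact HasFDerivWithinAt.comp_hasDerivWithinAt (t := T ×ˢ s) p.2 h1 h2
    (fun x hx => ⟨hp.1, hx⟩)

/-- The marginal payoffs are defined by one-variable derivatives of slices. Identifying them with
the joint derivative applied to a basis vector makes them jointly smooth, at the price of one order.
-/
theorem contDiffOn_slice_fst {s : Set ℝ} {T : Set G} {F : ℝ × G → W} {m n : WithTop ℕ∞}
    (hs : UniqueDiffOn ℝ s) (hT : UniqueDiffOn ℝ T)
    (hF : ContDiffOn ℝ n F (s ×ˢ T)) (hmn : m + 1 ≤ n) :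
    ContDiffOn ℝ m (fun p : ℝ × G => derivWithin (fun x => F (x, p.2)) s p.1) (s ×ˢ T) := by
  have hd : DifferentiableOn ℝ F (s ×ˢ T) :=
    (hF.of_le (le_trans (by simp) hmn)).differentiableOn (one_ne_zero (α := WithTop ℕ∞))
  have h := (hF.fderivWithin (hs.prod hT) hmn).clm_apply
    (contDiffOn_const (c := ((1 : ℝ), (0 : G))))
  refine h.congr fun p hp => ?_
  exact (hasDerivWithinAt_slice_fst hd hp).derivWithin (hs p.1 hp.1)

/-- A function with derivative at least `κ` on an interval grows at rate at least `κ`. -/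
theorem growth_of_hasDerivWithinAt {x y κ : ℝ} {g g' : ℝ → ℝ} (hxy : x ≤ y)
    (hg : ∀ z ∈ Icc x y, HasDerivWithinAt g (g' z) (Icc x y) z) (hκ : ∀ z ∈ Icc x y, κ ≤ g' z) :
    κ * (y - x) ≤ g y - g x := by
  refine (convex_Icc x y).mul_sub_le_image_sub_of_le_deriv
    (fun z hz => (hg z hz).continuousWithinAt) ?_ ?_ x (left_mem_Icc.2 hxy) y
    (right_mem_Icc.2 hxy) hxy
  · intro z hz
    rw [interior_Icc] at hz
    exact ((hg z (Ioo_subset_Icc_self hz)).hasDerivAt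
      (Icc_mem_nhds hz.1 hz.2)).differentiableAt.differentiableWithinAt
  · intro z hz
    rw [interior_Icc] at hz
    rw [((hg z (Ioo_subset_Icc_self hz)).hasDerivAt (Icc_mem_nhds hz.1 hz.2)).deriv]
    exact hκ z (Ioo_subset_Icc_self hz)

theorem hasDerivAt_quadratic (α β x z : ℝ) :
    HasDerivAt (fun z => α * (z - x) + β / 2 * (z - x) ^ 2) (α + β * (z - x)) z := by
  have := (((hasDerivAt_id z).sub_const x).const_mul α).add
    ((((hasDerivAt_id z).sub_const x).pow 2).const_mul (β / 2))
  exact this.congr_deriv (by simp; ring)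

/-- Quadratic upper bound for a function whose derivative decreases at rate at least `κ`. -/
theorem le_of_deriv_decreasing {S : Set ℝ} (hS : Convex ℝ S) {κ : ℝ} {g g' : ℝ → ℝ}
    (hg : ∀ z ∈ S, HasDerivWithinAt g (g' z) S z)
    (hκ : ∀ x ∈ S, ∀ y ∈ S, x ≤ y → g' y ≤ g' x - κ * (y - x)) {x y : ℝ} (hx : x ∈ S)
    (hy : y ∈ S) : g y ≤ g x + g' x * (y - x) - κ / 2 * (y - x) ^ 2 := by
  have hq := hasDerivAt_quadratic (g' x) (-κ) x
  rcases le_total x y with h | h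
  · have hsub : Icc x y ⊆ S := hS.ordConnected.out hx hy
    have := growth_of_hasDerivWithinAt (κ := 0) h
      (g := fun z => (g' x * (z - x) + -κ / 2 * (z - x) ^ 2) - g z)
      (fun z hz => ((hq z).hasDerivWithinAt).sub ((hg z (hsub hz)).mono hsub))
      (fun z hz => by linarith [hκ x hx z (hsub hz) hz.1])
    simp at this
    linarith
  · have hsub : Icc y x ⊆ S := hS.ordConnected.out hy hx
    have := growth_of_hasDerivWithinAt (κ := 0) h
      (g := fun z => g z - (g' x * (z - x) + -κ / 2 * (z - x) ^ 2))
      (fun z hz => ((hg z (hsub hz)).mono hsub).sub ((hq z).hasDerivWithinAt))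
      (fun z hz => by linarith [hκ z (hsub hz) x hx hz.2])
    simp at this
    linarith

/-- Third-order remainder from a quadratic bound on the error of the derivative. -/
theorem third_order_of_deriv {S : Set ℝ} (hS : Convex ℝ S) {C x α β : ℝ} (hC : 0 ≤ C)
    {g g' : ℝ → ℝ} (hg : ∀ z ∈ S, HasDerivWithinAt g (g' z) S z)
    (hb : ∀ z ∈ S, |g' z - α - β * (z - x)| ≤ C * (z - x) ^ 2) (hx : x ∈ S) {y : ℝ}
    (hy : y ∈ S) :
    |g y - g x - α * (y - x) - β / 2 * (y - x) ^ 2| ≤ C * |y - x| ^ 3 := by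
  have hq := hasDerivAt_quadratic α β x
  have hseg : segment ℝ x y ⊆ S := hS.segment_subset hx hy
  have h := (convex_segment x y).norm_image_sub_le_of_norm_hasDerivWithin_le
    (f := fun z => g z - (α * (z - x) + β / 2 * (z - x) ^ 2))
    (f' := fun z => g' z - (α + β * (z - x))) (C := C * |y - x| ^ 2)
    (fun z hz => ((hg z (hseg hz)).mono hseg).sub (hq z).hasDerivWithinAt)
    (fun z hz => by
      have h1 := hb z (hseg hz)
      have h2 : |z - x| ≤ |y - x| := by
        simpa [Real.norm_eq_abs] using norm_sub_le_of_mem_segment hz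
      rw [Real.norm_eq_abs, ← sub_sub]
      refine h1.trans ?_
      rw [← sq_abs (z - x)]
      gcongr)
    (left_mem_segment ℝ x y) (right_mem_segment ℝ x y)
  simp only [Real.norm_eq_abs] at h
  have e : g y - (α * (y - x) + β / 2 * (y - x) ^ 2) -
      (g x - (α * (x - x) + β / 2 * (x - x) ^ 2)) =
      g y - g x - α * (y - x) - β / 2 * (y - x) ^ 2 := by ring
  rw [e] at h
  calc _ ≤ _ := h
    _ = _ := by ring

end Calculus

theorem norm_prod_le_add (x y : ℝ) : ‖((x, y) : ℝ × ℝ)‖ ≤ |x| + |y| := by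
  rw [Prod.norm_def]
  exact max_le (le_add_of_nonneg_right (abs_nonneg y)) (le_add_of_nonneg_left (abs_nonneg x))

/-! ### The receiver: ideal actions, first-order condition, estimates -/

namespace Model

variable {E : Model}

namespace Assumptions

theorem uniqueDiffOn_Θ (hE : E.Assumptions) : UniqueDiffOn ℝ E.Θ :=
  uniqueDiffOn_Icc hE.lo_lt_hi

theorem lo_mem (hE : E.Assumptions) : E.lo ∈ E.Θ := left_mem_Icc.2 hE.lo_lt_hi.le

theorem hi_mem (hE : E.Assumptions) : E.hi ∈ E.Θ := right_mem_Icc.2 hE.lo_lt_hi.le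

theorem contDiffOn_UR1 (hE : E.Assumptions) :
    ContDiffOn ℝ 3 (fun p : ℝ × ℝ => E.UR1 p.1 p.2) (univ ×ˢ E.Θ) := by
  have := contDiffOn_slice_fst (m := 3) uniqueDiffOn_univ hE.uniqueDiffOn_Θ hE.UR_smooth
    (by norm_num)
  simp only [derivWithin_univ] at this
  exact this

theorem hasDerivAt_UR (hE : E.Assumptions) {θ : ℝ} (hθ : θ ∈ E.Θ) (a : ℝ) :
    HasDerivAt (fun x => E.UR x θ) (E.UR1 a θ) a := by
  have h := hasDerivWithinAt_slice_fst (hE.UR_smooth.differentiableOn (by simp))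
    (p := (a, θ)) ⟨mem_univ _, hθ⟩
  rw [hasDerivWithinAt_univ] at h
  exact h.differentiableAt.hasDerivAt

theorem UR11_eq (hE : E.Assumptions) {θ : ℝ} (hθ : θ ∈ E.Θ) (a : ℝ) :
    HasDerivAt (fun x => E.UR1 x θ) (E.UR11 a θ) a ∧
    fderivWithin ℝ (fun p : ℝ × ℝ => E.UR1 p.1 p.2) (univ ×ˢ E.Θ) (a, θ) (1, 0) = E.UR11 a θ := by
  have h := hasDerivWithinAt_slice_fst (hE.contDiffOn_UR1.differentiableOn (by simp))
    (p := (a, θ)) ⟨mem_univ _, hθ⟩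
  rw [hasDerivWithinAt_univ] at h
  exact ⟨h.differentiableAt.hasDerivAt, h.deriv.symm⟩

theorem UR12_eq (hE : E.Assumptions) {θ : ℝ} (hθ : θ ∈ E.Θ) (a : ℝ) :
    HasDerivWithinAt (fun x => E.UR1 a x) (E.UR12 a θ) E.Θ θ ∧
    fderivWithin ℝ (fun p : ℝ × ℝ => E.UR1 p.1 p.2) (univ ×ˢ E.Θ) (a, θ) (0, 1) = E.UR12 a θ := by
  have h := hasDerivWithinAt_slice_snd (hE.contDiffOn_UR1.differentiableOn (by simp))
    (p := (a, θ)) ⟨mem_univ _, hθ⟩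
  exact ⟨h.differentiableWithinAt.hasDerivWithinAt, (h.derivWithin (hE.uniqueDiffOn_Θ θ hθ)).symm⟩

theorem UR1_aR (hE : E.Assumptions) {θ : ℝ} (hθ : θ ∈ E.Θ) : E.UR1 (E.aR θ) θ = 0 :=
  Classical.epsilon_spec (p := fun a => E.UR1 a θ = 0) (hE.aR_unique θ hθ).exists

theorem eq_aR (hE : E.Assumptions) {θ a : ℝ} (hθ : θ ∈ E.Θ) (ha : E.UR1 a θ = 0) :
    a = E.aR θ := (hE.aR_unique θ hθ).unique ha (hE.UR1_aR hθ)

/-- Monotonicity of the receiver's marginal payoff in the state. -/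
theorem UR1_growth (hE : E.Assumptions) {γ : ℝ}
    (hγ : ∀ a ∈ E.A, ∀ θ ∈ E.Θ, γ ≤ E.UR12 a θ) {a θ θ' : ℝ} (ha : a ∈ E.A)
    (hθ : θ ∈ E.Θ) (hθ' : θ' ∈ E.Θ) (h : θ ≤ θ') :
    γ * (θ' - θ) ≤ E.UR1 a θ' - E.UR1 a θ := by
  have hsub : Icc θ θ' ⊆ E.Θ := Icc_subset_Icc hθ.1 hθ'.2
  exact growth_of_hasDerivWithinAt h
    (fun z hz => ((hE.UR12_eq (hsub hz) a).1).mono hsub) (fun z hz => hγ a ha z (hsub hz))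

/-- Monotonicity of the receiver's marginal payoff in the action. -/
theorem UR1_decay (hE : E.Assumptions) {η : ℝ}
    (hη : ∀ a ∈ E.A, ∀ θ ∈ E.Θ, E.UR11 a θ ≤ -η) {a a' θ : ℝ} (ha : a ∈ E.A) (ha' : a' ∈ E.A)
    (hθ : θ ∈ E.Θ) (h : a ≤ a') :
    E.UR1 a' θ ≤ E.UR1 a θ - η * (a' - a) := by
  have hsub : Icc a a' ⊆ E.A := Icc_subset_Icc ha.1 ha'.2
  have := growth_of_hasDerivWithinAt (g := fun x => -E.UR1 x θ) (κ := η) h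
    (fun z hz => ((hE.UR11_eq hθ z).1).neg.hasDerivWithinAt)
    (fun z hz => by linarith [hη z (hsub hz) θ hθ])
  linarith

/-- One action cannot have zero marginal payoff at both end states, because the marginal payoff
strictly increases in the state. Strictness makes `A` a nondegenerate interval, so that one-sided
derivatives on it are unique. -/
theorem aR_lo_lt_hi (hE : E.Assumptions) : E.aR E.lo < E.aR E.hi := by
  obtain ⟨γ, hγ0, hγ⟩ := hE.UR_cross
  refine lt_of_le_of_ne hE.A_nonempty fun heq => ?_
  have h := hE.UR1_growth hγ (left_mem_Icc.2 hE.A_nonempty) hE.lo_mem hE.hi_mem hE.lo_lt_hi.le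
  rw [hE.UR1_aR hE.lo_mem, heq, hE.UR1_aR hE.hi_mem] at h
  nlinarith [hE.lo_lt_hi]

theorem uniqueDiffOn_A (hE : E.Assumptions) : UniqueDiffOn ℝ E.A :=
  uniqueDiffOn_Icc hE.aR_lo_lt_hi

theorem aR_mem (hE : E.Assumptions) {θ : ℝ} (hθ : θ ∈ E.Θ) : E.aR θ ∈ E.A := by
  obtain ⟨γ, hγ0, hγ⟩ := hE.UR_cross
  have h1 := hE.UR1_growth hγ (left_mem_Icc.2 hE.A_nonempty) hE.lo_mem hθ hθ.1
  have h2 := hE.UR1_growth hγ (right_mem_Icc.2 hE.A_nonempty) hθ hE.hi_mem hθ.2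
  rw [hE.UR1_aR hE.lo_mem] at h1
  rw [hE.UR1_aR hE.hi_mem] at h2
  have h3 := mul_nonneg hγ0.le (sub_nonneg.2 hθ.1)
  have h4 := mul_nonneg hγ0.le (sub_nonneg.2 hθ.2)
  have hc : ContinuousOn (fun x => E.UR1 x θ) (Icc (E.aR E.lo) (E.aR E.hi)) := fun x _ =>
    ((hE.UR11_eq hθ x).1).continuousAt.continuousWithinAt
  obtain ⟨a, ha, ha0⟩ := intermediate_value_Icc' hE.A_nonempty hc
    (show (0 : ℝ) ∈ Icc _ _ from ⟨by linarith, by linarith⟩)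
  rwa [← hE.eq_aR hθ ha0]

theorem isCompact_A_prod_Θ : IsCompact (E.A ×ˢ E.Θ) := isCompact_Icc.prod isCompact_Icc

theorem convex_A_prod_Θ : Convex ℝ (E.A ×ˢ E.Θ) := (convex_Icc _ _).prod (convex_Icc _ _)

theorem continuousOn_UR1 (hE : E.Assumptions) :
    ContinuousOn (fun p : ℝ × ℝ => E.UR1 p.1 p.2) (univ ×ˢ E.Θ) := hE.contDiffOn_UR1.continuousOn

theorem continuousOn_UR (hE : E.Assumptions) :
    ContinuousOn (fun p : ℝ × ℝ => E.UR p.1 p.2) (univ ×ˢ E.Θ) := hE.UR_smooth.continuousOn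

/-- First-order condition for a best response to a belief. -/
theorem integral_UR1_eq_zero (hE : E.Assumptions) {μ : Measure ℝ} [IsProbabilityMeasure μ]
    (hμ : μ E.Θᶜ = 0) {a : ℝ} (hmax : ∀ x, ∫ θ, E.UR x θ ∂μ ≤ ∫ θ, E.UR a θ ∂μ) :
    ∫ θ, E.UR1 a θ ∂μ = 0 := by
  have hae : ∀ᵐ θ ∂μ, θ ∈ E.Θ := hμ
  have hμr : μ.restrict E.Θ = μ := Measure.restrict_eq_self_of_ae_mem hae
  have hmeas : ∀ {g : ℝ → ℝ}, ContinuousOn g E.Θ → AEStronglyMeasurable g μ := fun hg => by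
    rw [← hμr]; exact hg.aestronglyMeasurable measurableSet_Icc
  have hUR : ∀ x, ContinuousOn (fun θ => E.UR x θ) E.Θ := fun x =>
    hE.continuousOn_UR.comp (f := fun θ => (x, θ)) (by fun_prop) fun θ hθ => ⟨mem_univ _, hθ⟩
  have hUR1 : ∀ x, ContinuousOn (fun θ => E.UR1 x θ) E.Θ := fun x =>
    hE.continuousOn_UR1.comp (f := fun θ => (x, θ)) (by fun_prop) fun θ hθ => ⟨mem_univ _, hθ⟩
  obtain ⟨C, hC0, hC⟩ := exists_bound_of_continuousOn
    ((isCompact_Icc (a := a - 1) (b := a + 1)).prod (isCompact_Icc (a := E.lo) (b := E.hi)))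
    (hE.continuousOn_UR1.mono (prod_mono (subset_univ _) subset_rfl))
  obtain ⟨B, hB0, hB⟩ := exists_bound_of_continuousOn isCompact_Icc (hUR a)
  have hint : Integrable (fun θ => E.UR a θ) μ :=
    Integrable.of_bound (hmeas (hUR a)) B (hae.mono fun θ hθ => hB θ hθ)
  have hd := (hasDerivAt_integral_of_dominated_loc_of_deriv_le (μ := μ) (x₀ := a)
    (F := fun x θ => E.UR x θ) (F' := fun x θ => E.UR1 x θ) (bound := fun _ => C)
    (Metric.ball_mem_nhds a one_pos) (Eventually.of_forall fun x => hmeas (hUR x)) hint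
    (hmeas (hUR1 a))
    (hae.mono fun θ hθ x hx => hC (x, θ) ⟨by
      rw [Real.ball_eq_Ioo] at hx; exact Ioo_subset_Icc_self hx, hθ⟩)
    (integrable_const C) (hae.mono fun θ hθ x _ => hE.hasDerivAt_UR hθ x)).2
  -- The best reply is taken over all real actions, so the condition is an equality even if `a` is
  -- an end of `A`.
  have hloc : IsLocalMax (fun x => ∫ θ, E.UR x θ ∂μ) a := Eventually.of_forall hmax
  exact hloc.hasDerivAt_eq_zero hd

end Assumptions

/-- Quantitative estimates for the receiver's payoff and the prior. -/
structure ReceiverBounds (E : Model) (K κ : ℝ) : Prop where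
  K_one : 1 ≤ K
  κ_pos : 0 < κ
  f_lower : ∀ θ ∈ E.Θ, κ ≤ E.f θ
  f_upper : ∀ θ ∈ E.Θ, E.f θ ≤ K
  UR_bound : ∀ a ∈ E.A, ∀ θ ∈ E.Θ, |E.UR a θ| ≤ K
  UR_lip : ∀ a ∈ E.A, ∀ a' ∈ E.A, ∀ θ ∈ E.Θ, |E.UR a' θ - E.UR a θ| ≤ K * |a' - a|
  UR_quad : ∀ a ∈ E.A, ∀ θ ∈ E.Θ, κ * (a - E.aR θ) ^ 2 ≤ E.UR (E.aR θ) θ - E.UR a θ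
  UR1_lip : ∀ a ∈ E.A, ∀ a' ∈ E.A, ∀ θ ∈ E.Θ, ∀ θ' ∈ E.Θ,
    |E.UR1 a' θ' - E.UR1 a θ| ≤ K * (|a' - a| + |θ' - θ|)
  UR1_taylor : ∀ a ∈ E.A, ∀ a' ∈ E.A, ∀ θ ∈ E.Θ, ∀ θ' ∈ E.Θ,
    |E.UR1 a' θ' - E.UR1 a θ - (E.UR11 a θ * (a' - a) + E.UR12 a θ * (θ' - θ))| ≤
      K * (|a' - a| + |θ' - θ|) ^ 2
  UR11_le : ∀ a ∈ E.A, ∀ θ ∈ E.Θ, E.UR11 a θ ≤ -κ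
  UR12_ge : ∀ a ∈ E.A, ∀ θ ∈ E.Θ, κ ≤ E.UR12 a θ
  UR11_bound : ∀ a ∈ E.A, ∀ θ ∈ E.Θ, |E.UR11 a θ| ≤ K
  UR12_bound : ∀ a ∈ E.A, ∀ θ ∈ E.Θ, |E.UR12 a θ| ≤ K
  aR_growth : ∀ θ ∈ E.Θ, ∀ θ' ∈ E.Θ, θ ≤ θ' → κ * (θ' - θ) ≤ E.aR θ' - E.aR θ
  aR_lip : ∀ θ ∈ E.Θ, ∀ θ' ∈ E.Θ, |E.aR θ' - E.aR θ| ≤ K * |θ' - θ|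
  A_width : ∀ a ∈ E.A, ∀ a' ∈ E.A, |a' - a| ≤ K

/-- All constants come from compactness of `A × Θ`. The bounds on `aR` come from playing the growth
of `UR1` in the state against its decay in the action, so `aR` need not be differentiated. -/
theorem Assumptions.exists_receiverBounds (hE : E.Assumptions) :
    ∃ K κ, E.ReceiverBounds K κ := by
  obtain ⟨η, hη0, hη⟩ := hE.UR_curv
  obtain ⟨γ, hγ0, hγ⟩ := hE.UR_cross
  have hud : UniqueDiffOn ℝ ((univ : Set ℝ) ×ˢ E.Θ) := uniqueDiffOn_univ.prod hE.uniqueDiffOn_Θ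
  have hsub : E.A ×ˢ E.Θ ⊆ univ ×ˢ E.Θ := prod_mono (subset_univ _) subset_rfl
  obtain ⟨C0, hC00, hC0⟩ := exists_bound_of_continuousOn Assumptions.isCompact_A_prod_Θ
    (hE.continuousOn_UR.mono hsub)
  obtain ⟨C1, hC10, hC1⟩ := exists_lipschitz_of_contDiffOn hud
    (hE.UR_smooth.of_le (by norm_num)) hsub Assumptions.isCompact_A_prod_Θ
    Assumptions.convex_A_prod_Θ
  obtain ⟨C2, hC20, hC2⟩ := exists_lipschitz_of_contDiffOn hud
    (hE.contDiffOn_UR1.of_le (by norm_num)) hsub Assumptions.isCompact_A_prod_Θ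
    Assumptions.convex_A_prod_Θ
  obtain ⟨C3, hC30, hC3⟩ := exists_taylor_of_contDiffOn hud
    (hE.contDiffOn_UR1.of_le (by norm_num)) hsub Assumptions.isCompact_A_prod_Θ
    Assumptions.convex_A_prod_Θ
  obtain ⟨C4, hC40, hC4⟩ := exists_bound_of_continuousOn Assumptions.isCompact_A_prod_Θ
    ((hE.contDiffOn_UR1.continuousOn_fderivWithin hud (by norm_num)).mono hsub)
  obtain ⟨C5, hC50, hC5⟩ := exists_bound_of_continuousOn isCompact_Icc hE.f_cont
  obtain ⟨θm, hθm, hmin⟩ := (isCompact_Icc (a := E.lo) (b := E.hi)).exists_isMinOn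
    ⟨E.lo, hE.lo_mem⟩ hE.f_cont
  have hfm := hE.f_pos θm hθm
  -- From `θ` to `θ'` the marginal payoff at `aR θ` rises by at most `C2 * (θ' - θ)`; at decay rate
  -- `η` this is used up within `C2 / η * (θ' - θ)`.
  have hup : ∀ θ ∈ E.Θ, ∀ θ' ∈ E.Θ, θ ≤ θ' → 0 ≤ E.aR θ' - E.aR θ →
      E.aR θ' - E.aR θ ≤ C2 / η * (θ' - θ) := fun θ hθ θ' hθ' hle hpos => by
    have h1 := hE.UR1_decay hη (hE.aR_mem hθ) (hE.aR_mem hθ') hθ' (by linarith)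
    have h2 := hC2 (E.aR θ, θ) ⟨hE.aR_mem hθ, hθ⟩ (E.aR θ, θ') ⟨hE.aR_mem hθ, hθ'⟩
    have h3 := norm_prod_le_add 0 (θ' - θ)
    rw [hE.UR1_aR hθ'] at h1
    simp only [hE.UR1_aR hθ, sub_zero, Prod.mk_sub_mk, sub_self, abs_zero, zero_add,
      abs_of_nonneg (sub_nonneg.2 hle)] at h2 h3
    have h4 := h2.trans (mul_le_mul_of_nonneg_left h3 hC20)
    have h5 := (le_abs_self _).trans h4
    rw [div_mul_eq_mul_div, le_div_iff₀ hη0]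
    linarith
  have hdown : ∀ θ ∈ E.Θ, ∀ θ' ∈ E.Θ, θ ≤ θ' →
      γ / (C2 + 1) * (θ' - θ) ≤ E.aR θ' - E.aR θ := fun θ hθ θ' hθ' hle => by
    have h1 := hE.UR1_growth hγ (hE.aR_mem hθ) hθ hθ' hle
    rw [hE.UR1_aR hθ] at h1
    have h2 := hC2 (E.aR θ, θ') ⟨hE.aR_mem hθ, hθ'⟩ (E.aR θ', θ') ⟨hE.aR_mem hθ', hθ'⟩
    have h3 := norm_prod_le_add (E.aR θ' - E.aR θ) 0
    simp only [hE.UR1_aR hθ', zero_sub, Prod.mk_sub_mk, sub_self, abs_zero, add_zero,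
      norm_neg] at h2 h3
    -- If `aR θ' < aR θ`, then in state `θ'` the marginal payoff at `aR θ` would be negative by
    -- decay in the action and nonnegative by growth in the state.
    have hpos : 0 ≤ E.aR θ' - E.aR θ := by
      by_contra hneg
      push Not at hneg
      have h4 := hE.UR1_decay hη (hE.aR_mem hθ') (hE.aR_mem hθ) hθ' (by linarith)
      rw [hE.UR1_aR hθ'] at h4
      have := mul_nonneg hγ0.le (sub_nonneg.2 hle)
      nlinarith
    have h5 := (le_abs_self _).trans (h2.trans (mul_le_mul_of_nonneg_left h3 hC20))
    rw [abs_of_nonneg hpos] at h5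
    rw [div_mul_eq_mul_div, div_le_iff₀ (by linarith)]
    linarith
  set K := 1 + C0 + C1 + C2 + C3 + C4 + C5 + C2 / η + (E.aR E.hi - E.aR E.lo) with hK
  set κ := min (min (E.f θm) (η / 2)) (min γ (γ / (C2 + 1))) with hκ
  have hη' : 0 ≤ C2 / η := by positivity
  have hw := hE.aR_lo_lt_hi
  have hκ1 : κ ≤ E.f θm := (min_le_left _ _).trans (min_le_left _ _)
  have hκ2 : κ ≤ η / 2 := (min_le_left _ _).trans (min_le_right _ _)
  have hκ3 : κ ≤ γ := (min_le_right _ _).trans (min_le_left _ _)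
  have hκ4 : κ ≤ γ / (C2 + 1) := (min_le_right _ _).trans (min_le_right _ _)
  refine ⟨K, κ, ?_⟩
  constructor
  · linarith
  · rw [hκ]; positivity
  · exact fun θ hθ => hκ1.trans (hmin hθ)
  · intro θ hθ
    have := (le_abs_self _).trans (hC5 θ hθ)
    linarith
  · intro a ha θ hθ
    have := hC0 (a, θ) ⟨ha, hθ⟩
    rw [Real.norm_eq_abs] at this
    dsimp only at this
    linarith
  · intro a ha a' ha' θ hθ
    have h1 := hC1 (a, θ) ⟨ha, hθ⟩ (a', θ) ⟨ha', hθ⟩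
    have h2 := norm_prod_le_add (a' - a) 0
    simp only [Prod.mk_sub_mk, sub_self, abs_zero, add_zero, Real.norm_eq_abs] at h1 h2
    refine h1.trans (mul_le_mul (by linarith) h2 (norm_nonneg _) (by linarith))
  · intro a ha θ hθ
    have h1 := le_of_deriv_decreasing (convex_Icc (E.aR E.lo) (E.aR E.hi)) (κ := η)
      (g := fun x => E.UR x θ) (g' := fun x => E.UR1 x θ)
      (fun z _ => (hE.hasDerivAt_UR hθ z).hasDerivWithinAt)
      (fun x hx y hy h => hE.UR1_decay hη hx hy hθ h) (hE.aR_mem hθ) ha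
    rw [hE.UR1_aR hθ] at h1
    nlinarith [sq_nonneg (a - E.aR θ)]
  · intro a ha a' ha' θ hθ θ' hθ'
    have h1 := hC2 (a, θ) ⟨ha, hθ⟩ (a', θ') ⟨ha', hθ'⟩
    have h2 := norm_prod_le_add (a' - a) (θ' - θ)
    simp only [Prod.mk_sub_mk, Real.norm_eq_abs] at h1
    refine h1.trans (mul_le_mul (by linarith) h2 (norm_nonneg _) (by linarith))
  · intro a ha a' ha' θ hθ θ' hθ'
    have h1 := hC3 (a, θ) ⟨ha, hθ⟩ (a', θ') ⟨ha', hθ'⟩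
    have h2 := norm_prod_le_add (a' - a) (θ' - θ)
    have h3 : ((a' - a, θ' - θ) : ℝ × ℝ) = (a' - a) • ((1 : ℝ), (0 : ℝ)) +
        (θ' - θ) • ((0 : ℝ), (1 : ℝ)) := by simp
    simp only [Prod.mk_sub_mk, Real.norm_eq_abs] at h1
    rw [h3, map_add, map_smul, map_smul, (hE.UR11_eq hθ a).2, (hE.UR12_eq hθ a).2, ← h3] at h1
    rw [mul_comm (E.UR11 a θ), mul_comm (E.UR12 a θ)]
    refine h1.trans (mul_le_mul (by linarith) ?_ (by positivity) (by linarith))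
    gcongr
  · exact fun a ha θ hθ => (hη a ha θ hθ).trans (by linarith)
  · exact fun a ha θ hθ => hκ3.trans (hγ a ha θ hθ)
  · intro a ha θ hθ
    rw [← (hE.UR11_eq hθ a).2]
    refine ((ContinuousLinearMap.le_opNorm _ _).trans
      (mul_le_mul (hC4 (a, θ) ⟨ha, hθ⟩) (norm_prod_le_add _ _) (norm_nonneg _) hC40)).trans ?_
    simp; linarith
  · intro a ha θ hθ
    rw [← (hE.UR12_eq hθ a).2]
    refine ((ContinuousLinearMap.le_opNorm _ _).trans
      (mul_le_mul (hC4 (a, θ) ⟨ha, hθ⟩) (norm_prod_le_add _ _) (norm_nonneg _) hC40)).trans ?_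
    simp; linarith
  · exact fun θ hθ θ' hθ' hle =>
      (mul_le_mul_of_nonneg_right hκ4 (sub_nonneg.2 hle)).trans (hdown θ hθ θ' hθ' hle)
  · have key : ∀ θ ∈ E.Θ, ∀ θ' ∈ E.Θ, θ ≤ θ' → |E.aR θ' - E.aR θ| ≤ K * |θ' - θ| := by
      intro θ hθ θ' hθ' hle
      have h0 : 0 ≤ E.aR θ' - E.aR θ := (mul_nonneg (by positivity) (sub_nonneg.2 hle)).trans
        (hdown θ hθ θ' hθ' hle)
      rw [abs_of_nonneg h0, abs_of_nonneg (sub_nonneg.2 hle)]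
      exact (hup θ hθ θ' hθ' hle h0).trans
        (mul_le_mul_of_nonneg_right (by linarith) (sub_nonneg.2 hle))
    intro θ hθ θ' hθ'
    rcases le_total θ θ' with h | h
    · exact key θ hθ θ' hθ' h
    · rw [abs_sub_comm, abs_sub_comm θ']
      exact key θ' hθ' θ hθ h
  · intro a ha a' ha'
    rw [abs_le]
    constructor <;> linarith [ha.1, ha.2, ha'.1, ha'.2]

end Model

theorem norm_triple_le_add (x y z : ℝ) : ‖((x, y, z) : ℝ × ℝ × ℝ)‖ ≤ |x| + |y| + |z| := by
  rw [Prod.norm_def]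
  exact max_le (by rw [Real.norm_eq_abs]; linarith [abs_nonneg y, abs_nonneg z])
    ((norm_prod_le_add y z).trans (by linarith [abs_nonneg x]))

/-! ### The sender: payoff, bias and reporting cost -/

namespace Model

variable {E : Model}

namespace Assumptions

theorem uniqueDiffOn_states (hE : E.Assumptions) : UniqueDiffOn ℝ (E.Θ ×ˢ Icc 0 E.d₀) :=
  hE.uniqueDiffOn_Θ.prod (uniqueDiffOn_Icc hE.d₀_pos)

theorem uniqueDiffOn_box (hE : E.Assumptions) : UniqueDiffOn ℝ (E.A ×ˢ E.Θ ×ˢ Icc 0 E.d₀) :=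
  hE.uniqueDiffOn_A.prod hE.uniqueDiffOn_states

theorem isCompact_box : IsCompact (E.A ×ˢ E.Θ ×ˢ Icc 0 E.d₀) :=
  isCompact_Icc.prod (isCompact_Icc.prod isCompact_Icc)

theorem convex_box : Convex ℝ (E.A ×ˢ E.Θ ×ˢ Icc 0 E.d₀) :=
  (convex_Icc _ _).prod ((convex_Icc _ _).prod (convex_Icc _ _))

theorem contDiffOn_US1 (hE : E.Assumptions) :
    ContDiffOn ℝ 3 (fun p : ℝ × ℝ × ℝ => E.US1 p.1 p.2.1 p.2.2) (E.A ×ˢ E.Θ ×ˢ Icc 0 E.d₀) :=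
  contDiffOn_slice_fst (m := 3) hE.uniqueDiffOn_A hE.uniqueDiffOn_states hE.US_smooth
    (by norm_num)

theorem hasDerivWithinAt_US (hE : E.Assumptions) {a θ d : ℝ} (ha : a ∈ E.A) (hθ : θ ∈ E.Θ)
    (hd : d ∈ Icc 0 E.d₀) : HasDerivWithinAt (fun x => E.US x θ d) (E.US1 a θ d) E.A a :=
  (hasDerivWithinAt_slice_fst (hE.US_smooth.differentiableOn (by simp))
    (p := (a, θ, d)) ⟨ha, hθ, hd⟩).differentiableWithinAt.hasDerivWithinAt

theorem US11_eq (hE : E.Assumptions) {a θ d : ℝ} (ha : a ∈ E.A) (hθ : θ ∈ E.Θ)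
    (hd : d ∈ Icc 0 E.d₀) :
    HasDerivWithinAt (fun x => E.US1 x θ d) (E.US11 a θ d) E.A a ∧
    fderivWithin ℝ (fun p : ℝ × ℝ × ℝ => E.US1 p.1 p.2.1 p.2.2) (E.A ×ˢ E.Θ ×ˢ Icc 0 E.d₀)
      (a, θ, d) (1, 0) = E.US11 a θ d := by
  have h := hasDerivWithinAt_slice_fst (hE.contDiffOn_US1.differentiableOn (by simp))
    (p := (a, θ, d)) ⟨ha, hθ, hd⟩
  exact ⟨h.differentiableWithinAt.hasDerivWithinAt, (h.derivWithin (hE.uniqueDiffOn_A a ha)).symm⟩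

/-- Monotonicity of the sender's marginal payoff in the action. -/
theorem US1_decay (hE : E.Assumptions) {η : ℝ}
    (hη : ∀ a ∈ E.A, ∀ θ ∈ E.Θ, ∀ d ∈ Icc 0 E.d₀, E.US11 a θ d ≤ -η) {a a' θ d : ℝ}
    (ha : a ∈ E.A) (ha' : a' ∈ E.A) (hθ : θ ∈ E.Θ) (hd : d ∈ Icc 0 E.d₀) (h : a ≤ a') :
    E.US1 a' θ d ≤ E.US1 a θ d - η * (a' - a) := by
  have hsub : Icc a a' ⊆ E.A := Icc_subset_Icc ha.1 ha'.2
  have := growth_of_hasDerivWithinAt (g := fun x => -E.US1 x θ d) (κ := η) h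
    (fun z hz => (((hE.US11_eq (hsub hz) hθ hd).1).neg).mono hsub)
    (fun z hz => by linarith [hη z (hsub hz) θ hθ d hd])
  linarith

/-- The reporting cost dominates a quadratic. -/
theorem exists_cost_lower (hE : E.Assumptions) : ∃ κ > 0, ∀ u, κ * u ^ 2 ≤ E.c * E.φ u := by
  obtain ⟨κ₁, κ₂, hκ, h⟩ := hE.φ_curv
  have hd1 : ∀ z, HasDerivAt E.φ (deriv E.φ z) z := fun z =>
    ((hE.φ_smooth.differentiable (by simp)) z).hasDerivAt
  have hd2 : ∀ z, HasDerivAt (deriv E.φ) (iteratedDeriv 2 E.φ z) z := fun z => by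
    have h2 : ContDiff ℝ 4 (deriv E.φ) :=
      ((contDiff_succ_iff_deriv (n := 4)).1 (hE.φ_smooth.of_le (by norm_num))).2.2
    have := (h2.differentiable (by simp) z).hasDerivAt
    simpa [iteratedDeriv_succ, iteratedDeriv_zero] using this
  refine ⟨E.c * (κ₁ / 2), mul_pos hE.c_pos (by positivity), fun u => ?_⟩
  have := le_of_deriv_decreasing convex_univ (κ := κ₁) (g := fun z => -E.φ z)
    (g' := fun z => -deriv E.φ z) (fun z _ => (hd1 z).neg.hasDerivWithinAt)
    (fun x _ y _ hxy => by
      have := growth_of_hasDerivWithinAt (κ := κ₁) hxy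
        (fun z _ => (hd2 z).hasDerivWithinAt) (fun z _ => (h z).1)
      linarith) (mem_univ 0) (mem_univ u)
  simp only [hE.φ_zero, hE.φ_deriv_zero, neg_zero, zero_mul, sub_zero, zero_add, zero_sub] at this
  rw [mul_assoc]
  exact mul_le_mul_of_nonneg_left (by linarith) hE.c_pos.le

theorem continuous_φ (hE : E.Assumptions) : Continuous E.φ := hE.φ_smooth.continuous

theorem continuousOn_US (hE : E.Assumptions) :
    ContinuousOn (fun p : ℝ × ℝ × ℝ => E.US p.1 p.2.1 p.2.2) (E.A ×ˢ E.Θ ×ˢ Icc 0 E.d₀) :=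
  hE.US_smooth.continuousOn

theorem D_self (hE : E.Assumptions) (b : ℝ) : E.D b b = 0 := by
  simp [D, hE.φ_zero]

/-- For small misalignment the sender wants a higher action than the receiver. -/
theorem exists_US1_pos (hE : E.Assumptions) :
    ∃ d₁ ∈ Ioc 0 E.d₀, ∀ d ∈ Ioo 0 d₁, ∀ θ ∈ E.Θ, 0 < E.US1 (E.aR θ) θ d := by
  obtain ⟨η, hη0, hη⟩ := hE.US_curv
  obtain ⟨δ, hδ, hδ'⟩ := hE.bias
  obtain ⟨θm, hθm, hmin⟩ := (isCompact_Icc (a := E.lo) (b := E.hi)).exists_isMinOn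
    ⟨E.lo, hE.lo_mem⟩ hδ.continuousOn
  have hm := (hδ' θm hθm).1
  obtain ⟨C, hC0, hC⟩ := exists_taylor_of_contDiffOn hE.uniqueDiffOn_box
    (hE.contDiffOn_US1.of_le (by norm_num)) subset_rfl isCompact_box convex_box
  have h0 : (0 : ℝ) ∈ Icc 0 E.d₀ := left_mem_Icc.2 hE.d₀_pos.le
  -- In `d`, the marginal payoff at `aR θ` is a linear term of slope at least `η * δ θm` plus a
  -- remainder of at most `C * d ^ 2`; the linear term wins below this threshold. `C + 1` keeps the
  -- denominator positive.
  refine ⟨min E.d₀ (η * δ θm / (C + 1)), ⟨lt_min hE.d₀_pos (by positivity), min_le_left _ _⟩, ?_⟩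
  intro d hd θ hθ
  have hdm : d ∈ Icc 0 E.d₀ := ⟨hd.1.le, hd.2.le.trans (min_le_left _ _)⟩
  have hp : (E.aR θ, θ, (0 : ℝ)) ∈ E.A ×ˢ E.Θ ×ˢ Icc 0 E.d₀ := ⟨hE.aR_mem hθ, hθ, h0⟩
  have h1 := hC _ hp (E.aR θ, θ, d) ⟨hE.aR_mem hθ, hθ, hdm⟩
  have hder : HasDerivWithinAt (fun d => E.US1 (E.aR θ) θ d)
      (fderivWithin ℝ (fun p : ℝ × ℝ × ℝ => E.US1 p.1 p.2.1 p.2.2) (E.A ×ˢ E.Θ ×ˢ Icc 0 E.d₀)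
        (E.aR θ, θ, 0) (0, 0, 1)) (Icc 0 E.d₀) 0 := by
    have hf := (hE.contDiffOn_US1.differentiableOn (by simp) _ hp).hasFDerivWithinAt
    have hi : HasDerivWithinAt (fun x : ℝ => (E.aR θ, θ, x)) ((0 : ℝ), (0 : ℝ), (1 : ℝ))
        (Icc 0 E.d₀) 0 := ((hasDerivAt_const (0 : ℝ) (E.aR θ)).prodMk
          ((hasDerivAt_const (0 : ℝ) θ).prodMk (hasDerivAt_id (0 : ℝ)))).hasDerivWithinAt
    exact HasFDerivWithinAt.comp_hasDerivWithinAt (t := E.A ×ˢ E.Θ ×ˢ Icc 0 E.d₀) (0 : ℝ) hf hi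
      (fun x hx => ⟨hE.aR_mem hθ, hθ, hx⟩)
  have hval := (hder.derivWithin (uniqueDiffOn_Icc hE.d₀_pos 0 h0)).symm.trans
    ((hδ' θ hθ).2.derivWithin (uniqueDiffOn_Icc hE.d₀_pos 0 h0))
  have he : ((E.aR θ, θ, d) : ℝ × ℝ × ℝ) - (E.aR θ, θ, 0) = d • ((0 : ℝ), (0 : ℝ), (1 : ℝ)) := by
    simp
  have hn : ‖d • ((0 : ℝ), (0 : ℝ), (1 : ℝ))‖ ≤ d := by
    have := norm_triple_le_add 0 0 1
    rw [norm_smul, Real.norm_eq_abs, abs_of_pos hd.1]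
    simp only [abs_zero, abs_one, zero_add] at this
    nlinarith [hd.1]
  rw [he, map_smul, hval, smul_eq_mul] at h1
  simp only [hE.aligned θ hθ, sub_zero, Real.norm_eq_abs] at h1
  have h2 : C * ‖d • ((0 : ℝ), (0 : ℝ), (1 : ℝ))‖ ^ 2 ≤ C * d ^ 2 := by gcongr
  have h3 := (abs_le.1 (h1.trans h2)).1
  have h4 : η * δ θm ≤ -E.US11 (E.aR θ) θ 0 * δ θ := by
    have := hη _ (hE.aR_mem hθ) θ hθ 0 h0
    exact mul_le_mul (by linarith) (hmin hθ) hm.le (by linarith)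
  have h5 : d * (C + 1) < η * δ θm := by
    rw [← lt_div_iff₀ (by linarith)]; exact hd.2.trans_le (min_le_right _ _)
  have h6 := mul_le_mul_of_nonneg_left h4 hd.1.le
  nlinarith [mul_lt_mul_of_pos_left h5 hd.1, hd.1, sq_nonneg d]

end Assumptions

/-- Quantitative estimates for the sender's payoff and the reporting cost. -/
structure SenderBounds (E : Model) (K κ : ℝ) : Prop where
  K_one : 1 ≤ K
  κ_pos : 0 < κ
  US_bound : ∀ a ∈ E.A, ∀ θ ∈ E.Θ, ∀ d ∈ Icc 0 E.d₀, |E.US a θ d| ≤ K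
  US_lip : ∀ a ∈ E.A, ∀ a' ∈ E.A, ∀ θ ∈ E.Θ, ∀ θ' ∈ E.Θ, ∀ d ∈ Icc 0 E.d₀,
    |E.US a' θ' d - E.US a θ d| ≤ K * (|a' - a| + |θ' - θ|)
  US1_lip : ∀ a ∈ E.A, ∀ a' ∈ E.A, ∀ θ ∈ E.Θ, ∀ θ' ∈ E.Θ, ∀ d ∈ Icc 0 E.d₀,
    |E.US1 a' θ' d - E.US1 a θ d| ≤ K * (|a' - a| + |θ' - θ|)
  US1_bound : ∀ a ∈ E.A, ∀ θ ∈ E.Θ, ∀ d ∈ Icc 0 E.d₀, |E.US1 a θ d| ≤ K * (|a - E.aR θ| + d)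
  US_mvt : ∀ e, ∀ a ∈ E.A, ∀ a' ∈ E.A, ∀ θ ∈ E.Θ, ∀ d ∈ Icc 0 E.d₀, |a - E.aR θ| ≤ e →
    |a' - E.aR θ| ≤ e → |E.US a' θ d - E.US a θ d| ≤ K * (e + d) * |a' - a|
  US_quad : ∀ a ∈ E.A, ∀ a' ∈ E.A, ∀ θ ∈ E.Θ, ∀ d ∈ Icc 0 E.d₀,
    E.US a' θ d ≤ E.US a θ d + E.US1 a θ d * (a' - a) - κ * (a' - a) ^ 2
  US_third : ∀ a ∈ E.A, ∀ a' ∈ E.A, ∀ θ ∈ E.Θ, ∀ d ∈ Icc 0 E.d₀,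
    |E.US a' θ d - E.US a θ d - E.US1 a θ d * (a' - a) - E.US11 a θ d / 2 * (a' - a) ^ 2| ≤
      K * |a' - a| ^ 3
  US11_le : ∀ a ∈ E.A, ∀ θ ∈ E.Θ, ∀ d ∈ Icc 0 E.d₀, E.US11 a θ d ≤ -κ
  D_ge : ∀ r b, κ * (r - b) ^ 2 ≤ E.D r b

/-- Compactness again, plus alignment: `US1` vanishes at `(aR θ, θ, 0)`, so its Lipschitz bound
gives `|US1| ≤ K * (|a - aR θ| + d)`. Thus the sender's payoff is nearly flat near the receiver's
ideal action when `d` is small. -/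
theorem Assumptions.exists_senderBounds (hE : E.Assumptions) : ∃ K κ, E.SenderBounds K κ := by
  obtain ⟨η, hη0, hη⟩ := hE.US_curv
  obtain ⟨κ₁, hκ0, hκ1⟩ := hE.exists_cost_lower
  have hud := hE.uniqueDiffOn_box
  obtain ⟨C0, hC00, hC0⟩ := exists_bound_of_continuousOn Assumptions.isCompact_box
    hE.continuousOn_US
  obtain ⟨C1, hC10, hC1⟩ := exists_lipschitz_of_contDiffOn hud
    (hE.US_smooth.of_le (by norm_num)) subset_rfl Assumptions.isCompact_box Assumptions.convex_box
  obtain ⟨C2, hC20, hC2⟩ := exists_lipschitz_of_contDiffOn hud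
    (hE.contDiffOn_US1.of_le (by norm_num)) subset_rfl Assumptions.isCompact_box
    Assumptions.convex_box
  obtain ⟨C3, hC30, hC3⟩ := exists_taylor_of_contDiffOn hud
    (hE.contDiffOn_US1.of_le (by norm_num)) subset_rfl Assumptions.isCompact_box
    Assumptions.convex_box
  set K := 1 + C0 + C1 + C2 + C3 with hK
  set κ := min (η / 2) κ₁ with hκ
  have hκη : κ ≤ η / 2 := min_le_left _ _
  have h0 : (0 : ℝ) ∈ Icc 0 E.d₀ := left_mem_Icc.2 hE.d₀_pos.le
  have hb1 : ∀ a ∈ E.A, ∀ θ ∈ E.Θ, ∀ d ∈ Icc 0 E.d₀,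
      |E.US1 a θ d| ≤ K * (|a - E.aR θ| + d) := by
    intro a ha θ hθ d hd
    have h1 := hC2 (E.aR θ, θ, 0) ⟨hE.aR_mem hθ, hθ, h0⟩ (a, θ, d) ⟨ha, hθ, hd⟩
    have h2 := norm_triple_le_add (a - E.aR θ) 0 d
    simp only [Prod.mk_sub_mk, hE.aligned θ hθ, sub_zero, sub_self, Real.norm_eq_abs, abs_zero,
      add_zero, abs_of_nonneg hd.1] at h1 h2
    exact h1.trans (mul_le_mul (by linarith) h2 (norm_nonneg _) (by linarith))
  refine ⟨K, κ, ?_⟩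
  constructor
  · linarith
  · rw [hκ]; positivity
  · intro a ha θ hθ d hd
    have := hC0 (a, θ, d) ⟨ha, hθ, hd⟩
    rw [Real.norm_eq_abs] at this
    dsimp only at this
    linarith
  · intro a ha a' ha' θ hθ θ' hθ' d hd
    have h1 := hC1 (a, θ, d) ⟨ha, hθ, hd⟩ (a', θ', d) ⟨ha', hθ', hd⟩
    have h2 := norm_triple_le_add (a' - a) (θ' - θ) 0
    simp only [Prod.mk_sub_mk, sub_self, abs_zero, add_zero, Real.norm_eq_abs] at h1 h2
    exact h1.trans (mul_le_mul (by linarith) h2 (norm_nonneg _) (by linarith))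
  · intro a ha a' ha' θ hθ θ' hθ' d hd
    have h1 := hC2 (a, θ, d) ⟨ha, hθ, hd⟩ (a', θ', d) ⟨ha', hθ', hd⟩
    have h2 := norm_triple_le_add (a' - a) (θ' - θ) 0
    simp only [Prod.mk_sub_mk, sub_self, abs_zero, add_zero, Real.norm_eq_abs] at h1 h2
    exact h1.trans (mul_le_mul (by linarith) h2 (norm_nonneg _) (by linarith))
  · exact hb1
  · intro e a ha a' ha' θ hθ d hd hae hae'
    have hseg : segment ℝ a a' ⊆ E.A := (convex_Icc _ _).segment_subset ha ha'
    refine (convex_segment a a').norm_image_sub_le_of_norm_hasDerivWithin_le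
      (f := fun x => E.US x θ d) (fun z hz => (hE.hasDerivWithinAt_US (hseg hz) hθ hd).mono hseg)
      (fun z hz => ?_) (left_mem_segment ℝ a a') (right_mem_segment ℝ a a')
    refine (hb1 z (hseg hz) θ hθ d hd).trans
      (mul_le_mul_of_nonneg_left (add_le_add_left ?_ d) (by linarith))
    have hconv : Convex ℝ (Icc (E.aR θ - e) (E.aR θ + e)) := convex_Icc _ _
    have := hconv.segment_subset (x := a) (y := a')
      ⟨by linarith [(abs_le.1 hae).1], by linarith [(abs_le.1 hae).2]⟩
      ⟨by linarith [(abs_le.1 hae').1], by linarith [(abs_le.1 hae').2]⟩ hz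
    exact abs_le.2 ⟨by linarith [this.1], by linarith [this.2]⟩
  · intro a ha a' ha' θ hθ d hd
    have := le_of_deriv_decreasing (convex_Icc (E.aR E.lo) (E.aR E.hi)) (κ := η)
      (g := fun x => E.US x θ d) (g' := fun x => E.US1 x θ d)
      (fun z hz => hE.hasDerivWithinAt_US hz hθ hd)
      (fun x hx y hy h => hE.US1_decay hη hx hy hθ hd h) ha ha'
    nlinarith [sq_nonneg (a' - a)]
  · intro a ha a' ha' θ hθ d hd
    have := third_order_of_deriv (convex_Icc (E.aR E.lo) (E.aR E.hi)) (x := a) (y := a') hC30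
      (α := E.US1 a θ d) (β := E.US11 a θ d)
      (g := fun x => E.US x θ d) (g' := fun x => E.US1 x θ d)
      (fun z hz => hE.hasDerivWithinAt_US hz hθ hd) (fun z hz => by
        have h1 := hC3 (a, θ, d) ⟨ha, hθ, hd⟩ (z, θ, d) ⟨hz, hθ, hd⟩
        have h2 : ‖((z - a, 0) : ℝ × ℝ × ℝ)‖ ≤ |z - a| + |(0 : ℝ)| + |(0 : ℝ)| :=
          norm_triple_le_add (z - a) 0 0
        have h3 : ((z - a, 0) : ℝ × ℝ × ℝ) = (z - a) • ((1 : ℝ), (0 : ℝ × ℝ)) := by simp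
        simp only [Prod.mk_sub_mk, sub_self, abs_zero, add_zero, Real.norm_eq_abs] at h1 h2
        rw [h3, map_smul, (hE.US11_eq ha hθ hd).2, ← h3, smul_eq_mul] at h1
        rw [mul_comm (E.US11 a θ d), ← sq_abs (z - a)]
        exact h1.trans (by gcongr)) ha ha'
    exact this.trans (mul_le_mul_of_nonneg_right (by linarith) (by positivity))
  · exact fun a ha θ hθ d hd => (hη a ha θ hθ d hd).trans (by linarith)
  · intro r b
    exact (mul_le_mul_of_nonneg_right (min_le_right _ _) (sq_nonneg _)).trans (hκ1 _)

end Model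

/-- Translations of a `C¹` function with integrable derivative are Lipschitz in `L¹`. -/
theorem integral_abs_translate_le {p p' : ℝ → ℝ} (hp : ∀ x, HasDerivAt p (p' x) x)
    (hc : Continuous p') (hi : Integrable p') (s : ℝ) :
    ∫ x, |p (x + s) - p x| ≤ |s| * ∫ x, |p' x| := by
  have hpc : Continuous p := continuous_iff_continuousAt.2 fun x => (hp x).continuousAt
  -- The increment is the integral of `s * p' (x + τ * s)` over `τ` in `[0, 1]`. In extended
  -- nonnegative integrals Tonelli needs no prior integrability, and translation invariance removes
  -- `τ`.
  have hpt : ∀ x, ‖p (x + s) - p x‖ₑ ≤ ∫⁻ τ in Ioc (0 : ℝ) 1, ‖s * p' (x + τ * s)‖ₑ := fun x => by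
    have hder : ∀ τ ∈ uIcc (0 : ℝ) 1, HasDerivAt (fun τ => p (x + τ * s)) (s * p' (x + τ * s)) τ :=
      fun τ _ => by
        have h1 : HasDerivAt (fun τ : ℝ => x + τ * s) s τ := by
          simpa using ((hasDerivAt_id τ).mul_const s).const_add x
        have := (hp (x + τ * s)).comp τ h1
        rwa [mul_comm] at this
    have h := intervalIntegral.integral_eq_sub_of_hasDerivAt hder
      (by apply Continuous.intervalIntegrable; fun_prop)
    simp only [one_mul, zero_mul, add_zero] at h
    rw [← h, intervalIntegral.integral_of_le zero_le_one]
    exact enorm_integral_le_lintegral_enorm _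
  have hL : ∫⁻ x, ‖p (x + s) - p x‖ₑ ≤ ‖s‖ₑ * ∫⁻ x, ‖p' x‖ₑ := by
    calc ∫⁻ x, ‖p (x + s) - p x‖ₑ
        ≤ ∫⁻ x, ∫⁻ τ in Ioc (0 : ℝ) 1, ‖s * p' (x + τ * s)‖ₑ := lintegral_mono hpt
      _ = ∫⁻ τ in Ioc (0 : ℝ) 1, ∫⁻ x, ‖s * p' (x + τ * s)‖ₑ := by
          refine lintegral_lintegral_swap (Measurable.aemeasurable ?_)
          exact (Continuous.enorm (by fun_prop)).measurable
      _ = ∫⁻ τ in Ioc (0 : ℝ) 1, ‖s‖ₑ * ∫⁻ x, ‖p' x‖ₑ := by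
          refine lintegral_congr fun τ => ?_
          simp only [enorm_mul]
          rw [lintegral_const_mul _ (Continuous.enorm (by fun_prop)).measurable,
            lintegral_add_right_eq_self (fun x => ‖p' x‖ₑ)]
      _ = _ := by simp
  have h1 : ∫ x, |p (x + s) - p x| = (∫⁻ x, ‖p (x + s) - p x‖ₑ).toReal := by
    simp only [← Real.norm_eq_abs]
    exact integral_norm_eq_lintegral_enorm (by
      have : Continuous fun x => p (x + s) - p x := by fun_prop
      exact this.aestronglyMeasurable)
  have h2 : ∫ x, |p' x| = (∫⁻ x, ‖p' x‖ₑ).toReal := by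
    simp only [← Real.norm_eq_abs]
    exact integral_norm_eq_lintegral_enorm hc.aestronglyMeasurable
  rw [h1, h2, ← Real.norm_eq_abs, ← toReal_enorm, ← ENNReal.toReal_mul]
  exact ENNReal.toReal_mono (ENNReal.mul_ne_top enorm_ne_top hi.2.ne) hL

/-! ### Anchor laws and their comparison across states and translations -/

namespace Model

variable {E : Model}

/-- The density of the noise term `σ x` of the anchor. -/
noncomputable def noiseDensity (E : Model) (x : ℝ) : ℝ := E.σ⁻¹ * E.noise (x / E.σ)

/-- The law of the anchor in state `θ`. -/
noncomputable def anchorLaw (E : Model) (θ : ℝ) : Measure ℝ :=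
  volume.withDensity fun b => ENNReal.ofReal (E.q b θ)

theorem q_eq (b θ : ℝ) : E.q b θ = E.noiseDensity (b - E.b₀ θ) := rfl

namespace Assumptions

theorem noiseDensity_pos (hE : E.Assumptions) (x : ℝ) : 0 < E.noiseDensity x :=
  mul_pos (inv_pos.2 hE.σ_pos) (hE.noise_pos _)

theorem continuous_noiseDensity (hE : E.Assumptions) : Continuous E.noiseDensity := by
  have := hE.noise_smooth.continuous
  unfold noiseDensity
  fun_prop

theorem integrable_noiseDensity (hE : E.Assumptions) : Integrable E.noiseDensity :=
  (hE.noise_integrable.comp_div hE.σ_pos.ne').const_mul _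

theorem integral_noiseDensity (hE : E.Assumptions) : ∫ x, E.noiseDensity x = 1 := by
  unfold noiseDensity
  rw [integral_const_mul, Measure.integral_comp_div, hE.noise_mass, abs_of_pos hE.σ_pos]
  have := hE.σ_pos.ne'
  simp [this]

/-- The translation modulus of the noise density in `L¹`. -/
theorem exists_translate_noiseDensity (hE : E.Assumptions) :
    ∃ K, 0 ≤ K ∧ ∀ x y,
      ∫ b, |E.noiseDensity (b - x) - E.noiseDensity (b - y)| ≤ K * |x - y| := by
  have hn : ∀ x, HasDerivAt E.noise (deriv E.noise x) x := fun x =>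
    (hE.noise_smooth.differentiable (by simp) x).hasDerivAt
  have hnc : Continuous (deriv E.noise) := hE.noise_smooth.continuous_deriv (by norm_num)
  have hni : Integrable (deriv E.noise) := by
    simpa [iteratedDeriv_one] using (hE.noise_deriv 1 (by norm_num)).1
  set p' : ℝ → ℝ := fun x => E.σ⁻¹ * (deriv E.noise (x / E.σ) * E.σ⁻¹) with hp'
  have hd : ∀ x, HasDerivAt E.noiseDensity (p' x) x := fun x => by
    have h1 : HasDerivAt (fun x : ℝ => x / E.σ) E.σ⁻¹ x := by
      simpa using (hasDerivAt_id x).div_const E.σ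
    exact ((hn (x / E.σ)).comp x h1).const_mul E.σ⁻¹
  have hpi : Integrable p' := ((hni.comp_div hE.σ_pos.ne').mul_const _).const_mul _
  refine ⟨∫ x, |p' x|, integral_nonneg fun _ => abs_nonneg _, fun x y => ?_⟩
  have h := integral_abs_translate_le hd (by fun_prop) hpi (y - x)
  rw [← integral_sub_right_eq_self _ y, mul_comm, abs_sub_comm y x] at h
  have e : ∀ b, b - y + (y - x) = b - x := fun b => by ring
  simpa only [e] using h

theorem q_pos (hE : E.Assumptions) (b θ : ℝ) : 0 < E.q b θ := hE.noiseDensity_pos _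

theorem integrable_q (hE : E.Assumptions) (θ : ℝ) : Integrable fun b => E.q b θ :=
  hE.integrable_noiseDensity.comp_sub_right _

theorem continuous_q (hE : E.Assumptions) (θ : ℝ) : Continuous fun b => E.q b θ := by
  have := hE.continuous_noiseDensity
  simp only [q_eq]
  fun_prop

theorem integral_q (hE : E.Assumptions) (θ : ℝ) : ∫ b, E.q b θ = 1 := by
  simp only [q_eq]
  rw [integral_sub_right_eq_self (fun b => E.noiseDensity b), hE.integral_noiseDensity]

theorem isProbabilityMeasure_anchorLaw (hE : E.Assumptions) (θ : ℝ) :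
    IsProbabilityMeasure (E.anchorLaw θ) := by
  constructor
  rw [anchorLaw, withDensity_apply _ MeasurableSet.univ, Measure.restrict_univ,
    ← ofReal_integral_eq_lintegral_ofReal (hE.integrable_q θ)
      (Eventually.of_forall fun b => (hE.q_pos b θ).le), hE.integral_q, ENNReal.ofReal_one]

theorem integral_anchorLaw (hE : E.Assumptions) (θ : ℝ) (g : ℝ → ℝ) :
    ∫ b, g b ∂(E.anchorLaw θ) = ∫ b, g b * E.q b θ := by
  rw [anchorLaw, integral_withDensity_eq_integral_toReal_smul
    (hE.continuous_q θ).measurable.ennreal_ofReal (Eventually.of_forall fun _ => by simp)]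
  refine integral_congr_ae (Eventually.of_forall fun b => ?_)
  simp [ENNReal.toReal_ofReal (hE.q_pos b θ).le, mul_comm]

theorem integrable_anchorLaw (hE : E.Assumptions) (θ : ℝ) {g : ℝ → ℝ} {B : ℝ}
    (hg : Measurable g) (hB : ∀ b, |g b| ≤ B) : Integrable g (E.anchorLaw θ) := by
  have := hE.isProbabilityMeasure_anchorLaw θ
  exact Integrable.of_bound hg.aestronglyMeasurable B (Eventually.of_forall hB)

theorem integrable_mul_noiseDensity (hE : E.Assumptions) (x : ℝ) {g : ℝ → ℝ} {B : ℝ}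
    (hg : Measurable g) (hB : ∀ b, |g b| ≤ B) :
    Integrable fun b => g b * E.noiseDensity (b - x) :=
  (hE.integrable_noiseDensity.comp_sub_right x).bdd_mul hg.aestronglyMeasurable
    (Eventually.of_forall hB)

/-- A translation of the integrand moves the centre of the noise from `b₀ θ` to `b₀ θ + s`. Changes
of state and translations are thus the same operation, and one `L¹` modulus controls both. -/
theorem integral_shift_anchorLaw (hE : E.Assumptions) (θ s : ℝ) (g : ℝ → ℝ) :
    ∫ b, g (b + s) ∂(E.anchorLaw θ) = ∫ b, g b * E.noiseDensity (b - (E.b₀ θ + s)) := by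
  rw [hE.integral_anchorLaw, ← integral_sub_right_eq_self _ s]
  simp only [q_eq, sub_add_cancel, sub_sub, add_comm s]

theorem abs_integral_sub_le (hE : E.Assumptions) {K : ℝ}
    (hK : ∀ x y, ∫ b, |E.noiseDensity (b - x) - E.noiseDensity (b - y)| ≤ K * |x - y|)
    {g : ℝ → ℝ} {B : ℝ} (hg : Measurable g) (hB : ∀ b, |g b| ≤ B) (x y : ℝ) :
    |(∫ b, g b * E.noiseDensity (b - x)) - ∫ b, g b * E.noiseDensity (b - y)| ≤
      B * (K * |x - y|) := by
  have hB0 : 0 ≤ B := (abs_nonneg _).trans (hB 0)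
  rw [← integral_sub (hE.integrable_mul_noiseDensity x hg hB)
    (hE.integrable_mul_noiseDensity y hg hB)]
  calc _ ≤ ∫ b, |g b * E.noiseDensity (b - x) - g b * E.noiseDensity (b - y)| :=
        abs_integral_le_integral_abs
    _ ≤ ∫ b, B * |E.noiseDensity (b - x) - E.noiseDensity (b - y)| := by
        refine integral_mono_of_nonneg (Eventually.of_forall fun _ => abs_nonneg _) ?_
          (Eventually.of_forall fun b => ?_)
        · exact (((hE.integrable_noiseDensity.comp_sub_right x).sub
            (hE.integrable_noiseDensity.comp_sub_right y)).abs).const_mul B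
        · dsimp only
          rw [← mul_sub, abs_mul]
          exact mul_le_mul_of_nonneg_right (hB b) (abs_nonneg _)
    _ ≤ _ := by
        rw [integral_const_mul]
        exact mul_le_mul_of_nonneg_left (hK x y) hB0

theorem exists_b₀_bounds (hE : E.Assumptions) : ∃ K, 0 ≤ K ∧ (∀ θ ∈ E.Θ, |E.b₀ θ| ≤ K) ∧
    ∀ θ ∈ E.Θ, ∀ θ' ∈ E.Θ, |E.b₀ θ' - E.b₀ θ| ≤ K * |θ' - θ| := by
  obtain ⟨C, hC0, hC⟩ := exists_lipschitz_of_contDiffOn hE.uniqueDiffOn_Θ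
    (hE.b₀_smooth.of_le (by norm_num)) subset_rfl isCompact_Icc (convex_Icc _ _)
  obtain ⟨B, hB0, hB⟩ := exists_bound_of_continuousOn isCompact_Icc hE.b₀_smooth.continuousOn
  refine ⟨max C B, le_max_of_le_left hC0, fun θ hθ => (hB θ hθ).trans (le_max_right _ _), ?_⟩
  intro θ hθ θ' hθ'
  exact (hC θ hθ θ' hθ').trans (mul_le_mul_of_nonneg_right (le_max_left _ _) (abs_nonneg _))

/-- Lipschitz dependence of expectations over the anchor on the state, and their stability under
translations of the integrand. -/
theorem exists_anchorLaw_lip (hE : E.Assumptions) : ∃ K, 0 ≤ K ∧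
    (∀ θ ∈ E.Θ, ∀ θ' ∈ E.Θ, ∀ (g : ℝ → ℝ) (B : ℝ), Measurable g → (∀ b, |g b| ≤ B) →
      |∫ b, g b ∂(E.anchorLaw θ') - ∫ b, g b ∂(E.anchorLaw θ)| ≤ K * B * |θ' - θ|) ∧
    ∀ θ, ∀ (g : ℝ → ℝ) (B s : ℝ), 0 ≤ s → Measurable g → (∀ b, |g b| ≤ B) →
      |∫ b, g (b + s) ∂(E.anchorLaw θ) - ∫ b, g (b - s) ∂(E.anchorLaw θ)| ≤ K * B * s := by
  obtain ⟨K, hK0, hK⟩ := hE.exists_translate_noiseDensity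
  obtain ⟨C, hC0, -, hC⟩ := hE.exists_b₀_bounds
  refine ⟨K * (C + 2), by positivity, ?_, ?_⟩
  · intro θ hθ θ' hθ' g B hg hB
    have hB0 : 0 ≤ B := (abs_nonneg _).trans (hB 0)
    have h := hE.abs_integral_sub_le hK hg hB (E.b₀ θ') (E.b₀ θ)
    rw [hE.integral_anchorLaw, hE.integral_anchorLaw]
    refine h.trans ?_
    have := mul_le_mul_of_nonneg_left (hC θ hθ θ' hθ') (mul_nonneg hB0 hK0)
    nlinarith [mul_nonneg (mul_nonneg hB0 hK0) (abs_nonneg (θ' - θ))]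
  · intro θ g B s hs hg hB
    have hB0 : 0 ≤ B := (abs_nonneg _).trans (hB 0)
    have h := hE.abs_integral_sub_le hK hg hB (E.b₀ θ + s) (E.b₀ θ + -s)
    have e : E.b₀ θ + s - (E.b₀ θ + -s) = 2 * s := by ring
    rw [e, abs_of_nonneg (show (0 : ℝ) ≤ 2 * s by linarith)] at h
    rw [hE.integral_shift_anchorLaw θ s g]
    simp only [sub_eq_add_neg _ s]
    rw [hE.integral_shift_anchorLaw θ (-s) g]
    refine h.trans ?_
    nlinarith [mul_nonneg (mul_nonneg (mul_nonneg hB0 hK0) hs) hC0]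

/-- Uniform mutual absolute continuity of the anchor laws and their bounded translations. -/
theorem exists_contiguity (hE : E.Assumptions) (M : ℝ) {δ : ℝ} (hδ : 0 < δ) :
    ∃ L > 0, ∀ θ ∈ E.Θ, ∀ θ' ∈ E.Θ, ∀ s s' : ℝ, |s| ≤ M → |s'| ≤ M → ∀ (g : ℝ → ℝ) (B : ℝ),
      Measurable g → (∀ b, 0 ≤ g b) → (∀ b, g b ≤ B) →
      ∫ b, g (b + s) ∂(E.anchorLaw θ) ≤ L * ∫ b, g (b + s') ∂(E.anchorLaw θ') + B * δ := by
  obtain ⟨C, hC0, hC, -⟩ := hE.exists_b₀_bounds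
  have htail : Tendsto (fun T : ℝ => ∫ b in (Icc (-T) T)ᶜ, E.noiseDensity b) atTop (𝓝 0) := by
    have h1 : Tendsto (fun T : ℝ => ∫ b in Icc (-T) T, E.noiseDensity b) atTop (𝓝 1) := by
      rw [← hE.integral_noiseDensity]
      exact (aecover_Icc tendsto_neg_atTop_atBot tendsto_id).integral_tendsto_of_countably_generated
        hE.integrable_noiseDensity
    have h2 : (fun T : ℝ => ∫ b in (Icc (-T) T)ᶜ, E.noiseDensity b) =
        fun T => 1 - ∫ b in Icc (-T) T, E.noiseDensity b := by
      funext T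
      rw [setIntegral_compl measurableSet_Icc hE.integrable_noiseDensity,
        hE.integral_noiseDensity]
    rw [h2]
    simpa using h1.const_sub 1
  -- The noise mass outside `[-T, T]` is below `δ`; it is the source of the additive error `B * δ`.
  obtain ⟨T, hT⟩ := (htail.eventually (gt_mem_nhds hδ)).exists
  set S := C + |M| with hS
  -- Both centres are at most `S` in absolute value, so a point within `T` of one centre is within
  -- `T + 2 * S` of the other.
  set T' := |T| + 2 * S with hT'
  have hS0 : 0 ≤ S := by positivity
  have hT0 : 0 ≤ T' := by positivity
  have hcont : ContinuousOn E.noiseDensity (Icc (-T') T') :=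
    hE.continuous_noiseDensity.continuousOn
  obtain ⟨P, hP0, hP⟩ := exists_bound_of_continuousOn isCompact_Icc hcont
  obtain ⟨x0, hx0, hmin⟩ := (isCompact_Icc (a := -T') (b := T')).exists_isMinOn
    ⟨0, by constructor <;> linarith⟩ hcont
  have hm := hE.noiseDensity_pos x0
  -- The factor exceeds the ratio of an upper bound to the minimum of the density on the enlarged
  -- window; `P + 1` keeps it positive.
  refine ⟨(P + 1) / E.noiseDensity x0, by positivity, ?_⟩
  intro θ hθ θ' hθ' s s' hs hs' g B hg hg0 hgB
  set L := (P + 1) / E.noiseDensity x0 with hL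
  have hL0 : 0 < L := by positivity
  have hgabs : ∀ b, |g b| ≤ B := fun b => by rw [abs_of_nonneg (hg0 b)]; exact hgB b
  have hB0 : 0 ≤ B := (hg0 0).trans (hgB 0)
  rw [hE.integral_shift_anchorLaw, hE.integral_shift_anchorLaw]
  set x := E.b₀ θ + s
  set y := E.b₀ θ' + s'
  have hx : |x| ≤ S := (abs_add_le _ _).trans (add_le_add (hC θ hθ) (hs.trans (le_abs_self M)))
  have hy : |y| ≤ S := (abs_add_le _ _).trans (add_le_add (hC θ' hθ') (hs'.trans (le_abs_self M)))
  set U : Set ℝ := (fun b => b - x) ⁻¹' Icc (-T) T with hU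
  have hUm : MeasurableSet U := measurableSet_Icc.preimage (by fun_prop)
  have hi := hE.integrable_mul_noiseDensity x hg hgabs
  have hj := hE.integrable_mul_noiseDensity y hg hgabs
  rw [← integral_add_compl hUm hi]
  refine add_le_add ?_ ?_
  · calc ∫ b in U, g b * E.noiseDensity (b - x)
        ≤ ∫ b in U, L * (g b * E.noiseDensity (b - y)) := by
          refine setIntegral_mono_on hi.integrableOn (hj.const_mul L).integrableOn hUm ?_
          intro b hb
          have hb' : b - x ∈ Icc (-T) T := hb
          have hbx := abs_le.1 hx
          have hby := abs_le.1 hy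
          have hTT := le_abs_self T
          have h1 : b - x ∈ Icc (-T') T' := ⟨by linarith [hb'.1], by linarith [hb'.2]⟩
          have h2 : b - y ∈ Icc (-T') T' := ⟨by linarith [hb'.1], by linarith [hb'.2]⟩
          have h3 : E.noiseDensity (b - x) ≤ P := (le_abs_self _).trans (hP _ h1)
          have h4 : E.noiseDensity x0 ≤ E.noiseDensity (b - y) := hmin h2
          have h5 : P ≤ L * E.noiseDensity (b - y) := by
            rw [hL, div_mul_eq_mul_div, le_div_iff₀ hm]
            nlinarith
          calc g b * E.noiseDensity (b - x) ≤ g b * (L * E.noiseDensity (b - y)) :=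
                mul_le_mul_of_nonneg_left (h3.trans h5) (hg0 b)
            _ = _ := by ring
      _ ≤ ∫ b, L * (g b * E.noiseDensity (b - y)) :=
          setIntegral_le_integral (hj.const_mul L) (Eventually.of_forall fun b =>
            mul_nonneg hL0.le (mul_nonneg (hg0 b) (hE.noiseDensity_pos _).le))
      _ = _ := integral_const_mul _ _
  · have hn := hE.integrable_noiseDensity.comp_sub_right x
    calc ∫ b in Uᶜ, g b * E.noiseDensity (b - x)
        ≤ ∫ b in Uᶜ, B * E.noiseDensity (b - x) := by
          refine setIntegral_mono hi.integrableOn (hn.const_mul B).integrableOn fun b => ?_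
          exact mul_le_mul_of_nonneg_right (hgB b) (hE.noiseDensity_pos _).le
      _ = B * ∫ b in Uᶜ, E.noiseDensity (b - x) := integral_const_mul _ _
      _ = B * ∫ b in (Icc (-T) T)ᶜ, E.noiseDensity b := by
          congr 1
          have hmp := measurePreserving_sub_right (volume : Measure ℝ) x
          exact hmp.setIntegral_preimage_emb (measurableEmbedding_subRight x) E.noiseDensity
            (Icc (-T) T)ᶜ
      _ ≤ B * δ := mul_le_mul_of_nonneg_left hT.le hB0

end Assumptions

theorem ReceiverBounds.mono {K' κ' : ℝ} (h : E.ReceiverBounds K κ) (hK : K ≤ K') (hκ0 : 0 < κ')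
    (hκ : κ' ≤ κ) : E.ReceiverBounds K' κ' where
  K_one := h.K_one.trans hK
  κ_pos := hκ0
  f_lower θ hθ := hκ.trans (h.f_lower θ hθ)
  f_upper θ hθ := (h.f_upper θ hθ).trans hK
  UR_bound a ha θ hθ := (h.UR_bound a ha θ hθ).trans hK
  UR_lip a ha a' ha' θ hθ := (h.UR_lip a ha a' ha' θ hθ).trans (by gcongr)
  UR_quad a ha θ hθ := le_trans (by gcongr) (h.UR_quad a ha θ hθ)
  UR1_lip a ha a' ha' θ hθ θ' hθ' := (h.UR1_lip a ha a' ha' θ hθ θ' hθ').trans (by gcongr)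
  UR1_taylor a ha a' ha' θ hθ θ' hθ' := (h.UR1_taylor a ha a' ha' θ hθ θ' hθ').trans (by gcongr)
  UR11_le a ha θ hθ := (h.UR11_le a ha θ hθ).trans (by linarith)
  UR12_ge a ha θ hθ := hκ.trans (h.UR12_ge a ha θ hθ)
  UR11_bound a ha θ hθ := (h.UR11_bound a ha θ hθ).trans hK
  UR12_bound a ha θ hθ := (h.UR12_bound a ha θ hθ).trans hK
  aR_growth θ hθ θ' hθ' hle :=
    (mul_le_mul_of_nonneg_right hκ (sub_nonneg.2 hle)).trans (h.aR_growth θ hθ θ' hθ' hle)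
  aR_lip θ hθ θ' hθ' := (h.aR_lip θ hθ θ' hθ').trans (by gcongr)
  A_width a ha a' ha' := (h.A_width a ha a' ha').trans hK

theorem SenderBounds.mono {K' κ' : ℝ} (h : E.SenderBounds K κ) (hK : K ≤ K') (hκ0 : 0 < κ')
    (hκ : κ' ≤ κ) : E.SenderBounds K' κ' where
  K_one := h.K_one.trans hK
  κ_pos := hκ0
  US_bound a ha θ hθ d hd := (h.US_bound a ha θ hθ d hd).trans hK
  US_lip a ha a' ha' θ hθ θ' hθ' d hd :=
    (h.US_lip a ha a' ha' θ hθ θ' hθ' d hd).trans (by gcongr)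
  US1_lip a ha a' ha' θ hθ θ' hθ' d hd :=
    (h.US1_lip a ha a' ha' θ hθ θ' hθ' d hd).trans (by gcongr)
  US1_bound a ha θ hθ d hd := (h.US1_bound a ha θ hθ d hd).trans
    (mul_le_mul_of_nonneg_right hK (add_nonneg (abs_nonneg _) hd.1))
  US_mvt e a ha a' ha' θ hθ d hd h1 h2 := (h.US_mvt e a ha a' ha' θ hθ d hd h1 h2).trans
    (mul_le_mul_of_nonneg_right (mul_le_mul_of_nonneg_right hK
      (add_nonneg ((abs_nonneg _).trans h1) hd.1)) (abs_nonneg _))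
  US_quad a ha a' ha' θ hθ d hd := (h.US_quad a ha a' ha' θ hθ d hd).trans (by gcongr)
  US_third a ha a' ha' θ hθ d hd := (h.US_third a ha a' ha' θ hθ d hd).trans (by gcongr)
  US11_le a ha θ hθ d hd := (h.US11_le a ha θ hθ d hd).trans (by linarith)
  D_ge r b := le_trans (by gcongr) (h.D_ge r b)

/-- All quantitative estimates on the primitives, with common constants. -/
structure Bounds (E : Model) (K κ : ℝ) : Prop extends
    ReceiverBounds E K κ, SenderBounds E K κ where
  anchor_lip : ∀ θ ∈ E.Θ, ∀ θ' ∈ E.Θ, ∀ (g : ℝ → ℝ) (B : ℝ), Measurable g → (∀ b, |g b| ≤ B) →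
    |∫ b, g b ∂(E.anchorLaw θ') - ∫ b, g b ∂(E.anchorLaw θ)| ≤ K * B * |θ' - θ|
  anchor_shift : ∀ θ, ∀ (g : ℝ → ℝ) (B s : ℝ), 0 ≤ s → Measurable g → (∀ b, |g b| ≤ B) →
    |∫ b, g (b + s) ∂(E.anchorLaw θ) - ∫ b, g (b - s) ∂(E.anchorLaw θ)| ≤ K * B * s

theorem Assumptions.exists_bounds (hE : E.Assumptions) : ∃ K κ, E.Bounds K κ := by
  obtain ⟨K₁, κ₁, h₁⟩ := hE.exists_receiverBounds
  obtain ⟨K₂, κ₂, h₂⟩ := hE.exists_senderBounds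
  obtain ⟨K₃, hK₃, h₃, h₄⟩ := hE.exists_anchorLaw_lip
  have h1 := h₁.K_one
  have h2 := h₂.K_one
  have hκ : 0 < min κ₁ κ₂ := lt_min h₁.κ_pos h₂.κ_pos
  refine ⟨K₁ + K₂ + K₃, min κ₁ κ₂, ?_⟩
  have hR := h₁.mono (show K₁ ≤ K₁ + K₂ + K₃ by linarith) hκ (min_le_left _ _)
  have hS := h₂.mono (show K₂ ≤ K₁ + K₂ + K₃ by linarith) hκ (min_le_right _ _)
  refine { hR, hS with anchor_lip := ?_, anchor_shift := ?_ }
  · intro θ hθ θ' hθ' g B hg hB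
    have hB0 : 0 ≤ B := (abs_nonneg _).trans (hB 0)
    refine (h₃ θ hθ θ' hθ' g B hg hB).trans ?_
    gcongr
    linarith
  · intro θ g B s hs hg hB
    have hB0 : 0 ≤ B := (abs_nonneg _).trans (hB 0)
    refine (h₄ θ g B s hs hg hB).trans ?_
    gcongr
    linarith

/-- The nearest point of the state space. -/
noncomputable def clamp (E : Model) (θ : ℝ) : ℝ := max E.lo (min θ E.hi)

theorem clamp_of_mem {θ : ℝ} (hθ : θ ∈ E.Θ) : E.clamp θ = θ := by
  rw [clamp, min_eq_left hθ.2, max_eq_right hθ.1]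

@[fun_prop]
theorem continuous_clamp : Continuous E.clamp := by
  unfold clamp
  fun_prop

/-- The part of the state space between `u` and `v`, up to the right end. -/
structure IsCell (E : Model) (I : Set ℝ) (u v : ℝ) : Prop where
  u_mem : u ∈ E.Θ
  v_mem : v ∈ E.Θ
  lt : u < v
  measurable : MeasurableSet I
  Ico_subset : Ico u v ⊆ I
  subset_Icc : I ⊆ Icc u v

/-! ### Cells of states and the joint law of state and anchor -/

namespace IsCell

variable {I : Set ℝ} {u v : ℝ}

theorem Icc_subset (hI : E.IsCell I u v) : Icc u v ⊆ E.Θ := Icc_subset_Icc hI.u_mem.1 hI.v_mem.2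

theorem subset (hI : E.IsCell I u v) : I ⊆ E.Θ := hI.subset_Icc.trans hI.Icc_subset

theorem ae_eq (hI : E.IsCell I u v) : I =ᵐ[volume] Icc u v :=
  hI.subset_Icc.eventuallyLE.antisymm
    (Ico_ae_eq_Icc.symm.le.trans hI.Ico_subset.eventuallyLE)

theorem setIntegral_eq (hI : E.IsCell I u v) (g : ℝ → ℝ) :
    ∫ θ in I, g θ = ∫ θ in u..v, g θ := by
  rw [setIntegral_congr_set hI.ae_eq, integral_Icc_eq_integral_Ioc,
    intervalIntegral.integral_of_le hI.lt.le]

theorem Ico_cell (hu : u ∈ E.Θ) (hv : v ∈ E.Θ) (h : u < v) :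
    E.IsCell (Ico u v) u v := ⟨hu, hv, h, measurableSet_Ico, subset_rfl, Ico_subset_Icc_self⟩

theorem Icc_cell (hu : u ∈ E.Θ) (hv : v ∈ E.Θ) (h : u < v) :
    E.IsCell (Icc u v) u v := ⟨hu, hv, h, measurableSet_Icc, Ico_subset_Icc_self, subset_rfl⟩

end IsCell

namespace Assumptions

theorem clamp_mem (hE : E.Assumptions) (θ : ℝ) : E.clamp θ ∈ E.Θ :=
  ⟨le_max_left _ _, max_le hE.lo_lt_hi.le (min_le_right _ _)⟩

theorem isCell_Θ (hE : E.Assumptions) : E.IsCell E.Θ E.lo E.hi :=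
  IsCell.Icc_cell hE.lo_mem hE.hi_mem hE.lo_lt_hi

theorem integrableOn_f (hE : E.Assumptions) : IntegrableOn E.f E.Θ :=
  hE.f_cont.integrableOn_compact isCompact_Icc

/-- The joint density of states and anchors is integrable. -/
theorem integrable_weight (hE : E.Assumptions) {I : Set ℝ} (hI : MeasurableSet I)
    (hIΘ : I ⊆ E.Θ) :
    Integrable (fun p : ℝ × ℝ => E.f p.1 * E.q p.2 p.1) ((volume.restrict I).prod volume) := by
  have hm : AEStronglyMeasurable (fun p : ℝ × ℝ => E.f p.1 * E.q p.2 p.1)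
      ((volume.restrict I).prod volume) := by
    have hprod : (volume.restrict I).prod (volume : Measure ℝ) =
        (volume.prod volume).restrict (I ×ˢ univ) := by
      rw [← Measure.prod_restrict, Measure.restrict_univ]
    rw [hprod]
    refine ContinuousOn.aestronglyMeasurable ?_ (hI.prod MeasurableSet.univ)
    have h1 : ContinuousOn (fun p : ℝ × ℝ => E.f p.1) (I ×ˢ univ) :=
      hE.f_cont.comp continuousOn_fst fun p hp => hIΘ hp.1
    have h2 : ContinuousOn (fun p : ℝ × ℝ => E.b₀ p.1) (I ×ˢ univ) :=
      hE.b₀_smooth.continuousOn.comp continuousOn_fst fun p hp => hIΘ hp.1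
    simp only [q_eq]
    exact h1.mul (hE.continuous_noiseDensity.comp_continuousOn (continuousOn_snd.sub h2))
  rw [integrable_prod_iff hm]
  refine ⟨Eventually.of_forall fun θ => by
    simpa using (hE.integrable_q θ).const_mul (E.f θ), ?_⟩
  have : ∀ θ, ∫ b, ‖E.f θ * E.q b θ‖ = ‖E.f θ‖ := fun θ => by
    simp_rw [norm_mul, Real.norm_of_nonneg (hE.q_pos _ θ).le]
    rw [integral_const_mul, hE.integral_q, mul_one]
  simp only [this]
  exact (hE.integrableOn_f.mono_set hIΘ).norm

theorem integrable_mul_weight (hE : E.Assumptions) {I : Set ℝ} (hI : MeasurableSet I)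
    (hIΘ : I ⊆ E.Θ) {G : ℝ × ℝ → ℝ} {B : ℝ} (hG : Measurable G) (hB : ∀ p, |G p| ≤ B) :
    Integrable (fun p : ℝ × ℝ => G p * (E.f p.1 * E.q p.2 p.1))
      ((volume.restrict I).prod volume) :=
  (hE.integrable_weight hI hIΘ).bdd_mul hG.aestronglyMeasurable (Eventually.of_forall hB)

theorem integral_mul_weight (hE : E.Assumptions) (G : ℝ × ℝ → ℝ) (θ : ℝ) :
    ∫ b, G (θ, b) * (E.f θ * E.q b θ) = (∫ b, G (θ, b) ∂(E.anchorLaw θ)) * E.f θ := by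
  rw [hE.integral_anchorLaw, ← integral_mul_const]
  exact integral_congr_ae (Eventually.of_forall fun b => by ring)

/-- Integrability over the state of expectations over the anchor. -/
theorem integrableOn_expectation (hE : E.Assumptions) {I : Set ℝ} (hI : MeasurableSet I)
    (hIΘ : I ⊆ E.Θ) {G : ℝ × ℝ → ℝ} {B : ℝ} (hG : Measurable G) (hB : ∀ p, |G p| ≤ B) :
    IntegrableOn (fun θ => (∫ b, G (θ, b) ∂(E.anchorLaw θ)) * E.f θ) I := by
  have := (hE.integrable_mul_weight hI hIΘ hG hB).integral_prod_left
  simp only [hE.integral_mul_weight] at this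
  exact this

theorem integral_f_pos (hE : E.Assumptions) {I : Set ℝ} {u v : ℝ} (hI : E.IsCell I u v) :
    0 < ∫ θ in I, E.f θ := by
  rw [hI.setIntegral_eq]
  refine intervalIntegral.intervalIntegral_pos_of_pos_on ?_
    (fun θ hθ => hE.f_pos θ (hI.Icc_subset (Ioo_subset_Icc_self hθ))) hI.lt
  exact (hE.f_cont.mono (by rw [uIcc_of_le hI.lt.le]; exact hI.Icc_subset)).intervalIntegrable

/-- Fubini for the truncated prior, whose normalising mass comes out of the integral. Finiteness is
bundled because the disintegration of the joint law relies on it. -/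
theorem integral_joint (hE : E.Assumptions) {I : Set ℝ} {u v : ℝ} (hI : E.IsCell I u v)
    {G : ℝ × ℝ → ℝ} {B : ℝ} (hG : Measurable G) (hB : ∀ p, |G p| ≤ B) :
    IsFiniteMeasure (E.joint I) ∧ ∫ p, G p ∂(E.joint I) =
      (∫ θ in I, (∫ b, G (θ, b) ∂(E.anchorLaw θ)) * E.f θ) / ∫ θ in I, E.f θ := by
  set F := ∫ θ in I, E.f θ with hF
  have hw := hE.integrable_weight hI.measurable hI.subset
  have e : ∀ p : ℝ × ℝ, E.f p.1 / F * E.q p.2 p.1 = (E.f p.1 * E.q p.2 p.1) / F :=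
    fun p => by ring
  have hpos : ∀ᵐ p ∂((volume.restrict I).prod (volume : Measure ℝ)),
      0 ≤ E.f p.1 * E.q p.2 p.1 := by
    have h1 : ∀ᵐ θ ∂(volume.restrict I), θ ∈ I := ae_restrict_mem hI.measurable
    have h2 := (Measure.quasiMeasurePreserving_fst (μ := volume.restrict I)
      (ν := (volume : Measure ℝ))).ae h1
    exact h2.mono fun p hp => mul_nonneg (hE.f_pos _ (hI.subset hp)).le (hE.q_pos _ _).le
  have hF0 := hE.integral_f_pos hI
  unfold joint
  simp only [← hF, e]
  refine ⟨isFiniteMeasure_withDensity_ofReal (hw.div_const F).2, ?_⟩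
  rw [integral_withDensity_eq_integral_toReal_smul₀
    (hw.div_const F).aestronglyMeasurable.aemeasurable.ennreal_ofReal
    (Eventually.of_forall fun _ => by simp)]
  have h1 : ∫ p, (ENNReal.ofReal ((E.f p.1 * E.q p.2 p.1) / F)).toReal • G p
      ∂((volume.restrict I).prod volume) =
      ∫ p, G p * (E.f p.1 * E.q p.2 p.1) / F ∂((volume.restrict I).prod volume) := by
    refine integral_congr_ae (hpos.mono fun p hp => ?_)
    dsimp only
    rw [ENNReal.toReal_ofReal (div_nonneg hp hF0.le), smul_eq_mul]
    ring
  rw [h1, integral_div, integral_prod _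
    (hE.integrable_mul_weight hI.measurable hI.subset hG hB)]
  simp only [hE.integral_mul_weight]

/-- A version of the marginal payoff of the receiver that is continuous on `A × ℝ`. -/
theorem measurable_UR1_comp (hE : E.Assumptions) {X : Type*} [MeasurableSpace X] {a θ : X → ℝ}
    (ha : Measurable a) (hθ : Measurable θ) : Measurable fun x => E.UR1 (a x) (E.clamp (θ x)) := by
  have hc : Continuous fun p : ℝ × ℝ => E.UR1 p.1 (E.clamp p.2) :=
    hE.continuousOn_UR1.comp_continuous (f := fun p : ℝ × ℝ => (p.1, E.clamp p.2)) (by fun_prop)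
      fun p => ⟨mem_univ _, hE.clamp_mem _⟩
  exact hc.measurable.comp (ha.prodMk hθ)

theorem measurable_UR_comp (hE : E.Assumptions) {X : Type*} [MeasurableSpace X] {a θ : X → ℝ}
    (ha : Measurable a) (hθ : Measurable θ) : Measurable fun x => E.UR (a x) (E.clamp (θ x)) := by
  have hc : Continuous fun p : ℝ × ℝ => E.UR p.1 (E.clamp p.2) :=
    hE.continuousOn_UR.comp_continuous (f := fun p : ℝ × ℝ => (p.1, E.clamp p.2)) (by fun_prop)
      fun p => ⟨mem_univ _, hE.clamp_mem _⟩
  exact hc.measurable.comp (ha.prodMk hθ)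

/-- Continuity of `US` is known only on `A × Θ × [0, d₀]`, so the action is clamped too; this
changes nothing for actions in `A`. -/
theorem measurable_US_comp (hE : E.Assumptions) {X : Type*} [MeasurableSpace X] {a θ : X → ℝ}
    {d : ℝ} (hd : d ∈ Icc 0 E.d₀) (ha : Measurable a) (haA : ∀ x, a x ∈ E.A)
    (hθ : Measurable θ) : Measurable fun x => E.US (a x) (E.clamp (θ x)) d := by
  have hc : Continuous fun p : ℝ × ℝ =>
      E.US (max (E.aR E.lo) (min p.1 (E.aR E.hi))) (E.clamp p.2) d :=
    hE.continuousOn_US.comp_continuous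
      (f := fun p : ℝ × ℝ => (max (E.aR E.lo) (min p.1 (E.aR E.hi)), E.clamp p.2, d))
      (by fun_prop)
      fun p => ⟨⟨le_max_left _ _, max_le hE.aR_lo_lt_hi.le (min_le_right _ _)⟩,
        hE.clamp_mem _, hd⟩
  have := hc.measurable.comp (ha.prodMk hθ)
  convert this using 2 with x
  simp [min_eq_left (haA x).2, max_eq_right (haA x).1]

theorem integral_bounds_of_belief {μ : Measure ℝ} [IsProbabilityMeasure μ]
    {I : Set ℝ} (hIΘ : I ⊆ E.Θ) (hμ : μ Iᶜ = 0) {g : ℝ → ℝ} (hg : ContinuousOn g E.Θ) (c : ℝ) :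
    ((∀ θ ∈ I, c ≤ g θ) → c ≤ ∫ θ, g θ ∂μ) ∧ ((∀ θ ∈ I, g θ ≤ c) → ∫ θ, g θ ∂μ ≤ c) := by
  have hae : ∀ᵐ θ ∂μ, θ ∈ I := hμ
  have hμr : μ.restrict E.Θ = μ := Measure.restrict_eq_self_of_ae_mem
    (hae.mono fun θ hθ => hIΘ hθ)
  obtain ⟨B, -, hB⟩ := exists_bound_of_continuousOn isCompact_Icc hg
  have hint : Integrable g μ := Integrable.of_bound
    (by rw [← hμr]; exact hg.aestronglyMeasurable measurableSet_Icc) B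
    (hae.mono fun θ hθ => hB θ (hIΘ hθ))
  constructor
  · intro h
    have := integral_mono_ae (integrable_const c) hint (hae.mono fun θ hθ => h θ hθ)
    simpa using this
  · intro h
    have := integral_mono_ae hint (integrable_const c) (hae.mono fun θ hθ => h θ hθ)
    simpa using this

end Assumptions

/-! ### Equilibrium on a cell: range of actions and orthogonality -/

namespace IsRegularEq

variable {d : ℝ} {I : Set ℝ} {u v : ℝ} {R : ℝ → ℝ → ℝ} {a : ℝ → ℝ}

/-- Actions in an equilibrium on a cell lie between the ideal actions at its ends. -/
theorem a_range (hE : E.Assumptions) (hB : E.Bounds K κ) (hI : E.IsCell I u v)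
    (h : E.IsRegularEq d I R a) (r : ℝ) : a r ∈ Icc (E.aR u) (E.aR v) := by
  obtain ⟨μ, hμ, hμI, -, hbest⟩ := h.beliefs
  have hfoc := hE.integral_UR1_eq_zero (μ := μ r)
    (measure_mono_null (compl_subset_compl.2 hI.subset) (hμI r)) (hbest r)
  have hc : ContinuousOn (fun θ => E.UR1 (a r) θ) E.Θ :=
    hE.continuousOn_UR1.comp (f := fun θ => (a r, θ)) (by fun_prop) fun θ hθ => ⟨mem_univ _, hθ⟩
  have hb := Assumptions.integral_bounds_of_belief hI.subset (hμI r) hc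
  have hA := h.a_mem r
  have hκ := hB.κ_pos
  constructor
  · by_contra! hlt
    have h1 := hE.UR1_decay hB.UR11_le hA (hE.aR_mem hI.u_mem) hI.u_mem hlt.le
    rw [hE.UR1_aR hI.u_mem] at h1
    -- An action below `aR u` has marginal payoff at least `κ * (aR u - a r) > 0` in every state of
    -- the cell, contradicting the zero mean. The other side is symmetric.
    have := (hb (κ * (E.aR u - a r))).1 fun θ hθ => by
      have h2 := hE.UR1_growth hB.UR12_ge hA hI.u_mem (hI.subset hθ) (hI.subset_Icc hθ).1
      have := mul_nonneg hκ.le (sub_nonneg.2 (hI.subset_Icc hθ).1)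
      linarith
    rw [hfoc] at this
    nlinarith
  · by_contra! hlt
    have h1 := hE.UR1_decay hB.UR11_le (hE.aR_mem hI.v_mem) hA hI.v_mem hlt.le
    rw [hE.UR1_aR hI.v_mem] at h1
    have := (hb (-(κ * (a r - E.aR v)))).2 fun θ hθ => by
      have h2 := hE.UR1_growth hB.UR12_ge hA (hI.subset hθ) hI.v_mem (hI.subset_Icc hθ).2
      have := mul_nonneg hκ.le (sub_nonneg.2 (hI.subset_Icc hθ).2)
      linarith
    rw [hfoc] at this
    nlinarith

theorem measurable_report (h : E.IsRegularEq d I R a) (θ : ℝ) : Measurable (R θ) :=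
  h.measurable_R.comp (measurable_const.prodMk measurable_id)

/-- Bayes' rule and the receiver's first-order condition: the marginal payoff is orthogonal to
every bounded function of the report. -/
theorem orthogonality (hE : E.Assumptions) (hI : E.IsCell I u v)
    (h : E.IsRegularEq d I R a) {s : ℝ → ℝ} {B : ℝ} (hs : Measurable s) (hsB : ∀ r, |s r| ≤ B) :
    ∫ θ in I, (∫ b, s (R θ b) * E.UR1 (a (R θ b)) θ ∂(E.anchorLaw θ)) * E.f θ = 0 := by
  obtain ⟨μ, hμ, hμI, hbayes, hbest⟩ := h.beliefs
  obtain ⟨C, hC0, hC⟩ := exists_bound_of_continuousOn Assumptions.isCompact_A_prod_Θ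
    (hE.continuousOn_UR1.mono (prod_mono (subset_univ _) subset_rfl))
  have hB0 : 0 ≤ B := (abs_nonneg _).trans (hsB 0)
  have ham : Measurable a := h.a_cont.measurable
  -- The clamp makes `W` measurable and bounded on the whole plane; on the cell it is invisible.
  set W : ℝ × ℝ → ℝ := fun p => s p.1 * E.UR1 (a p.1) (E.clamp p.2) with hW
  have hWm : Measurable W := (hs.comp measurable_fst).mul
    (hE.measurable_UR1_comp (ham.comp measurable_fst) measurable_snd)
  have hWB : ∀ p, |W p| ≤ B * C := fun p => by
    rw [hW, abs_mul]
    exact mul_le_mul (hsB _) (hC (a p.1, E.clamp p.2) ⟨h.a_mem _, hE.clamp_mem _⟩)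
      (abs_nonneg _) hB0
  have hRm := h.measurable_R
  have hφ : Measurable fun p : ℝ × ℝ => (R p.1 p.2, p.1) := hRm.prodMk measurable_fst
  obtain ⟨hfin, hJ⟩ := hE.integral_joint hI (G := fun p => W (R p.1 p.2, p.1))
    (hWm.comp hφ) (fun p => hWB _)
  have h1 : ∫ p, W (R p.1 p.2, p.1) ∂(E.joint I) = 0 := by
    rw [← integral_map (φ := fun p : ℝ × ℝ => (R p.1 p.2, p.1)) hφ.aemeasurable
      hWm.aestronglyMeasurable, hbayes]
    have hfm : IsFiniteMeasure ((E.joint I).map fun p => R p.1 p.2) :=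
      Measure.isFiniteMeasure_map _ _
    rw [Measure.integral_compProd
      (Integrable.of_bound hWm.aestronglyMeasurable _ (Eventually.of_forall hWB))]
    refine integral_eq_zero_of_ae (Eventually.of_forall fun r => ?_)
    have hae : ∀ᵐ θ ∂(μ r), θ ∈ I := hμI r
    -- The action is a best reply after every report, so the inner integral vanishes for each `r`,
    -- not only almost surely.
    have hfoc := hE.integral_UR1_eq_zero (μ := μ r)
      (measure_mono_null (compl_subset_compl.2 hI.subset) (hμI r)) (hbest r)
    simp only [hW, Pi.zero_apply]
    rw [integral_const_mul, integral_congr_ae (g := fun θ => E.UR1 (a r) θ)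
      (hae.mono fun θ hθ => by simp only [clamp_of_mem (hI.subset hθ)]), hfoc, mul_zero]
  rw [h1] at hJ
  have h2 := (div_eq_zero_iff.1 hJ.symm).resolve_right (hE.integral_f_pos hI).ne'
  rw [← h2]
  refine setIntegral_congr_fun hI.measurable fun θ hθ => ?_
  simp only [hW, clamp_of_mem (hI.subset hθ)]

end IsRegularEq

/-! ### Size and cost of report distortions -/

namespace Bounds

variable {d : ℝ} {a : ℝ → ℝ} {θ : ℝ}

theorem D_nonneg (hB : E.Bounds K κ) (r b : ℝ) : 0 ≤ E.D r b :=
  (mul_nonneg hB.κ_pos.le (sq_nonneg _)).trans (hB.D_ge r b)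

/-- Reports farther than this from the anchor are never worth their cost. -/
theorem senderObj_lt_of_far (hE : E.Assumptions) (hB : E.Bounds K κ) (hd : d ∈ Icc 0 E.d₀)
    (ha : ∀ r, a r ∈ E.A) (hθ : θ ∈ E.Θ) {b r : ℝ} (h : 2 * K / κ + 1 < |r - b|) :
    E.senderObj d a θ b r < E.senderObj d a θ b b := by
  have h1 := (abs_le.1 (hB.US_bound _ (ha r) θ hθ d hd)).2
  have h2 := (abs_le.1 (hB.US_bound _ (ha b) θ hθ d hd)).1
  have h3 := hB.D_ge r b
  have hκ := hB.κ_pos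
  have hK := hB.K_one
  have h4 : 2 * K < κ * |r - b| := by
    have : 2 * K / κ < |r - b| := by linarith
    rw [div_lt_iff₀ hκ] at this
    linarith
  -- The summand `1` in the radius makes the quadratic cost dominate `κ * |r - b|`, which already
  -- exceeds the largest possible gain `2 * K`.
  have h5 : 1 ≤ |r - b| := by
    have : 0 ≤ 2 * K / κ := by positivity
    linarith
  unfold senderObj
  rw [hE.D_self]
  rw [← sq_abs] at h3
  nlinarith

/-- When actions are close to the ideal one, reports are close to the anchor. -/
theorem senderObj_lt_of_far_of_near (hE : E.Assumptions) (hB : E.Bounds K κ)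
    (hd : d ∈ Icc 0 E.d₀) (ha : ∀ r, a r ∈ E.A) (hθ : θ ∈ E.Θ) {h : ℝ} (hdh : d ≤ h)
    (hah : ∀ r, |a r - E.aR θ| ≤ K * h) {b r : ℝ}
    (hr : (2 * K ^ 2 * (K + 1) / κ + 1) * h < |r - b|) :
    E.senderObj d a θ b r < E.senderObj d a θ b b := by
  have hκ := hB.κ_pos
  have hK := hB.K_one
  have hh : 0 ≤ h := hd.1.trans hdh
  have h1 := le_of_abs_le (hB.US_mvt (K * h) _ (ha b) _ (ha r) θ hθ d hd (hah b) (hah r))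
  have h2 : |a r - a b| ≤ 2 * (K * h) := by
    have h3 := abs_le.1 (hah r)
    have h4 := abs_le.1 (hah b)
    exact abs_le.2 ⟨by linarith, by linarith⟩
  -- The gain is a slope of order `h` times an action change of order `h`. A cost of `κ * |r - b| ^
  -- 2` then forces displacements of order `h`.
  have h3 : K * (K * h + d) * |a r - a b| ≤ K * (K * h + h) * (2 * (K * h)) := by gcongr
  have h4 := hB.D_ge r b
  rw [← sq_abs] at h4
  set c := 2 * K ^ 2 * (K + 1) / κ with hc
  have hc0 : 0 ≤ c := by positivity
  have hck : κ * c = 2 * K ^ 2 * (K + 1) := by rw [hc]; field_simp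
  have h5 : K * (K * h + h) * (2 * (K * h)) < κ * |r - b| ^ 2 := by
    have h6 : ((c + 1) * h) ^ 2 < |r - b| ^ 2 := by
      apply pow_lt_pow_left₀ hr (by positivity) two_ne_zero
    have h7 : K * (K * h + h) * (2 * (K * h)) = κ * c * h ^ 2 := by rw [hck]; ring
    rw [h7]
    have h8 : κ * c * h ^ 2 ≤ κ * ((c + 1) * h) ^ 2 := by
      rw [mul_pow, mul_assoc]
      gcongr
      nlinarith
    exact h8.trans_lt (mul_lt_mul_of_pos_left h6 hκ)
  unfold senderObj
  rw [hE.D_self]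
  linarith

end Bounds

namespace IsRegularEq

variable {d : ℝ} {I : Set ℝ} {u v : ℝ} {R : ℝ → ℝ → ℝ} {a : ℝ → ℝ}

theorem senderObj_le (h : E.IsRegularEq d I R a) {θ : ℝ} (hθ : θ ∈ I) (b r : ℝ) :
    E.senderObj d a θ b r ≤ E.senderObj d a θ b (R θ b) := by
  rcases eq_or_ne r (R θ b) with hr | hr
  · rw [hr]
  · exact (h.sender_opt θ hθ b r hr).le

theorem abs_report_sub_le (h : E.IsRegularEq d I R a) {θ b M : ℝ} (hθ : θ ∈ I)
    (hM : ∀ r, M < |r - b| → E.senderObj d a θ b r < E.senderObj d a θ b b) :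
    |R θ b - b| ≤ M := by
  by_contra! hlt
  exact absurd (h.senderObj_le hθ b b) (not_le.2 (hM _ hlt))

/-- Monotonicity replaces the unknown report rule by two deterministic translations of the anchor,
to which the estimates on anchor laws apply. -/
theorem action_bracket (h : E.IsRegularEq d I R a) {θ b M : ℝ} (hM : |R θ b - b| ≤ M) :
    a (b - M) ≤ a (R θ b) ∧ a (R θ b) ≤ a (b + M) := by
  have := abs_le.1 hM
  exact ⟨h.a_mono.monotone (by linarith), h.a_mono.monotone (by linarith)⟩

/-- The truthful report `r = b` is free, so an optimal distortion costs at most what it gains in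
action payoff. -/
theorem D_report_le (hE : E.Assumptions) (h : E.IsRegularEq d I R a) {θ : ℝ} (hθ : θ ∈ I)
    (b : ℝ) : E.D (R θ b) b ≤ E.US (a (R θ b)) θ d - E.US (a b) θ d := by
  have := h.senderObj_le hθ b b
  unfold senderObj at this
  rw [hE.D_self] at this
  linarith

/-- The payoff along the equilibrium path has a bounded measurable version. -/
theorem exists_payoff_version (hE : E.Assumptions) (hB : E.Bounds K κ) (hI : I ⊆ E.Θ)
    (hd : d ∈ Icc 0 E.d₀) (h : E.IsRegularEq d I R a) (i : Player) :
    ∃ G : ℝ × ℝ → ℝ, Measurable G ∧ (∀ p, |G p| ≤ 3 * K) ∧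
      ∀ θ ∈ I, ∀ b, G (θ, b) = E.payoff d (a (R θ b)) (R θ b) θ b i := by
  have hK := hB.K_one
  have ham : Measurable fun p : ℝ × ℝ => a (R p.1 p.2) :=
    h.a_cont.measurable.comp h.measurable_R
  cases i with
  | receiver =>
    refine ⟨_, hE.measurable_UR_comp ham measurable_fst, fun p => ?_, fun θ hθ b => ?_⟩
    · exact (hB.UR_bound _ (h.a_mem _) _ (hE.clamp_mem _)).trans (by linarith)
    · simp [payoff, clamp_of_mem (hI hθ)]
  | sender =>
    -- Truncation at `2 * K` bounds the cost at all states; at states of `I` an optimal report never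
    -- costs more, so the payoff there is unchanged.
    have hDm : Measurable fun p : ℝ × ℝ => min (E.D (R p.1 p.2) p.2) (2 * K) := by
      have : Measurable fun p : ℝ × ℝ => E.D (R p.1 p.2) p.2 :=
        (hE.continuous_φ.measurable.comp (h.measurable_R.sub measurable_snd)).const_mul E.c
      exact this.min measurable_const
    refine ⟨_, (hE.measurable_US_comp hd ham (fun p => h.a_mem _) measurable_fst).sub hDm,
      fun p => ?_, fun θ hθ b => ?_⟩
    · have h1 := abs_le.1 (hB.US_bound _ (h.a_mem (R p.1 p.2)) _ (hE.clamp_mem p.1) d hd)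
      have h2 : 0 ≤ min (E.D (R p.1 p.2) p.2) (2 * K) :=
        le_min (hB.D_nonneg _ _) (by linarith)
      have h3 := min_le_right (E.D (R p.1 p.2) p.2) (2 * K)
      simp only [Pi.sub_apply]
      exact abs_le.2 ⟨by linarith, by linarith⟩
    · have h1 := h.D_report_le hE hθ b
      have h2 := abs_le.1 (hB.US_bound _ (h.a_mem (R θ b)) _ (hI hθ) d hd)
      have h3 := abs_le.1 (hB.US_bound _ (h.a_mem b) _ (hI hθ) d hd)
      simp only [Pi.sub_apply, payoff, clamp_of_mem (hI hθ)]
      rw [min_eq_left (by linarith)]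

end IsRegularEq

/-- Expected payoff conditional on the state. -/
noncomputable def condPayoff (E : Model) (d : ℝ) (R : ℝ → ℝ → ℝ) (a : ℝ → ℝ) (i : Player)
    (θ : ℝ) : ℝ := ∫ b, E.payoff d (a (R θ b)) (R θ b) θ b i ∂(E.anchorLaw θ)

/-- The ideal payoff of a player in a given state. -/
noncomputable def ideal (E : Model) (d : ℝ) (θ : ℝ) : Player → ℝ
  | .receiver => E.UR (E.aR θ) θ
  | .sender => E.US (E.aS θ d) θ d

theorem benchmark_eq (d : ℝ) (i : Player) :
    E.benchmark d i = ∫ θ in E.Θ, E.ideal d θ i * E.f θ := by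
  cases i <;> rfl

/-! ### Ideal payoffs and pointwise losses -/

namespace Assumptions

variable {d : ℝ}

theorem surplusOn_eq (hE : E.Assumptions) (d : ℝ) (I : Set ℝ) (R : ℝ → ℝ → ℝ) (a : ℝ → ℝ)
    (i : Player) : E.surplusOn d I R a i = ∫ θ in I, E.condPayoff d R a i θ * E.f θ := by
  simp only [surplusOn, condPayoff, hE.integral_anchorLaw]

theorem aS_spec (hE : E.Assumptions) (hd : d ∈ Icc 0 E.d₀) {θ : ℝ} (hθ : θ ∈ E.Θ) :
    E.aS θ d ∈ E.A ∧ ∀ a ∈ E.A, E.US a θ d ≤ E.US (E.aS θ d) θ d := by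
  have hc : ContinuousOn (fun x => E.US x θ d) E.A :=
    hE.continuousOn_US.comp (f := fun x => (x, θ, d)) (by fun_prop) fun x hx => ⟨hx, hθ, hd⟩
  obtain ⟨a, ha, hmax⟩ := (isCompact_Icc (a := E.aR E.lo) (b := E.aR E.hi)).exists_isMaxOn
    ⟨_, left_mem_Icc.2 hE.A_nonempty⟩ hc
  have := Classical.epsilon_spec
    (p := fun a => a ∈ E.A ∧ IsMaxOn (fun x => E.US x θ d) E.A a) ⟨a, ha, hmax⟩
  exact ⟨this.1, fun x hx => this.2 hx⟩

theorem continuousOn_aR (hB : E.Bounds K κ) : ContinuousOn E.aR E.Θ := by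
  have hK := hB.K_one
  refine (LipschitzOnWith.of_dist_le_mul (K := K.toNNReal) fun x hx y hy => ?_).continuousOn
  rw [Real.coe_toNNReal _ (by linarith), Real.dist_eq, Real.dist_eq]
  exact hB.aR_lip y hy x hx

theorem continuousOn_ideal (hE : E.Assumptions) (hB : E.Bounds K κ) (hd : d ∈ Icc 0 E.d₀)
    (i : Player) : ContinuousOn (fun θ => E.ideal d θ i) E.Θ := by
  cases i with
  | receiver =>
    exact hE.continuousOn_UR.comp (f := fun θ => (E.aR θ, θ))
      ((continuousOn_aR hB).prodMk continuousOn_id) fun θ hθ => ⟨mem_univ _, hθ⟩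
  | sender =>
    have hK := hB.K_one
    -- Envelope argument: the maximiser at `x` is also available at `y`, so only the dependence of
    -- `US` on the state matters.
    have key : ∀ x ∈ E.Θ, ∀ y ∈ E.Θ,
        E.US (E.aS x d) x d - E.US (E.aS y d) y d ≤ K * |x - y| := fun x hx y hy => by
      obtain ⟨h1, -⟩ := hE.aS_spec hd hx
      have h2 := (hE.aS_spec hd hy).2 _ h1
      have h3 := le_of_abs_le (hB.US_lip _ h1 _ h1 y hy x hx d hd)
      simp only [sub_self, abs_zero, zero_add] at h3
      linarith
    refine (LipschitzOnWith.of_dist_le_mul (K := K.toNNReal) fun x hx y hy => ?_).continuousOn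
    rw [Real.coe_toNNReal _ (by linarith), Real.dist_eq, Real.dist_eq]
    refine abs_le.2 ⟨?_, key x hx y hy⟩
    have := key y hy x hx
    rw [abs_sub_comm] at this
    simp only [ideal]
    linarith

theorem integrableOn_ideal (hE : E.Assumptions) (hB : E.Bounds K κ) (hd : d ∈ Icc 0 E.d₀)
    (i : Player) : IntegrableOn (fun θ => E.ideal d θ i * E.f θ) E.Θ :=
  ((hE.continuousOn_ideal hB hd i).mul hE.f_cont).integrableOn_compact isCompact_Icc

theorem integrableOn_condPayoff (hE : E.Assumptions) (hB : E.Bounds K κ) (hd : d ∈ Icc 0 E.d₀)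
    {I : Set ℝ} {R : ℝ → ℝ → ℝ} {a : ℝ → ℝ} (hIm : MeasurableSet I) (hI : I ⊆ E.Θ)
    (h : E.IsRegularEq d I R a) (i : Player) :
    IntegrableOn (fun θ => E.condPayoff d R a i θ * E.f θ) I := by
  obtain ⟨G, hG, hGB, hGe⟩ := h.exists_payoff_version hE hB hI hd i
  refine (hE.integrableOn_expectation hIm hI hG hGB).congr_fun (fun θ hθ => ?_) hIm
  simp only [condPayoff, hGe θ hθ]

theorem integrable_payoff (hE : E.Assumptions) (hB : E.Bounds K κ) (hd : d ∈ Icc 0 E.d₀)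
    {I : Set ℝ} {R : ℝ → ℝ → ℝ} {a : ℝ → ℝ} (hI : I ⊆ E.Θ)
    (h : E.IsRegularEq d I R a) (i : Player) {θ : ℝ} (hθ : θ ∈ I) :
    Integrable (fun b => E.payoff d (a (R θ b)) (R θ b) θ b i) (E.anchorLaw θ) := by
  obtain ⟨G, hG, hGB, hGe⟩ := h.exists_payoff_version hE hB hI hd i
  simp only [← hGe θ hθ]
  exact hE.integrable_anchorLaw θ (hG.comp (measurable_const.prodMk measurable_id))
    (fun b => hGB _)

/-- Lower bound for the loss of a player at an action. -/
theorem loss_lower (hE : E.Assumptions) (hB : E.Bounds K κ) (hd : d ∈ Icc 0 E.d₀) {a θ : ℝ}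
    (ha : a ∈ E.A) (hθ : θ ∈ E.Θ) (r b : ℝ) (i : Player) :
    κ * (a - E.aR θ) ^ 2 - K ^ 2 * d ≤ E.ideal d θ i - E.payoff d a r θ b i := by
  have hK := hB.K_one
  cases i with
  | receiver =>
    have h1 := hB.UR_quad a ha θ hθ
    have : 0 ≤ K ^ 2 * d := mul_nonneg (sq_nonneg _) hd.1
    simp only [ideal, payoff]
    linarith
  | sender =>
    -- Strong concavity is used at `aR θ`, where the first-order coefficient is `O(d)` by alignment;
    -- this yields the error `K ^ 2 * d`.
    have h1 := hB.US_quad _ (hE.aR_mem hθ) a ha θ hθ d hd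
    have h2 := hB.US1_bound _ (hE.aR_mem hθ) θ hθ d hd
    have h3 := hB.A_width _ (hE.aR_mem hθ) a ha
    have h4 := (hE.aS_spec hd hθ).2 _ (hE.aR_mem hθ)
    have h5 := hB.D_nonneg r b
    rw [sub_self, abs_zero, zero_add] at h2
    have h6 : E.US1 (E.aR θ) θ d * (a - E.aR θ) ≤ K * d * K :=
      (le_abs_self _).trans (by
        rw [abs_mul]
        exact mul_le_mul h2 h3 (abs_nonneg _) (mul_nonneg (by linarith) hd.1))
    simp only [ideal, payoff]
    nlinarith

/-- Upper bound for the loss of the sender at the ideal action of the receiver. -/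
theorem ideal_sender_le (hE : E.Assumptions) (hB : E.Bounds K κ) (hd : d ∈ Icc 0 E.d₀) {θ : ℝ}
    (hθ : θ ∈ E.Θ) : E.US (E.aS θ d) θ d ≤ E.US (E.aR θ) θ d + K ^ 2 * d := by
  have hK := hB.K_one
  have hs := (hE.aS_spec hd hθ).1
  have h1 := hB.US_quad _ (hE.aR_mem hθ) _ hs θ hθ d hd
  have h2 := hB.US1_bound _ (hE.aR_mem hθ) θ hθ d hd
  have h3 := hB.A_width _ (hE.aR_mem hθ) _ hs
  rw [sub_self, abs_zero, zero_add] at h2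
  have h6 : E.US1 (E.aR θ) θ d * (E.aS θ d - E.aR θ) ≤ K * d * K :=
    (le_abs_self _).trans (by
      rw [abs_mul]
      exact mul_le_mul h2 h3 (abs_nonneg _) (mul_nonneg (by linarith) hd.1))
  have h7 := mul_nonneg hB.κ_pos.le (sq_nonneg (E.aS θ d - E.aR θ))
  nlinarith

end Assumptions

/-! ### Anchor-only equilibria -/

namespace IsRegularEq

variable {d : ℝ} {I : Set ℝ} {u v : ℝ} {R : ℝ → ℝ → ℝ} {a : ℝ → ℝ}

theorem integrable_action_error (hE : E.Assumptions) (hB : E.Bounds K κ)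
    (h : E.IsRegularEq d I R a) {c : ℝ} (hc : c ∈ E.A) (θ : ℝ) (θ' : ℝ) :
    Integrable (fun b => |a (R θ b) - c|) (E.anchorLaw θ') :=
  hE.integrable_anchorLaw θ' (B := K)
    ((h.a_cont.measurable.comp (h.measurable_report θ)).sub_const c).abs
    fun b => by rw [abs_abs]; exact hB.A_width c hc _ (h.a_mem _)

/-- Comparison of the expected action error with its counterpart under truthful reporting and a
reference law of the anchor. -/
theorem reference_error_le (hE : E.Assumptions) (hB : E.Bounds K κ) (hd : d ∈ Icc 0 E.d₀)
    (hI : I ⊆ E.Θ) (h : E.IsRegularEq d I R a) {L δ : ℝ} {ϑ : ℝ} (hϑ : ϑ ∈ E.Θ) (hL0 : 0 ≤ L)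
    (hL : ∀ θ ∈ E.Θ, ∀ θ' ∈ E.Θ, ∀ s s' : ℝ, |s| ≤ 2 * K / κ + 1 → |s'| ≤ 2 * K / κ + 1 →
      ∀ (g : ℝ → ℝ) (B : ℝ), Measurable g → (∀ b, 0 ≤ g b) → (∀ b, g b ≤ B) →
      ∫ b, g (b + s) ∂(E.anchorLaw θ) ≤ L * ∫ b, g (b + s') ∂(E.anchorLaw θ') + B * δ)
    {θ : ℝ} (hθ : θ ∈ I) :
    ∫ b, |a b - E.aR θ| ∂(E.anchorLaw ϑ) ≤
      2 * L * ∫ b, |a (R θ b) - E.aR θ| ∂(E.anchorLaw θ) + 2 * (K * δ) := by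
  have hK := hB.K_one
  have hκ := hB.κ_pos
  have hM : 0 ≤ 2 * K / κ + 1 := by positivity
  have hθ' := hI hθ
  have ham := h.a_cont.measurable
  have hA : ∀ r, |a r - E.aR θ| ≤ K := fun r => hB.A_width _ (hE.aR_mem hθ') _ (h.a_mem r)
  have hbr : ∀ b, a (b - (2 * K / κ + 1)) ≤ a (R θ b) ∧ a (R θ b) ≤ a (b + (2 * K / κ + 1)) :=
    fun b => h.action_bracket (h.abs_report_sub_le hθ fun r hr =>
      hB.senderObj_lt_of_far hE hd h.a_mem hθ' hr)
  have hint := h.integrable_action_error hE hB (hE.aR_mem hθ') θ θ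
  -- The error is split into its two one-sided parts because each is monotone in the report: the
  -- shortfall at `b + M` and the excess at `b - M` are both below the equilibrium error.
  have side : ∀ (g : ℝ → ℝ) (s : ℝ), Measurable g → (∀ b, 0 ≤ g b) → (∀ b, g b ≤ K) →
      |s| ≤ 2 * K / κ + 1 → (∀ b, g (b + s) ≤ |a (R θ b) - E.aR θ|) →
      ∫ b, g b ∂(E.anchorLaw ϑ) ≤
        L * ∫ b, |a (R θ b) - E.aR θ| ∂(E.anchorLaw θ) + K * δ := by
    intro g s hg hg0 hgK hs hle
    have h1 := hL ϑ hϑ θ hθ' 0 s (by simpa using hM) hs g K hg hg0 hgK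
    simp only [add_zero] at h1
    refine h1.trans ?_
    gcongr
    exact hE.integrable_anchorLaw θ (B := K) (hg.comp (measurable_id.add_const s))
      fun b => by rw [abs_of_nonneg (hg0 _)]; exact hgK _
    exact fun b => hle b
  have h1 := side (fun b => max 0 (E.aR θ - a b)) (2 * K / κ + 1)
    (measurable_const.max (measurable_const.sub ham)) (fun b => le_max_left _ _)
    (fun b => max_le (by linarith) (by linarith [(abs_le.1 (hA b)).1])) (by rw [abs_of_nonneg hM])
    (fun b => max_le (abs_nonneg _) (by
      rw [abs_sub_comm]
      exact (sub_le_sub_left (hbr b).2 _).trans (le_abs_self _)))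
  have h2 := side (fun b => max 0 (a b - E.aR θ)) (-(2 * K / κ + 1))
    (measurable_const.max (ham.sub measurable_const)) (fun b => le_max_left _ _)
    (fun b => max_le (by linarith) (by linarith [(abs_le.1 (hA b)).2]))
    (by rw [abs_neg, abs_of_nonneg hM])
    (fun b => max_le (abs_nonneg _) (by
      have := (hbr b).1
      rw [sub_eq_add_neg] at this
      exact (sub_le_sub_right this _).trans (le_abs_self _)))
  have e : ∀ b, |a b - E.aR θ| = max 0 (E.aR θ - a b) + max 0 (a b - E.aR θ) := fun b => by
    rcases le_total (a b) (E.aR θ) with hh | hh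
    · rw [max_eq_right (sub_nonneg.2 hh), max_eq_left (sub_nonpos.2 hh), abs_sub_comm,
        abs_of_nonneg (sub_nonneg.2 hh), add_zero]
    · rw [max_eq_left (sub_nonpos.2 hh), max_eq_right (sub_nonneg.2 hh),
        abs_of_nonneg (sub_nonneg.2 hh), zero_add]
  simp only [e]
  rw [integral_add]
  · simp only [e] at h1 h2
    linarith
  · exact hE.integrable_anchorLaw ϑ (B := K) (measurable_const.max (measurable_const.sub ham))
      fun b => by
        rw [abs_of_nonneg (le_max_left _ _)]
        exact max_le (by linarith) (by linarith [(abs_le.1 (hA b)).1])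
  · exact hE.integrable_anchorLaw ϑ (B := K) (measurable_const.max (ham.sub measurable_const))
      fun b => by
        rw [abs_of_nonneg (le_max_left _ _)]
        exact max_le (by linarith) (by linarith [(abs_le.1 (hA b)).2])

theorem integrableOn_action_error (hE : E.Assumptions) (hB : E.Bounds K κ)
    (hIm : MeasurableSet I) (hI : I ⊆ E.Θ) (h : E.IsRegularEq d I R a) :
    IntegrableOn (fun θ => (∫ b, |a (R θ b) - E.aR θ| ∂(E.anchorLaw θ)) * E.f θ) I := by
  have haR : Continuous fun θ => E.aR (E.clamp θ) :=
    (Assumptions.continuousOn_aR hB).comp_continuous continuous_clamp hE.clamp_mem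
  have := hE.integrableOn_expectation hIm hI (B := K)
    (G := fun p => |a (R p.1 p.2) - E.aR (E.clamp p.1)|)
    (((h.a_cont.measurable.comp h.measurable_R).sub (haR.measurable.comp measurable_fst)).abs)
    fun p => by
      rw [abs_abs]; exact hB.A_width _ (hE.aR_mem (hE.clamp_mem _)) _ (h.a_mem _)
  exact this.congr_fun (fun θ hθ => by simp only [clamp_of_mem (hI hθ)]) hIm

end IsRegularEq

/-- In an anchor-only equilibrium actions are uniformly bounded away from the ideal ones. -/
theorem Bounds.exists_anchorOnly_error (hE : E.Assumptions) (hB : E.Bounds K κ) :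
    ∃ e > 0, ∀ d ∈ Icc 0 E.d₀, ∀ (R : ℝ → ℝ → ℝ) (a : ℝ → ℝ), E.IsRegularEq d E.Θ R a →
      e ≤ ∫ θ in E.Θ, (∫ b, |a (R θ b) - E.aR θ| ∂(E.anchorLaw θ)) * E.f θ := by
  have hK := hB.K_one
  have hκ := hB.κ_pos
  have hlen : 0 < E.hi - E.lo := sub_pos.2 hE.lo_lt_hi
  -- With this `δ`, the additive errors of two states sum to `κ * ℓ / 4`, half of the separation `κ
  -- * (ℓ / 2)` of their ideal actions.
  obtain ⟨L, hL0, hL⟩ := hE.exists_contiguity (2 * K / κ + 1)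
    (δ := κ * (E.hi - E.lo) / (16 * K)) (by positivity)
  set ℓ := E.hi - E.lo with hℓ
  refine ⟨κ * (κ * ℓ / (8 * L)) * (ℓ / 2), by positivity, fun d hd R a h => ?_⟩
  set H : ℝ → ℝ := fun θ => ∫ b, |a (R θ b) - E.aR θ| ∂(E.anchorLaw θ) with hH
  have hH0 : ∀ θ, 0 ≤ H θ := fun θ => integral_nonneg fun b => abs_nonneg _
  -- Under the reference law at `lo` the same number `a b` is compared with two ideal actions at
  -- least `κ * (ℓ / 2)` apart, so by the triangle inequality both errors cannot be small.
  have hpair : ∀ θ ∈ E.Θ, ∀ θ' ∈ E.Θ, θ' = θ + ℓ / 2 → κ * ℓ / (8 * L) ≤ H θ + H θ' := by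
    intro θ hθ θ' hθ' he
    have hp := hE.isProbabilityMeasure_anchorLaw E.lo
    have h1 := h.reference_error_le hE hB hd subset_rfl hE.lo_mem hL0.le hL hθ
    have h2 := h.reference_error_le hE hB hd subset_rfl hE.lo_mem hL0.le hL hθ'
    have hi : ∀ ϑ ∈ E.Θ, Integrable (fun b => |a b - E.aR ϑ|) (E.anchorLaw E.lo) :=
      fun ϑ hϑ => hE.integrable_anchorLaw E.lo (B := K) (h.a_cont.measurable.sub_const _).abs
        fun b => by rw [abs_abs]; exact hB.A_width _ (hE.aR_mem hϑ) _ (h.a_mem b)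
    have h3 : κ * (ℓ / 2) ≤ ∫ b, (|a b - E.aR θ| + |a b - E.aR θ'|) ∂(E.anchorLaw E.lo) := by
      have h4 := hB.aR_growth θ hθ θ' hθ' (by linarith)
      have h5 := integral_mono (μ := E.anchorLaw E.lo) (integrable_const (κ * (ℓ / 2)))
        ((hi θ hθ).add (hi θ' hθ')) fun b => by
          have h6 := le_abs_self (a b - E.aR θ)
          have h7 := neg_abs_le (a b - E.aR θ')
          simp only [Pi.add_apply]
          rw [he] at h4 h7 ⊢
          linarith
      simpa using h5
    rw [integral_add (hi θ hθ) (hi θ' hθ')] at h3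
    have h6 : K * (κ * ℓ / (16 * K)) = κ * ℓ / 16 := by field_simp
    rw [h6] at h1 h2
    rw [div_le_iff₀ (by positivity)]
    simp only [hH]
    nlinarith
  have hHf := h.integrableOn_action_error hE hB measurableSet_Icc subset_rfl
  have hmid : E.lo ≤ E.lo + ℓ / 2 := by linarith
  have hmid' : E.lo + ℓ / 2 ≤ E.hi := by linarith
  have hII : ∀ x ∈ E.Θ, ∀ y ∈ E.Θ, IntervalIntegrable (fun θ => H θ * E.f θ) volume x y :=
    fun x hx y hy => (hHf.mono_set (by
      rw [← uIcc_of_le hE.lo_lt_hi.le]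
      exact uIcc_subset_uIcc (by rw [uIcc_of_le hE.lo_lt_hi.le]; exact hx)
        (by rw [uIcc_of_le hE.lo_lt_hi.le]; exact hy))).intervalIntegrable
  have hmm : E.lo + ℓ / 2 ∈ E.Θ := ⟨hmid, hmid'⟩
  have hhi : E.lo + ℓ / 2 + ℓ / 2 = E.hi := by linarith
  rw [hE.isCell_Θ.setIntegral_eq (fun θ => H θ * E.f θ),
    ← intervalIntegral.integral_add_adjacent_intervals (hII _ hE.lo_mem _ hmm)
      (hII _ hmm _ hE.hi_mem)]
  -- Translating the right half of the state space onto the left half pairs `θ` with `θ + ℓ / 2`.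
  have hshift : ∫ θ in (E.lo + ℓ / 2)..E.hi, H θ * E.f θ =
      ∫ θ in E.lo..(E.lo + ℓ / 2), H (θ + ℓ / 2) * E.f (θ + ℓ / 2) := by
    rw [intervalIntegral.integral_comp_add_right (fun θ => H θ * E.f θ), hhi]
  have hI2 : IntervalIntegrable (fun θ => H (θ + ℓ / 2) * E.f (θ + ℓ / 2)) volume E.lo
      (E.lo + ℓ / 2) := by
    have := (hII _ hmm _ hE.hi_mem).comp_add_right (ℓ / 2)
    have e2 : E.hi - ℓ / 2 = E.lo + ℓ / 2 := by linarith
    simpa [e2] using this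
  rw [hshift, ← intervalIntegral.integral_add (hII _ hE.lo_mem _ hmm) hI2]
  have hmono := intervalIntegral.integral_mono_on hmid
    (_root_.intervalIntegrable_const (c := κ * (κ * ℓ / (8 * L))))
    ((hII _ hE.lo_mem _ hmm).add hI2) fun θ hθ => by
      have hθ1 : θ ∈ E.Θ := ⟨hθ.1, hθ.2.trans hmid'⟩
      have hθ2 : θ + ℓ / 2 ∈ E.Θ := ⟨by linarith [hθ.1], by linarith [hθ.2]⟩
      have h1 := hpair θ hθ1 _ hθ2 rfl
      have h2 := mul_le_mul_of_nonneg_left (hB.f_lower θ hθ1) (hH0 θ)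
      have h3 := mul_le_mul_of_nonneg_left (hB.f_lower _ hθ2) (hH0 (θ + ℓ / 2))
      have h4 := mul_le_mul_of_nonneg_left h1 hκ.le
      linarith
  rw [intervalIntegral.integral_const] at hmono
  have e3 : E.lo + ℓ / 2 - E.lo = ℓ / 2 := by ring
  rw [e3, smul_eq_mul, mul_comm (ℓ / 2)] at hmono
  exact hmono

/-- The loss of anchor-only equilibria is bounded away from zero for small misalignment. -/
theorem Assumptions.exists_anchorOnly_loss (hE : E.Assumptions) :
    ∃ d₁ ∈ Ioc 0 E.d₀, ∃ ℓ > 0, ∀ d ∈ Ioo 0 d₁, ∀ (X : E.AnchorOnly d) (i : Player),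
      ℓ ≤ X.loss i := by
  obtain ⟨K, κ, hB⟩ := hE.exists_bounds
  have hK := hB.K_one
  have hκ := hB.κ_pos
  obtain ⟨e, he, herr⟩ := hB.exists_anchorOnly_error hE
  refine ⟨min E.d₀ (κ * e ^ 2 / (2 * K ^ 2)), ⟨lt_min hE.d₀_pos (by positivity), min_le_left _ _⟩,
    κ * e ^ 2 / 2, by positivity, ?_⟩
  intro d hd X i
  have hd' : d ∈ Icc 0 E.d₀ := ⟨hd.1.le, hd.2.le.trans (min_le_left _ _)⟩
  have hdK : K ^ 2 * d ≤ κ * e ^ 2 / 2 := by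
    have : d ≤ κ * e ^ 2 / (2 * K ^ 2) := hd.2.le.trans (min_le_right _ _)
    rw [le_div_iff₀ (by positivity)] at this
    linarith
  have h := X.regular
  have hint1 := hE.integrableOn_ideal hB hd' i
  have hint2 := hE.integrableOn_condPayoff hB hd' measurableSet_Icc subset_rfl h i
  have hHf := h.integrableOn_action_error hE hB measurableSet_Icc subset_rfl
  set H : ℝ → ℝ := fun θ => ∫ b, |X.a (X.R θ b) - E.aR θ| ∂(E.anchorLaw θ) with hH
  rw [AnchorOnly.loss, AnchorOnly.surplus, benchmark_eq, hE.surplusOn_eq,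
    ← integral_sub hint1 hint2]
  -- The quadratic loss is bounded below by its tangent line at error `e`, namely `κ * x ^ 2 ≥ 2 * κ
  -- * e * x - κ * e ^ 2`. As the mean error is at least `e`, integration leaves `κ * e ^ 2 - K ^ 2
  -- * d`.
  have hpt : ∀ θ ∈ E.Θ, 2 * κ * e * (H θ * E.f θ) - (κ * e ^ 2 + K ^ 2 * d) * E.f θ ≤
      E.ideal d θ i * E.f θ - E.condPayoff d X.R X.a i θ * E.f θ := by
    intro θ hθ
    have hp := hE.isProbabilityMeasure_anchorLaw θ
    have hi := hE.integrable_payoff hB hd' subset_rfl h i hθ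
    have hiH := h.integrable_action_error hE hB (hE.aR_mem hθ) θ θ
    have h1 := integral_mono (μ := E.anchorLaw θ)
      ((hiH.const_mul (2 * κ * e)).sub (integrable_const (κ * e ^ 2 + K ^ 2 * d)))
      ((integrable_const (E.ideal d θ i)).sub hi) fun b => by
        have h2 := hE.loss_lower hB hd' (h.a_mem (X.R θ b)) hθ (X.R θ b) b i
        have h3 := mul_nonneg hκ.le (sq_nonneg (|X.a (X.R θ b) - E.aR θ| - e))
        rw [← sq_abs] at h2
        simp only [Pi.sub_apply]
        nlinarith
    simp only [Pi.sub_apply] at h1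
    rw [integral_sub (hiH.const_mul _) (integrable_const _), integral_const_mul,
      integral_sub (integrable_const _) hi] at h1
    simp only [integral_const, probReal_univ, one_smul] at h1
    have h4 := mul_le_mul_of_nonneg_right h1 (hE.f_pos θ hθ).le
    simp only [condPayoff]
    simp only [hH]
    linarith
  have hmono := setIntegral_mono_on ((hHf.const_mul (2 * κ * e)).sub
    (hE.integrableOn_f.const_mul (κ * e ^ 2 + K ^ 2 * d))) (hint1.sub hint2) measurableSet_Icc hpt
  simp only [Pi.sub_apply] at hmono
  rw [integral_sub (hHf.const_mul _) (hE.integrableOn_f.const_mul _), integral_const_mul,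
    integral_const_mul, show ∫ θ in Icc E.lo E.hi, E.f θ = 1 from hE.f_mass] at hmono
  have hfin := herr d hd' X.R X.a h
  refine le_trans ?_ hmono
  have := mul_le_mul_of_nonneg_left hfin (show 0 ≤ 2 * κ * e by positivity)
  simp only [Θ] at this
  nlinarith

/-! ### Cells of a partition -/

section Cells

variable {N : ℕ} {t : Fin (N + 1) → ℝ}

theorem cut_mem (ht : StrictMono t) (h0 : t 0 = E.lo) (hN : t (Fin.last N) = E.hi)
    (j : Fin (N + 1)) : t j ∈ E.Θ :=
  ⟨h0 ▸ ht.monotone (Fin.zero_le j), hN ▸ ht.monotone (Fin.le_last j)⟩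

theorem isCell_cell (ht : StrictMono t) (h0 : t 0 = E.lo) (hN : t (Fin.last N) = E.hi)
    (k : Fin N) : E.IsCell (cell t k) (t k.castSucc) (t k.succ) := by
  have h1 := cut_mem ht h0 hN k.castSucc
  have h2 := cut_mem ht h0 hN k.succ
  have h3 := ht (Fin.castSucc_lt_succ (i := k))
  unfold cell
  split_ifs
  · exact IsCell.Icc_cell h1 h2 h3
  · exact IsCell.Ico_cell h1 h2 h3

theorem sum_setIntegral_cell (ht : StrictMono t) (h0 : t 0 = E.lo)
    (hN : t (Fin.last N) = E.hi) {g : ℝ → ℝ} (hg : IntegrableOn g E.Θ) :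
    ∑ k, ∫ θ in cell t k, g θ = ∫ θ in E.Θ, g θ := by
  have hle : E.lo ≤ E.hi := h0 ▸ hN ▸ ht.monotone (Fin.zero_le _)
  -- The cutoffs are extended to all naturals, constant past `N`, so that interval integrals
  -- telescope.
  set t' : ℕ → ℝ := fun j => t ⟨min j N, by omega⟩ with ht'
  have h1 : ∀ k : Fin N, ∫ θ in cell t k, g θ = ∫ θ in (t' k)..(t' (k + 1)), g θ := fun k => by
    rw [(isCell_cell ht h0 hN k).setIntegral_eq]
    have e1 : t' k = t k.castSucc := by
      simp only [ht']; congr 1; ext; simp [k.2.le]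
    have e2 : t' (k + 1) = t k.succ := by
      simp only [ht']; congr 1; ext; simp
    rw [e1, e2]
  simp only [h1]
  rw [Fin.sum_univ_eq_sum_range (fun k => ∫ θ in (t' k)..(t' (k + 1)), g θ) N,
    intervalIntegral.sum_integral_adjacent_intervals]
  · have e1 : t' 0 = E.lo := by rw [← h0]; simp only [ht']; congr 1
    have e2 : t' N = E.hi := by
      rw [← hN]; simp only [ht']; congr 1; ext; simp
    rw [e1, e2, Θ, integral_Icc_eq_integral_Ioc, intervalIntegral.integral_of_le hle]
  · intro k _
    have hm : ∀ j, t' j ∈ uIcc E.lo E.hi := fun j => by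
      rw [uIcc_of_le hle]; exact cut_mem ht h0 hN _
    refine (hg.mono_set ?_).intervalIntegrable
    rw [Θ, ← uIcc_of_le hle]
    exact uIcc_subset_uIcc (hm k) (hm (k + 1))

end Cells

/-! ### Losses of hybrid equilibria -/

namespace Hybrid

variable {d : ℝ} {N : ℕ}

theorem isCell (H : E.Hybrid d N) (k : Fin N) :
    E.IsCell (cell H.cut k) (H.cut k.castSucc) (H.cut k.succ) :=
  isCell_cell H.cut_strictMono H.cut_first H.cut_last k

end Hybrid

namespace IsRegularEq

variable {d : ℝ} {I : Set ℝ} {u v : ℝ} {R : ℝ → ℝ → ℝ} {a : ℝ → ℝ}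

/-- On a cell, actions are within a multiple of its width of every ideal action. -/
theorem abs_action_sub_le (hE : E.Assumptions) (hB : E.Bounds K κ) (hI : E.IsCell I u v)
    (h : E.IsRegularEq d I R a) {θ : ℝ} (hθ : θ ∈ Icc u v) (r : ℝ) :
    |a r - E.aR θ| ≤ K * (v - u) := by
  have h1 := h.a_range hE hB hI r
  have hθ' := hI.Icc_subset hθ
  have hκ := hB.κ_pos
  have h2 := hB.aR_growth u hI.u_mem θ hθ' hθ.1
  have h3 := hB.aR_growth θ hθ' v hI.v_mem hθ.2
  have h4 := le_of_abs_le (hB.aR_lip u hI.u_mem v hI.v_mem)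
  rw [abs_of_pos (sub_pos.2 hI.lt)] at h4
  have h5 := mul_nonneg hκ.le (sub_nonneg.2 hθ.1)
  have h6 := mul_nonneg hκ.le (sub_nonneg.2 hθ.2)
  exact abs_le.2 ⟨by linarith [h1.1], by linarith [h1.2]⟩

/-- Both ideal and equilibrium actions lie within `K * (v - u)` of each other. For the sender the
reporting cost is of the same order by `D_report_le`, and replacing `aS` by `aR` in the benchmark
costs `K ^ 2 * d`. -/
theorem abs_ideal_sub_payoff_le (hE : E.Assumptions) (hB : E.Bounds K κ) (hd : d ∈ Icc 0 E.d₀)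
    (hI : E.IsCell I u v) (h : E.IsRegularEq d I R a) {θ : ℝ} (hθ : θ ∈ I) (b : ℝ)
    (i : Player) :
    |E.ideal d θ i - E.payoff d (a (R θ b)) (R θ b) θ b i| ≤
      3 * K ^ 2 * (v - u) + K ^ 2 * d := by
  have hK := hB.K_one
  have hθ' := hI.subset hθ
  have hw := sub_pos.2 hI.lt
  have ha := fun r => h.abs_action_sub_le hE hB hI (hI.subset_Icc hθ) r
  have hsq : 0 ≤ K ^ 2 * (v - u) := by positivity
  have hd0 : 0 ≤ K ^ 2 * d := mul_nonneg (sq_nonneg _) hd.1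
  cases i with
  | receiver =>
    have h1 := hB.UR_lip _ (h.a_mem (R θ b)) _ (hE.aR_mem hθ') θ hθ'
    have h2 := mul_le_mul_of_nonneg_left (ha (R θ b)) (show 0 ≤ K by linarith)
    rw [abs_sub_comm (E.aR θ)] at h1
    simp only [ideal, payoff]
    nlinarith
  | sender =>
    have h1 := hB.US_lip _ (h.a_mem (R θ b)) _ (hE.aR_mem hθ') θ hθ' θ hθ' d hd
    have h2 := mul_le_mul_of_nonneg_left (ha (R θ b)) (show 0 ≤ K by linarith)
    have h3 := hB.US_lip _ (h.a_mem b) _ (h.a_mem (R θ b)) θ hθ' θ hθ' d hd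
    have h4 : |a (R θ b) - a b| ≤ 2 * (K * (v - u)) := by
      have h5 := abs_le.1 (ha (R θ b))
      have h6 := abs_le.1 (ha b)
      exact abs_le.2 ⟨by linarith, by linarith⟩
    have h7 := h.D_report_le hE hθ b
    have h8 := hB.D_nonneg (R θ b) b
    have h9 := hE.ideal_sender_le hB hd hθ'
    have h10 := (hE.aS_spec hd hθ').2 _ (hE.aR_mem hθ')
    simp only [sub_self, abs_zero, add_zero] at h1 h3
    rw [abs_sub_comm (E.aR θ)] at h1
    have h11 := mul_le_mul_of_nonneg_left h4 (show 0 ≤ K by linarith)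
    have h12 := abs_le.1 h1
    have h13 := le_of_abs_le h3
    simp only [ideal, payoff]
    exact abs_le.2 ⟨by nlinarith, by nlinarith⟩

end IsRegularEq

/-- The pointwise bound is integrated cell by cell; the total mass of `f` is one, so the number of
cells does not enter. -/
theorem Hybrid.abs_loss_le (hE : E.Assumptions) (hB : E.Bounds K κ) {d : ℝ}
    (hd : d ∈ Icc 0 E.d₀) {N : ℕ} (H : E.Hybrid d N) (i : Player) {w : ℝ}
    (hw : H.FinerThan w) : |H.loss i| ≤ 3 * K ^ 2 * w + K ^ 2 * d := by
  set C := 3 * K ^ 2 * w + K ^ 2 * d with hC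
  have hint1 := hE.integrableOn_ideal hB hd i
  have hcell : ∀ k : Fin N,
      |(∫ θ in cell H.cut k, E.ideal d θ i * E.f θ) -
        E.surplusOn d (cell H.cut k) (H.R k) (H.a k) i| ≤ ∫ θ in cell H.cut k, C * E.f θ := by
    intro k
    have hI := H.isCell k
    have h := H.regular k
    have hint2 := hE.integrableOn_condPayoff hB hd hI.measurable hI.subset h i
    have hint1' := hint1.mono_set hI.subset
    rw [hE.surplusOn_eq, ← integral_sub hint1' hint2]
    refine abs_integral_le_integral_abs.trans (setIntegral_mono_on (hint1'.sub hint2).abs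
      ((hE.integrableOn_f.mono_set hI.subset).const_mul C) hI.measurable fun θ hθ => ?_)
    have hp := hE.isProbabilityMeasure_anchorLaw θ
    have hi := hE.integrable_payoff hB hd hI.subset h i hθ
    rw [← sub_mul, abs_mul, abs_of_pos (hE.f_pos θ (hI.subset hθ))]
    refine mul_le_mul_of_nonneg_right ?_ (hE.f_pos θ (hI.subset hθ)).le
    have e : E.ideal d θ i - E.condPayoff d (H.R k) (H.a k) i θ =
        ∫ b, (E.ideal d θ i - E.payoff d (H.a k (H.R k θ b)) (H.R k θ b) θ b i)
          ∂(E.anchorLaw θ) := by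
      rw [integral_sub (integrable_const _) hi]
      simp [condPayoff]
    rw [e]
    have := norm_integral_le_of_norm_le_const (μ := E.anchorLaw θ) (C := C)
      (f := fun b => E.ideal d θ i - E.payoff d (H.a k (H.R k θ b)) (H.R k θ b) θ b i)
      (Eventually.of_forall fun b => (h.abs_ideal_sub_payoff_le hE hB hd hI hθ b i).trans (by
        have := hw k
        rw [hC]
        gcongr))
    simpa using this
  rw [Hybrid.loss, Hybrid.surplus, benchmark_eq,
    ← sum_setIntegral_cell H.cut_strictMono H.cut_first H.cut_last hint1,
    ← Finset.sum_sub_distrib]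
  refine (Finset.abs_sum_le_sum_abs _ _).trans ((Finset.sum_le_sum fun k _ => hcell k).trans ?_)
  rw [sum_setIntegral_cell H.cut_strictMono H.cut_first H.cut_last
    (hE.integrableOn_f.const_mul C), integral_const_mul, hE.f_mass, mul_one]

/-- Hybrid losses vanish with the misalignment and the mesh. -/
theorem Assumptions.hybrid_loss_vanishes (hE : E.Assumptions) {ε : ℝ} (hε : 0 < ε) :
    ∃ w > 0, ∃ d₁ ∈ Ioc 0 E.d₀, ∀ d ∈ Ioo 0 d₁, ∀ (N : ℕ) (H : E.Hybrid d N)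
        (i : Player), H.FinerThan w → |H.loss i| < ε := by
  obtain ⟨K, κ, hB⟩ := hE.exists_bounds
  have hK := hB.K_one
  refine ⟨ε / (12 * K ^ 2), by positivity, min E.d₀ (ε / (4 * K ^ 2)),
    ⟨lt_min hE.d₀_pos (by positivity), min_le_left _ _⟩, ?_⟩
  intro d hd N H i hw
  have hd' : d ∈ Icc 0 E.d₀ := ⟨hd.1.le, hd.2.le.trans (min_le_left _ _)⟩
  have h := H.abs_loss_le hE hB hd' i hw
  have h1 : 3 * K ^ 2 * (ε / (12 * K ^ 2)) = ε / 4 := by field_simp; norm_num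
  have h2 : K ^ 2 * d ≤ ε / 4 := by
    have : d ≤ ε / (4 * K ^ 2) := hd.2.le.trans (min_le_right _ _)
    rw [le_div_iff₀ (by positivity)] at this
    linarith
  linarith

/-! ### Values of labels -/

section LabelValue

variable {d : ℝ} {a : ℝ → ℝ} {θ : ℝ}

theorem senderObj_le_bound (hB : E.Bounds K κ) (hd : d ∈ Icc 0 E.d₀) (ha : ∀ r, a r ∈ E.A)
    (hθ : θ ∈ E.Θ) (b r : ℝ) : E.senderObj d a θ b r ≤ E.US (a r) θ d ∧
      E.US (a r) θ d ≤ K := by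
  have h1 := hB.D_nonneg r b
  have h2 := le_of_abs_le (hB.US_bound _ (ha r) θ hθ d hd)
  unfold senderObj
  exact ⟨by linarith, h2⟩

theorem bddAbove_senderObj (hB : E.Bounds K κ) (hd : d ∈ Icc 0 E.d₀) (ha : ∀ r, a r ∈ E.A)
    (hθ : θ ∈ E.Θ) (b : ℝ) : BddAbove (range fun r => E.senderObj d a θ b r) := by
  refine ⟨K, ?_⟩
  rintro _ ⟨r, rfl⟩
  have := senderObj_le_bound hB hd ha hθ b r
  exact this.1.trans this.2

theorem US_le_iSup (hE : E.Assumptions) (hB : E.Bounds K κ) (hd : d ∈ Icc 0 E.d₀)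
    (ha : ∀ r, a r ∈ E.A) (hθ : θ ∈ E.Θ) (b : ℝ) :
    E.US (a b) θ d ≤ ⨆ r, E.senderObj d a θ b r := by
  refine le_trans ?_ (le_ciSup (bddAbove_senderObj hB hd ha hθ b) b)
  simp [senderObj, hE.D_self]

/-- The supremum runs over uncountably many reports; it is measurable because a supremum of
continuous functions of `b` is lower semicontinuous. -/
theorem measurable_iSup_senderObj (hE : E.Assumptions) (hB : E.Bounds K κ)
    (hd : d ∈ Icc 0 E.d₀) (ha : ∀ r, a r ∈ E.A) (hθ : θ ∈ E.Θ) :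
    Measurable fun b => ⨆ r, E.senderObj d a θ b r := by
  refine (lowerSemicontinuous_ciSup (f := fun r b => E.senderObj d a θ b r)
    (fun b => bddAbove_senderObj hB hd ha hθ b) fun r => Continuous.lowerSemicontinuous ?_).measurable
  have := hE.continuous_φ
  unfold senderObj D
  fun_prop

theorem abs_iSup_senderObj_le (hE : E.Assumptions) (hB : E.Bounds K κ)
    (hd : d ∈ Icc 0 E.d₀) (ha : ∀ r, a r ∈ E.A) (hθ : θ ∈ E.Θ) (b : ℝ) :
    |⨆ r, E.senderObj d a θ b r| ≤ K := by
  have h1 := US_le_iSup hE hB hd ha hθ b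
  have h2 := neg_le_of_abs_le (hB.US_bound _ (ha b) θ hθ d hd)
  exact abs_le.2 ⟨by linarith, ciSup_le fun r =>
    (senderObj_le_bound hB hd ha hθ b r).1.trans (senderObj_le_bound hB hd ha hθ b r).2⟩

theorem labelValue_eq (hE : E.Assumptions) : E.labelValue d a θ =
    ∫ b, (⨆ r, E.senderObj d a θ b r) ∂(E.anchorLaw θ) := by
  rw [hE.integral_anchorLaw]; rfl

theorem integrable_iSup_senderObj (hE : E.Assumptions) (hB : E.Bounds K κ)
    (hd : d ∈ Icc 0 E.d₀) (ha : ∀ r, a r ∈ E.A) (hθ : θ ∈ E.Θ) (θ' : ℝ) :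
    Integrable (fun b => ⨆ r, E.senderObj d a θ b r) (E.anchorLaw θ') :=
  hE.integrable_anchorLaw θ' (measurable_iSup_senderObj hE hB hd ha hθ)
    (abs_iSup_senderObj_le hE hB hd ha hθ)

theorem labelValue_le (hE : E.Assumptions) (hB : E.Bounds K κ) (hd : d ∈ Icc 0 E.d₀)
    (ha : ∀ r, a r ∈ E.A) (hθ : θ ∈ E.Θ) {g : ℝ → ℝ} (hg : Integrable g (E.anchorLaw θ))
    (hle : ∀ b r, E.senderObj d a θ b r ≤ g b) :
    E.labelValue d a θ ≤ ∫ b, g b ∂(E.anchorLaw θ) := by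
  rw [labelValue_eq hE]
  exact integral_mono (integrable_iSup_senderObj hE hB hd ha hθ θ) hg fun b => ciSup_le (hle b)

/-- Truthful reporting is free, so a label is worth at least the expected payoff of the action read
off at the anchor itself. -/
theorem le_labelValue (hE : E.Assumptions) (hB : E.Bounds K κ) (hd : d ∈ Icc 0 E.d₀)
    (ha : ∀ r, a r ∈ E.A) (hθ : θ ∈ E.Θ) {g : ℝ → ℝ} (hg : Integrable g (E.anchorLaw θ))
    (hle : ∀ b, g b ≤ E.US (a b) θ d) :
    ∫ b, g b ∂(E.anchorLaw θ) ≤ E.labelValue d a θ := by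
  rw [labelValue_eq hE]
  exact integral_mono hg (integrable_iSup_senderObj hE hB hd ha hθ θ) fun b =>
    (hle b).trans (US_le_iSup hE hB hd ha hθ b)

/-- Values of labels are Lipschitz in the state. -/
theorem abs_labelValue_sub_le (hE : E.Assumptions) (hB : E.Bounds K κ) (hd : d ∈ Icc 0 E.d₀)
    (ha : ∀ r, a r ∈ E.A) (hθ : θ ∈ E.Θ) {θ' : ℝ} (hθ' : θ' ∈ E.Θ) :
    |E.labelValue d a θ' - E.labelValue d a θ| ≤ (K + K * K) * |θ' - θ| := by
  have hsup : ∀ x ∈ E.Θ, ∀ y ∈ E.Θ, ∀ b, (⨆ r, E.senderObj d a x b r) ≤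
      (⨆ r, E.senderObj d a y b r) + K * |x - y| := fun x hx y hy b => by
    refine ciSup_le fun r => ?_
    have h1 := le_ciSup (bddAbove_senderObj hB hd ha hy b) r
    have h2 := le_of_abs_le (hB.US_lip _ (ha r) _ (ha r) y hy x hx d hd)
    rw [sub_self, abs_zero, zero_add] at h2
    simp only [senderObj] at h1 ⊢
    linarith
  have hp := hE.isProbabilityMeasure_anchorLaw θ'
  -- The state enters twice: through the law of the anchor, with constant `K * K`, and through the
  -- payoff, with constant `K`.
  have h1 := hB.anchor_lip θ hθ θ' hθ' _ K (measurable_iSup_senderObj hE hB hd ha hθ)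
    (abs_iSup_senderObj_le hE hB hd ha hθ)
  have h2 : |∫ b, (⨆ r, E.senderObj d a θ' b r) ∂(E.anchorLaw θ') -
      ∫ b, (⨆ r, E.senderObj d a θ b r) ∂(E.anchorLaw θ')| ≤ K * |θ' - θ| := by
    rw [← integral_sub (integrable_iSup_senderObj hE hB hd ha hθ' θ')
      (integrable_iSup_senderObj hE hB hd ha hθ θ')]
    have := norm_integral_le_of_norm_le_const (μ := E.anchorLaw θ') (C := K * |θ' - θ|)
      (f := fun b => (⨆ r, E.senderObj d a θ' b r) - ⨆ r, E.senderObj d a θ b r)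
      (Eventually.of_forall fun b => by
        have h3 := hsup θ hθ θ' hθ' b
        have h4 := hsup θ' hθ' θ hθ b
        rw [abs_sub_comm] at h3
        exact abs_le.2 ⟨by linarith, by linarith⟩)
    simpa using this
  rw [labelValue_eq hE, labelValue_eq hE]
  have h3 := abs_sub_le (∫ b, (⨆ r, E.senderObj d a θ' b r) ∂(E.anchorLaw θ'))
    (∫ b, (⨆ r, E.senderObj d a θ b r) ∂(E.anchorLaw θ'))
    (∫ b, (⨆ r, E.senderObj d a θ b r) ∂(E.anchorLaw θ))
  linarith

end LabelValue

/-! ### Narrow cells -/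

/-- The ratio of report displacements to the scale of a narrow cell. -/
noncomputable def displacement (K κ : ℝ) : ℝ := 2 * K ^ 2 * (K + 1) / κ + 1

namespace IsRegularEq

variable {d : ℝ} {I : Set ℝ} {u v : ℝ} {R : ℝ → ℝ → ℝ} {a : ℝ → ℝ} {h : ℝ}

/-- The prior mean of a cell. -/
theorem _root_.HardSoft.Model.IsCell.exists_mean (hE : E.Assumptions) (hI : E.IsCell I u v) :
    ∃ m ∈ Icc u v, ∫ θ in I, (θ - m) * E.f θ = 0 := by
  have hF := hE.integral_f_pos hI
  have hfi := hE.integrableOn_f.mono_set hI.subset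
  have hθf : IntegrableOn (fun θ => θ * E.f θ) I :=
    ((continuousOn_id.mul hE.f_cont).integrableOn_compact isCompact_Icc).mono_set hI.subset
  refine ⟨(∫ θ in I, θ * E.f θ) / ∫ θ in I, E.f θ, ⟨?_, ?_⟩, ?_⟩
  · rw [le_div_iff₀ hF, ← integral_const_mul]
    exact setIntegral_mono_on (hfi.const_mul u) hθf hI.measurable fun θ hθ =>
      mul_le_mul_of_nonneg_right (hI.subset_Icc hθ).1 (hE.f_pos θ (hI.subset hθ)).le
  · rw [div_le_iff₀ hF, ← integral_const_mul]
    exact setIntegral_mono_on hθf (hfi.const_mul v) hI.measurable fun θ hθ =>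
      mul_le_mul_of_nonneg_right (hI.subset_Icc hθ).2 (hE.f_pos θ (hI.subset hθ)).le
  · simp only [sub_mul]
    rw [integral_sub hθf (hfi.const_mul _), integral_const_mul]
    field_simp
    ring

theorem displacement_nonneg (hB : E.Bounds K κ) : 0 ≤ displacement K κ := by
  have h1 := hB.K_one
  have h2 := hB.κ_pos
  unfold displacement
  positivity

theorem abs_action_sub_ideal_le (hE : E.Assumptions) (hB : E.Bounds K κ) (hI : E.IsCell I u v)
    (eq : E.IsRegularEq d I R a) (hw : v - u ≤ h) {θ : ℝ} (hθ : θ ∈ Icc u v) (r : ℝ) :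
    |a r - E.aR θ| ≤ K * h :=
  (eq.abs_action_sub_le hE hB hI hθ r).trans
    (mul_le_mul_of_nonneg_left hw (by linarith [hB.K_one]))

/-- Expected variation of the action over a window of the size of report displacements. -/
theorem integral_window_le (hE : E.Assumptions) (hB : E.Bounds K κ) (hI : E.IsCell I u v)
    (eq : E.IsRegularEq d I R a) (hw : v - u ≤ h) {s : ℝ} (hs : 0 ≤ s) (θ : ℝ) :
    ∫ b, (a (b + s) - a (b - s)) ∂(E.anchorLaw θ) ≤ K * (K * h) * s := by
  have hp := hE.isProbabilityMeasure_anchorLaw θ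
  have hu : u ∈ Icc u v := left_mem_Icc.2 hI.lt.le
  have hm : Measurable fun b => a b - E.aR u := eq.a_cont.measurable.sub_const _
  have hb := fun r => eq.abs_action_sub_ideal_le hE hB hI hw hu r
  have h1 := le_of_abs_le (hB.anchor_shift θ (fun b => a b - E.aR u) (K * h) s hs hm hb)
  have m1 : Measurable fun b => a (b + s) - E.aR u := hm.comp (measurable_id.add_const s)
  have m2 : Measurable fun b => a (b - s) - E.aR u := hm.comp (measurable_id.sub_const s)
  rw [← integral_sub (hE.integrable_anchorLaw θ m1 fun b => hb _)
    (hE.integrable_anchorLaw θ m2 fun b => hb _)] at h1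
  simpa using h1

theorem integrable_window (hE : E.Assumptions) (hB : E.Bounds K κ)
    (eq : E.IsRegularEq d I R a) (s θ : ℝ) :
    Integrable (fun b => a (b + s) - a (b - s)) (E.anchorLaw θ) := by
  have ham := eq.a_cont.measurable
  exact hE.integrable_anchorLaw θ
    ((ham.comp (measurable_id.add_const s)).sub (ham.comp (measurable_id.sub_const s)))
    fun b => hB.A_width _ (eq.a_mem _) _ (eq.a_mem _)

/-- On a narrow cell the equilibrium action is, on average and up to second order, the ideal
action at the prior mean. -/
theorem integral_action_error_le (hE : E.Assumptions) (hB : E.Bounds K κ)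
    (hd : d ∈ Icc 0 E.d₀) (hI : E.IsCell I u v) (eq : E.IsRegularEq d I R a) (hw : v - u ≤ h)
    (hdh : d ≤ h) {m : ℝ} (hm : m ∈ Icc u v) (hm0 : ∫ θ in I, (θ - m) * E.f θ = 0) :
    κ * ∫ θ in I, (∫ b, |a (R θ b) - E.aR m| ∂(E.anchorLaw θ)) * E.f θ ≤
      (K ^ 2 * (displacement K κ + 1) + K * (K + 1) ^ 2) * h ^ 2 * ∫ θ in I, E.f θ := by
  have hK := hB.K_one
  have hκ := hB.κ_pos
  have hh : 0 ≤ h := hd.1.trans hdh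
  have hC1 := displacement_nonneg hB
  set C1 := displacement K κ with hC1def
  have hmΘ := hI.Icc_subset hm
  have hmA := hE.aR_mem hmΘ
  have ham := eq.a_cont.measurable
  -- The test function is the sign of `a r - aR m`: it produces the absolute error and, like `a`, is
  -- monotone in the report.
  set s : ℝ → ℝ := fun r => if E.aR m ≤ a r then 1 else -1 with hs
  have hsm : Measurable s := Measurable.ite (measurableSet_le measurable_const ham)
    measurable_const measurable_const
  have hs1 : ∀ r, |s r| ≤ 1 := fun r => by simp only [hs]; split_ifs <;> simp
  have hsmono : Monotone s := fun x y hxy => by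
    have := eq.a_mono.monotone hxy
    simp only [hs]
    split_ifs <;> linarith
  have hsabs : ∀ r, s r * (a r - E.aR m) = |a r - E.aR m| := fun r => by
    simp only [hs]
    split_ifs with hc
    · rw [one_mul, abs_of_nonneg (sub_nonneg.2 hc)]
    · push Not at hc
      rw [abs_of_neg (sub_neg.2 hc)]; ring
  have hnear := fun θ (hθ : θ ∈ Icc u v) r => eq.abs_action_sub_ideal_le hE hB hI hw hθ r
  have hR : ∀ θ ∈ I, ∀ b, |R θ b - b| ≤ C1 * h := fun θ hθ b =>
    eq.abs_report_sub_le hθ fun r hr => hB.senderObj_lt_of_far_of_near hE hd eq.a_mem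
      (hI.subset hθ) hdh (hnear θ (hI.subset_Icc hθ)) hr
  have horth := eq.orthogonality hE hI hsm hs1
  set g0 := ∫ b, s b ∂(E.anchorLaw u) with hg0
  -- The expected sign is nearly the same in all states of the cell: the anchor law is Lipschitz in
  -- the state, and displacing reports by `C1 * h` costs one translation of a monotone bounded
  -- function.
  have hg : ∀ θ ∈ I, |∫ b, s (R θ b) ∂(E.anchorLaw θ) - g0| ≤ K * (C1 + 1) * h := by
    intro θ hθ
    have hsi : ∀ {φ : ℝ → ℝ}, Measurable φ → Integrable (fun b => s (φ b)) (E.anchorLaw θ) :=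
      fun hφ => hE.integrable_anchorLaw θ (hsm.comp hφ) fun b => hs1 _
    have i1 := hsi (measurable_id.add_const (C1 * h))
    have i2 := hsi (measurable_id.sub_const (C1 * h))
    have h1 := le_of_abs_le (hB.anchor_shift θ s 1 (C1 * h) (by positivity) hsm hs1)
    have h2 := hB.anchor_lip u hI.u_mem θ (hI.subset hθ) s 1 hsm hs1
    have h3 := integral_mono (hsi (eq.measurable_report θ)) i1 fun b =>
      hsmono (by have := (abs_le.1 (hR θ hθ b)).2; simp only [id]; linarith)
    have h4 := integral_mono i2 (hsi (eq.measurable_report θ)) fun b =>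
      hsmono (by have := (abs_le.1 (hR θ hθ b)).1; simp only [id]; linarith)
    have hpos : 0 ≤ C1 * h := by positivity
    have h5 := integral_mono (hsi measurable_id) i1 fun b =>
      hsmono (by simp only [id]; linarith)
    have h6 := integral_mono i2 (hsi measurable_id) fun b =>
      hsmono (by simp only [id]; linarith)
    simp only [id] at h3 h4 h5 h6
    have h7 : |θ - u| ≤ h := by
      have := hI.subset_Icc hθ
      rw [abs_of_nonneg (by linarith [this.1])]
      linarith [this.2]
    have h8 : K * 1 * |θ - u| ≤ K * h := by rw [mul_one]; gcongr
    have h9 := abs_le.1 (h2.trans h8)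
    exact abs_le.2 ⟨by nlinarith [h9.1], by nlinarith [h9.2]⟩
  set α := E.UR11 (E.aR m) m with hα
  set β := E.UR12 (E.aR m) m with hβ
  have hακ : κ ≤ -α := by linarith [hB.UR11_le _ hmA m hmΘ]
  have hβ0 : 0 ≤ β := hκ.le.trans (hB.UR12_ge _ hmA m hmΘ)
  have hβK : β ≤ K := le_of_abs_le (hB.UR12_bound _ hmA m hmΘ)
  have hiE : ∀ θ, Integrable (fun b => |a (R θ b) - E.aR m|) (E.anchorLaw θ) := fun θ =>
    eq.integrable_action_error hE hB hmA θ θ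
  obtain ⟨B1, hB10, hB1⟩ := exists_bound_of_continuousOn Assumptions.isCompact_A_prod_Θ
    (hE.continuousOn_UR1.mono (prod_mono (subset_univ _) subset_rfl))
  have hUm : Measurable fun p : ℝ × ℝ => s (R p.1 p.2) * E.UR1 (a (R p.1 p.2)) (E.clamp p.1) :=
    (hsm.comp eq.measurable_R).mul
      (hE.measurable_UR1_comp (ham.comp eq.measurable_R) measurable_fst)
  have hUB : ∀ p : ℝ × ℝ, |s (R p.1 p.2) * E.UR1 (a (R p.1 p.2)) (E.clamp p.1)| ≤ B1 :=
    fun p => by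
      rw [abs_mul]
      have := mul_le_mul (hs1 (R p.1 p.2)) (hB1 (a (R p.1 p.2), E.clamp p.1)
        ⟨eq.a_mem _, hE.clamp_mem _⟩) (norm_nonneg _) zero_le_one
      simpa using this
  have hiU : ∀ θ ∈ I, Integrable (fun b => s (R θ b) * E.UR1 (a (R θ b)) θ) (E.anchorLaw θ) := by
    intro θ hθ
    have := hE.integrable_anchorLaw θ
      (hUm.comp (measurable_const (a := θ) |>.prodMk measurable_id)) (fun b => hUB _)
    simpa [Function.comp_def, clamp_of_mem (hI.subset hθ)] using this
  have hIU : IntegrableOn (fun θ => (∫ b, s (R θ b) * E.UR1 (a (R θ b)) θ ∂(E.anchorLaw θ)) *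
      E.f θ) I := by
    refine (hE.integrableOn_expectation hI.measurable hI.subset hUm hUB).congr_fun
      (fun θ hθ => ?_) hI.measurable
    simp only [clamp_of_mem (hI.subset hθ)]
  have hIE : IntegrableOn (fun θ => (∫ b, |a (R θ b) - E.aR m| ∂(E.anchorLaw θ)) * E.f θ) I :=
    hE.integrableOn_expectation hI.measurable hI.subset (B := K)
      (G := fun p => |a (R p.1 p.2) - E.aR m|)
      ((ham.comp eq.measurable_R).sub_const _).abs
      fun p => by rw [abs_abs]; exact hB.A_width _ hmA _ (eq.a_mem _)
  set C2 := K ^ 2 * (C1 + 1) + K * (K + 1) ^ 2 with hC2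
  have hfi := hE.integrableOn_f.mono_set hI.subset
  have hθf : IntegrableOn (fun θ => (θ - m) * E.f θ) I :=
    (((continuousOn_id.sub continuousOn_const).mul hE.f_cont).integrableOn_compact
      isCompact_Icc).mono_set hI.subset
  -- `UR1` is expanded at `(aR m, m)`. The state term pairs `β * (θ - m)` with the expected sign `g0
  -- + O(h)`; its main part integrates to zero because `m` is the prior mean, and the rest is `O(h ^
  -- 2)`.
  have hpt : ∀ θ ∈ I, κ * ((∫ b, |a (R θ b) - E.aR m| ∂(E.anchorLaw θ)) * E.f θ) ≤
      -((∫ b, s (R θ b) * E.UR1 (a (R θ b)) θ ∂(E.anchorLaw θ)) * E.f θ) +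
      β * g0 * ((θ - m) * E.f θ) + C2 * h ^ 2 * E.f θ := by
    intro θ hθ
    have hθΘ := hI.subset hθ
    have hp := hE.isProbabilityMeasure_anchorLaw θ
    have hθm : |θ - m| ≤ h := by
      have := hI.subset_Icc hθ
      exact abs_le.2 ⟨by linarith [this.1, hm.2], by linarith [this.2, hm.1]⟩
    have hsi : Integrable (fun b => s (R θ b)) (E.anchorLaw θ) :=
      hE.integrable_anchorLaw θ (hsm.comp (eq.measurable_report θ)) fun b => hs1 _
    have h1 : ∀ b, κ * |a (R θ b) - E.aR m| ≤ -(s (R θ b) * E.UR1 (a (R θ b)) θ) +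
        β * (θ - m) * s (R θ b) + K * (K + 1) ^ 2 * h ^ 2 := by
      intro b
      set x := a (R θ b) with hx
      set σ := s (R θ b) with hσ
      have ht := hB.UR1_taylor _ hmA x (eq.a_mem _) m hmΘ θ hθΘ
      rw [hE.UR1_aR hmΘ, sub_zero] at ht
      have hxm : |x - E.aR m| ≤ K * h := hnear m hm _
      have h2 : K * (|x - E.aR m| + |θ - m|) ^ 2 ≤ K * (K * h + h) ^ 2 := by gcongr
      have h3 : |σ * (E.UR1 x θ - (α * (x - E.aR m) + β * (θ - m)))| ≤ K * (K * h + h) ^ 2 := by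
        rw [abs_mul]
        calc _ ≤ 1 * |E.UR1 x θ - (α * (x - E.aR m) + β * (θ - m))| :=
              mul_le_mul_of_nonneg_right (hs1 _) (abs_nonneg _)
          _ ≤ _ := by rw [one_mul]; exact ht.trans h2
      have h4 : σ * (x - E.aR m) = |x - E.aR m| := hsabs _
      have h5 : κ * |x - E.aR m| ≤ -α * |x - E.aR m| :=
        mul_le_mul_of_nonneg_right hακ (abs_nonneg _)
      rw [← h4] at h5
      have h6 := (abs_le.1 h3).2
      rw [← h4]
      linarith
    have i1 : Integrable (fun b => -(s (R θ b) * E.UR1 (a (R θ b)) θ)) (E.anchorLaw θ) :=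
      (hiU θ hθ).neg
    have i2 := hsi.const_mul (β * (θ - m))
    have i3 : Integrable (fun b => -(s (R θ b) * E.UR1 (a (R θ b)) θ) +
      β * (θ - m) * s (R θ b)) (E.anchorLaw θ) := i1.add i2
    have h2 := integral_mono ((hiE θ).const_mul κ)
      (i3.add (integrable_const (K * (K + 1) ^ 2 * h ^ 2))) h1
    simp only [Pi.add_apply] at h2
    rw [integral_const_mul, integral_add i3 (integrable_const _), integral_add i1 i2,
      integral_const_mul, integral_neg] at h2
    simp only [integral_const, probReal_univ, one_smul] at h2
    have h3 : β * (θ - m) * ∫ b, s (R θ b) ∂(E.anchorLaw θ) ≤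
        β * (θ - m) * g0 + K * h * (K * (C1 + 1) * h) := by
      have h4 : |β * (θ - m) * (∫ b, s (R θ b) ∂(E.anchorLaw θ) - g0)| ≤
          K * h * (K * (C1 + 1) * h) := by
        rw [abs_mul, abs_mul, abs_of_nonneg hβ0]
        exact mul_le_mul (mul_le_mul hβK hθm (abs_nonneg _) (by linarith)) (hg θ hθ)
          (abs_nonneg _) (by positivity)
      have := le_of_abs_le h4
      linarith
    have h4 := mul_le_mul_of_nonneg_right (h2.trans (add_le_add_left (add_le_add_right h3 _) _))
      (hE.f_pos θ hθΘ).le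
    calc _ = (κ * ∫ b, |a (R θ b) - E.aR m| ∂(E.anchorLaw θ)) * E.f θ := by ring
      _ ≤ _ := h4
      _ = _ := by rw [hC2]; ring
  have i1 : IntegrableOn (fun θ =>
    -((∫ b, s (R θ b) * E.UR1 (a (R θ b)) θ ∂(E.anchorLaw θ)) * E.f θ)) I := hIU.neg
  have i2 := hθf.const_mul (β * g0)
  have i3 : IntegrableOn (fun θ =>
    -((∫ b, s (R θ b) * E.UR1 (a (R θ b)) θ ∂(E.anchorLaw θ)) * E.f θ) +
      β * g0 * ((θ - m) * E.f θ)) I := i1.add i2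
  have i4 := hfi.const_mul (C2 * h ^ 2)
  have hfin := setIntegral_mono_on (hIE.const_mul κ) (i3.add i4) hI.measurable hpt
  simp only [Pi.add_apply] at hfin
  rw [integral_const_mul, integral_add i3 i4, integral_add i1 i2, integral_neg, horth,
    integral_const_mul, integral_const_mul, hm0] at hfin
  linarith

end IsRegularEq

/-- Constant for the average action error on narrow cells. -/
noncomputable def actionConst (K κ : ℝ) : ℝ :=
  (K ^ 2 * (displacement K κ + 1) + K * (K + 1) ^ 2) / κ + K ^ 2 * (displacement K κ + 1)

/-- Constant for the value of labels of narrow cells. -/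
noncomputable def valueConst (K κ : ℝ) : ℝ :=
  K * (K + 1) * (actionConst K κ + K ^ 2 * displacement K κ)

theorem actionConst_nonneg (hB : E.Bounds K κ) : 0 ≤ actionConst K κ := by
  have h1 := hB.K_one
  have h2 := hB.κ_pos
  have h3 := IsRegularEq.displacement_nonneg hB
  unfold actionConst
  positivity

theorem valueConst_nonneg (hB : E.Bounds K κ) : 0 ≤ valueConst K κ := by
  have h1 := hB.K_one
  have h3 := IsRegularEq.displacement_nonneg hB
  have h4 := actionConst_nonneg hB
  unfold valueConst
  positivity

namespace IsRegularEq

variable {d : ℝ} {I : Set ℝ} {u v : ℝ} {R : ℝ → ℝ → ℝ} {a : ℝ → ℝ} {h : ℝ}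

/-- The equilibrium report is replaced by the anchor and the state `θ` by `t`. Actions on the cell
vary by `O(h)`, and the translation and the change of law each contribute another factor `h`, so the
error stays `O(h ^ 2)`. Averaging over `θ` then applies `integral_action_error_le`. -/
theorem integral_truthful_error_le (hE : E.Assumptions) (hB : E.Bounds K κ)
    (hd : d ∈ Icc 0 E.d₀) (hI : E.IsCell I u v) (eq : E.IsRegularEq d I R a) (hw : v - u ≤ h)
    (hdh : d ≤ h) {m : ℝ} (hm : m ∈ Icc u v) (hm0 : ∫ θ in I, (θ - m) * E.f θ = 0) {t : ℝ}
    (ht : t ∈ Icc u v) :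
    ∫ b, |a b - E.aR m| ∂(E.anchorLaw t) ≤ actionConst K κ * h ^ 2 := by
  have hK := hB.K_one
  have hκ := hB.κ_pos
  have hh : 0 ≤ h := hd.1.trans hdh
  have hC1 := displacement_nonneg hB
  have hmΘ := hI.Icc_subset hm
  have hmA := hE.aR_mem hmΘ
  have ham := eq.a_cont.measurable
  have hnear := fun θ (hθ : θ ∈ Icc u v) r => eq.abs_action_sub_ideal_le hE hB hI hw hθ r
  have hfi := hE.integrableOn_f.mono_set hI.subset
  have hF := hE.integral_f_pos hI
  have hIE : IntegrableOn (fun θ => (∫ b, |a (R θ b) - E.aR m| ∂(E.anchorLaw θ)) * E.f θ) I :=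
    hE.integrableOn_expectation hI.measurable hI.subset (B := K)
      (G := fun p => |a (R p.1 p.2) - E.aR m|)
      ((ham.comp eq.measurable_R).sub_const _).abs
      fun p => by rw [abs_abs]; exact hB.A_width _ hmA _ (eq.a_mem _)
  have hmain := eq.integral_action_error_le hE hB hd hI hw hdh hm hm0
  set T := ∫ b, |a b - E.aR m| ∂(E.anchorLaw t) with hT
  set C1 := displacement K κ with hC1def
  have hpt : ∀ θ ∈ I, T * E.f θ ≤ (∫ b, |a (R θ b) - E.aR m| ∂(E.anchorLaw θ)) * E.f θ +
      K ^ 2 * (C1 + 1) * h ^ 2 * E.f θ := by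
    intro θ hθ
    have hp := hE.isProbabilityMeasure_anchorLaw θ
    have hθ' := hI.subset_Icc hθ
    have hg : Measurable fun b => |a b - E.aR m| := (ham.sub_const _).abs
    have hgB : ∀ b, |(|a b - E.aR m|)| ≤ K * h := fun b => by
      rw [abs_abs]; exact hnear m hm b
    have h1 := le_of_abs_le (hB.anchor_lip θ (hI.subset hθ) t (hI.Icc_subset ht) _ (K * h) hg hgB)
    have htθ : |t - θ| ≤ h :=
      abs_le.2 ⟨by linarith [ht.1, hθ'.2], by linarith [ht.2, hθ'.1]⟩
    have h2 : K * (K * h) * |t - θ| ≤ K * (K * h) * h := by gcongr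
    have hR : ∀ b, |R θ b - b| ≤ C1 * h := fun b =>
      eq.abs_report_sub_le hθ fun r hr => hB.senderObj_lt_of_far_of_near hE hd eq.a_mem
        (hI.subset hθ) hdh (hnear θ hθ') hr
    have h3 := eq.integral_window_le hE hB hI hw (s := C1 * h) (by positivity) θ
    have i1 := eq.integrable_action_error hE hB hmA θ θ
    have i2 := eq.integrable_window hE hB (C1 * h) θ
    have h4 := integral_mono (hE.integrable_anchorLaw θ hg hgB) (i1.add i2) fun b => by
      have h5 := eq.action_bracket (hR b)
      have h6 : a (b - C1 * h) ≤ a b ∧ a b ≤ a (b + C1 * h) := by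
        have : 0 ≤ C1 * h := by positivity
        exact ⟨eq.a_mono.monotone (by linarith), eq.a_mono.monotone (by linarith)⟩
      have h7 := abs_sub_le (a b) (a (R θ b)) (E.aR m)
      have h8 : |a b - a (R θ b)| ≤ a (b + C1 * h) - a (b - C1 * h) :=
        abs_le.2 ⟨by linarith [h6.1, h5.2], by linarith [h6.2, h5.1]⟩
      simp only [Pi.add_apply]
      linarith
    simp only [Pi.add_apply] at h4
    rw [integral_add i1 i2] at h4
    rw [← add_mul]
    refine mul_le_mul_of_nonneg_right ?_ (hE.f_pos θ (hI.subset hθ)).le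
    nlinarith
  have hfin := setIntegral_mono_on (hfi.const_mul T)
    (hIE.add (hfi.const_mul (K ^ 2 * (C1 + 1) * h ^ 2))) hI.measurable hpt
  simp only [Pi.add_apply] at hfin
  rw [integral_add hIE (hfi.const_mul _), integral_const_mul, integral_const_mul] at hfin
  set F := ∫ θ in I, E.f θ with hFdef
  set W := ∫ θ in I, (∫ b, |a (R θ b) - E.aR m| ∂(E.anchorLaw θ)) * E.f θ with hW
  have h1 : W ≤ (K ^ 2 * (C1 + 1) + K * (K + 1) ^ 2) / κ * h ^ 2 * F := by
    rw [div_mul_eq_mul_div, div_mul_eq_mul_div, le_div_iff₀ hκ]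
    linarith
  have h2 : T * F ≤ (actionConst K κ * h ^ 2) * F := by
    rw [actionConst, ← hC1def]
    linarith
  exact le_of_mul_le_mul_right h2 hF

/-- Near the ideal action the slope of `US` is `O(h)`, as `d ≤ h`, and the mean action error is `O(h
^ 2)`. Third order is needed: squared widths will be compared and then divided by `h`. -/
theorem abs_labelValue_sub_ideal_le (hE : E.Assumptions) (hB : E.Bounds K κ)
    (hd : d ∈ Icc 0 E.d₀) (hI : E.IsCell I u v) (eq : E.IsRegularEq d I R a) (hw : v - u ≤ h)
    (hdh : d ≤ h) {m : ℝ} (hm : m ∈ Icc u v) (hm0 : ∫ θ in I, (θ - m) * E.f θ = 0) {t : ℝ}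
    (ht : t ∈ Icc u v) :
    |E.labelValue d a t - E.US (E.aR m) t d| ≤ valueConst K κ * h ^ 3 := by
  have hK := hB.K_one
  have hκ := hB.κ_pos
  have hh : 0 ≤ h := hd.1.trans hdh
  have hC1 := displacement_nonneg hB
  have hmΘ := hI.Icc_subset hm
  have htΘ := hI.Icc_subset ht
  have hmA := hE.aR_mem hmΘ
  have ham := eq.a_cont.measurable
  have hp := hE.isProbabilityMeasure_anchorLaw t
  have hT := eq.integral_truthful_error_le hE hB hd hI hw hdh hm hm0 ht
  have hnear := fun r => eq.abs_action_sub_ideal_le hE hB hI hw ht r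
  have hmt : |E.aR m - E.aR t| ≤ K * h := by
    refine (hB.aR_lip t htΘ m hmΘ).trans (mul_le_mul_of_nonneg_left ?_ (by linarith))
    exact abs_le.2 ⟨by linarith [ht.2, hm.1], by linarith [ht.1, hm.2]⟩
  have hslope : ∀ r, |E.US (a r) t d - E.US (E.aR m) t d| ≤
      K * (K + 1) * h * |a r - E.aR m| := fun r => by
    refine (hB.US_mvt (K * h) _ hmA _ (eq.a_mem r) t htΘ d hd hmt (hnear r)).trans ?_
    have : K * (K * h + d) ≤ K * (K + 1) * h := by nlinarith
    gcongr
  have hc : 0 ≤ K * (K + 1) * h := by positivity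
  set C1 := displacement K κ with hC1def
  have h3 := eq.integral_window_le hE hB hI hw (s := C1 * h) (by positivity) t
  have i2 := eq.integrable_window hE hB (C1 * h) t
  have i1 : Integrable (fun b => |a b - E.aR m|) (E.anchorLaw t) :=
    hE.integrable_anchorLaw t (B := K) (ham.sub_const _).abs
      fun b => by rw [abs_abs]; exact hB.A_width _ hmA _ (eq.a_mem _)
  have i3 := i1.const_mul (K * (K + 1) * h)
  have i5 : Integrable (fun b => |a b - E.aR m| + (a (b + C1 * h) - a (b - C1 * h)))
    (E.anchorLaw t) := i1.add i2
  have i4 := i5.const_mul (K * (K + 1) * h)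
  have hlow := le_labelValue hE hB hd eq.a_mem htΘ
    (g := fun b => E.US (E.aR m) t d - K * (K + 1) * h * |a b - E.aR m|)
    ((integrable_const _).sub i3) fun b => by linarith [(abs_le.1 (hslope b)).1]
  have hup := labelValue_le hE hB hd eq.a_mem htΘ
    (g := fun b => E.US (E.aR m) t d +
      K * (K + 1) * h * (|a b - E.aR m| + (a (b + C1 * h) - a (b - C1 * h))))
    ((integrable_const _).add i4) fun b r => by
      have hpos : 0 ≤ C1 * h := by positivity
      have hmono : ∀ {x y}, x ≤ y → a x ≤ a y := fun h => eq.a_mono.monotone h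
      have h6 : a (b - C1 * h) ≤ a (b + C1 * h) := hmono (by linarith)
      have hb := (abs_le.1 (hslope b)).2
      -- Far reports are beaten by the truthful one; near reports move the action by no more than
      -- the variation of `a` over the window.
      rcases lt_or_ge (C1 * h) |r - b| with hr | hr
      · have h7 := hB.senderObj_lt_of_far_of_near hE hd eq.a_mem htΘ hdh hnear hr
        have h8 : E.senderObj d a t b b = E.US (a b) t d := by simp [senderObj, hE.D_self]
        have h9 := mul_nonneg hc (sub_nonneg.2 h6)
        linarith
      · have hr' := abs_le.1 hr
        have h7 := (senderObj_le_bound hB hd eq.a_mem htΘ b r).1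
        have h8 := (abs_le.1 (hslope r)).2
        have h9 : |a r - E.aR m| ≤ |a b - E.aR m| + (a (b + C1 * h) - a (b - C1 * h)) := by
          have h10 := abs_sub_le (a r) (a b) (E.aR m)
          have h11 : |a r - a b| ≤ a (b + C1 * h) - a (b - C1 * h) := by
            have e1 : a (b - C1 * h) ≤ a r := hmono (by linarith)
            have e2 : a r ≤ a (b + C1 * h) := hmono (by linarith)
            have e3 : a (b - C1 * h) ≤ a b := hmono (by linarith)
            have e4 : a b ≤ a (b + C1 * h) := hmono (by linarith)
            exact abs_le.2 ⟨by linarith, by linarith⟩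
          linarith
        have h10 := mul_le_mul_of_nonneg_left h9 hc
        linarith
  rw [integral_sub (integrable_const _) i3, integral_const_mul] at hlow
  rw [integral_add (integrable_const _) i4, integral_const_mul] at hup
  rw [integral_add i1 i2] at hup
  simp only [integral_const, probReal_univ, one_smul] at hlow hup
  have h7 : K * (K + 1) * h * (∫ b, |a b - E.aR m| ∂(E.anchorLaw t)) ≤
      K * (K + 1) * h * (actionConst K κ * h ^ 2) := mul_le_mul_of_nonneg_left hT hc
  have h8 := mul_le_mul_of_nonneg_left h3 hc
  have h9 : 0 ≤ K * (K + 1) * h * (K * (K * h) * (C1 * h)) := by positivity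
  rw [valueConst, ← hC1def]
  refine abs_le.2 ⟨by nlinarith, by nlinarith⟩

end IsRegularEq

/-- With a Lipschitz prior the prior mean of a cell is its midpoint up to second order. -/
theorem IsCell.abs_mean_sub_midpoint_le (hE : E.Assumptions) (hB : E.Bounds K κ) {I : Set ℝ}
    {u v : ℝ} (hI : E.IsCell I u v) {k : NNReal} (hf : LipschitzOnWith k E.f E.Θ) {m : ℝ}
    (hm0 : ∫ θ in I, (θ - m) * E.f θ = 0) :
    |m - (u + v) / 2| ≤ k / κ * (v - u) ^ 2 := by
  have hκ := hB.κ_pos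
  set c := (u + v) / 2 with hc
  have huv := hI.lt
  have hcI : c ∈ Icc u v := ⟨by rw [hc]; linarith, by rw [hc]; linarith⟩
  have hfi := hE.integrableOn_f.mono_set hI.subset
  have hcont : ∀ x, IntegrableOn (fun θ => (θ - x) * E.f θ) I := fun x =>
    (((continuousOn_id.sub continuousOn_const).mul hE.f_cont).integrableOn_compact
      isCompact_Icc).mono_set hI.subset
  have hlin : IntegrableOn (fun θ => (θ - c) * E.f c) I :=
    ((((continuousOn_id (s := E.Θ)).sub continuousOn_const).mul continuousOn_const
      ).integrableOn_compact isCompact_Icc).mono_set hI.subset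
  -- A constant density has its mean at the midpoint, so only the deviation of `f` from `E.f c`
  -- displaces the mean.
  have h0 : ∫ θ in I, (θ - c) * E.f c = 0 := by
    rw [hI.setIntegral_eq, intervalIntegral.integral_mul_const, intervalIntegral.integral_sub
      (by simp) (by simp), integral_id, intervalIntegral.integral_const, hc, smul_eq_mul]
    ring
  have h1 : (m - c) * ∫ θ in I, E.f θ = ∫ θ in I, ((θ - c) * E.f θ - (θ - c) * E.f c) := by
    rw [integral_sub (hcont c) hlin, h0, sub_zero, ← integral_const_mul]
    have : ∫ θ in I, (m - c) * E.f θ = ∫ θ in I, ((θ - c) * E.f θ - (θ - m) * E.f θ) := by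
      congr 1; funext θ; ring
    rw [this, integral_sub (hcont c) (hcont m), hm0, sub_zero]
  -- Arm and density deviation are each of the order of the width; integration gives the cube, and
  -- the mass of the cell, at least `κ * (v - u)`, divides out one power.
  have h2 : |∫ θ in I, ((θ - c) * E.f θ - (θ - c) * E.f c)| ≤ k * (v - u) ^ 2 * (v - u) := by
    have := norm_setIntegral_le_of_norm_le_const (μ := volume) (s := I) (C := k * (v - u) ^ 2)
      (f := fun θ => (θ - c) * E.f θ - (θ - c) * E.f c)
      (by rw [measure_congr hI.ae_eq]; simp) fun θ hθ => by
        have hθ' := hI.subset_Icc hθ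
        have h3 := hf.dist_le_mul θ (hI.subset hθ) c (hI.Icc_subset hcI)
        rw [Real.dist_eq, Real.dist_eq] at h3
        have h4 : |θ - c| ≤ v - u :=
          abs_le.2 ⟨by linarith [hθ'.1, hcI.2], by linarith [hθ'.2, hcI.1]⟩
        rw [← mul_sub, Real.norm_eq_abs, abs_mul]
        calc |θ - c| * |E.f θ - E.f c| ≤ (v - u) * (k * (v - u)) :=
              mul_le_mul h4 (h3.trans (by gcongr)) (abs_nonneg _) (by linarith)
          _ = _ := by ring
    rw [Real.norm_eq_abs] at this
    refine this.trans (le_of_eq ?_)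
    rw [measureReal_def, measure_congr hI.ae_eq, Real.volume_Icc,
      ENNReal.toReal_ofReal (by linarith)]
  have hF : κ * (v - u) ≤ ∫ θ in I, E.f θ := by
    have := setIntegral_mono_on (μ := volume) (s := I) (f := fun _ => κ)
      (integrableOn_const (by rw [measure_congr hI.ae_eq]; simp)) hfi hI.measurable
      fun θ hθ => hB.f_lower θ (hI.subset hθ)
    rw [setIntegral_const, measureReal_def, measure_congr hI.ae_eq, Real.volume_Icc,
      ENNReal.toReal_ofReal (by linarith), smul_eq_mul] at this
    linarith
  rw [← h1, abs_mul, abs_of_pos (hE.integral_f_pos hI)] at h2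
  have h3 : |m - c| * (κ * (v - u)) ≤ k * (v - u) ^ 2 * (v - u) :=
    (mul_le_mul_of_nonneg_left hF (abs_nonneg _)).trans h2
  rw [div_mul_eq_mul_div, le_div_iff₀ hκ]
  exact le_of_mul_le_mul_right (by linarith) (sub_pos.2 huv)

theorem abs_sq_sub_sq_le {p q A B : ℝ} (h1 : |p + q| ≤ A) (h2 : |p - q| ≤ B) :
    |p ^ 2 - q ^ 2| ≤ A * B := by
  rw [sq_sub_sq, abs_mul]
  exact mul_le_mul h1 h2 (abs_nonneg _) ((abs_nonneg _).trans h1)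

/-- Second-order expansion of the sender's payoff at ideal actions of the receiver. -/
theorem Bounds.ideal_expansion (hE : E.Assumptions) (hB : E.Bounds K κ) {d t m h : ℝ}
    (hd : d ∈ Icc 0 E.d₀) (ht : t ∈ E.Θ) (hm : m ∈ E.Θ) (hmt : |m - t| ≤ h) :
    |E.US (E.aR m) t d - E.US (E.aR t) t d -
        E.US11 (E.aR t) t d / 2 * (E.aR m - E.aR t) ^ 2| ≤ K ^ 2 * (d * h) + K ^ 4 * h ^ 3 ∧
      |E.UR11 (E.aR t) t ^ 2 * (E.aR m - E.aR t) ^ 2 -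
        E.UR12 (E.aR t) t ^ 2 * (m - t) ^ 2| ≤ K * (K + 1) ^ 2 * (K ^ 2 + K) * h ^ 3 := by
  have hK := hB.K_one
  have hh : 0 ≤ h := (abs_nonneg _).trans hmt
  have hta := hE.aR_mem ht
  have hma := hE.aR_mem hm
  have hy : |E.aR m - E.aR t| ≤ K * h :=
    (hB.aR_lip t ht m hm).trans (mul_le_mul_of_nonneg_left hmt (by linarith))
  set y := E.aR m - E.aR t with hydef
  constructor
  · have h1 := hB.US_third _ hta _ hma t ht d hd
    have h2 := hB.US1_bound _ hta t ht d hd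
    rw [sub_self, abs_zero, zero_add] at h2
    rw [← hydef] at h1
    have h3 : |E.US1 (E.aR t) t d * y| ≤ K * d * (K * h) := by
      rw [abs_mul]
      exact mul_le_mul h2 hy (abs_nonneg _) (mul_nonneg (by linarith) hd.1)
    have h4 : K * |y| ^ 3 ≤ K * (K * h) ^ 3 := by gcongr
    have h5 := abs_le.1 (h1.trans h4)
    have h6 := abs_le.1 h3
    exact abs_le.2 ⟨by nlinarith [h5.1, h6.1], by nlinarith [h5.2, h6.2]⟩
  · have h1 := hB.UR1_taylor _ hta _ hma t ht m hm
    rw [hE.UR1_aR hm, hE.UR1_aR ht, sub_zero, zero_sub, abs_neg, ← hydef] at h1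
    have h2 : K * (|y| + |m - t|) ^ 2 ≤ K * (K * h + h) ^ 2 := by gcongr
    have h3 : |E.UR11 (E.aR t) t * y - E.UR12 (E.aR t) t * (m - t)| ≤ K * (K * h) + K * h := by
      refine (abs_sub _ _).trans (add_le_add ?_ ?_)
      · rw [abs_mul]
        exact mul_le_mul (hB.UR11_bound _ hta t ht) hy (abs_nonneg _) (by linarith)
      · rw [abs_mul]
        exact mul_le_mul (hB.UR12_bound _ hta t ht) hmt (abs_nonneg _) (by linarith)
    have h4 := abs_sq_sub_sq_le (h1.trans h2) h3
    rw [mul_pow, mul_pow] at h4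
    exact h4.trans (le_of_eq (by ring))

/-- Comparison of squared widths from second-order expansions on the two sides of a cutoff. -/
theorem abs_sq_width_sub_le {K κ c0 c1 c2 h d V V₁ V₂ U c α β y y' x x' w w' : ℝ}
    (hκ : 0 < κ) (hc0 : 0 ≤ c0) (hc1 : 0 ≤ c1) (hc2 : 0 ≤ c2) (hh : 0 ≤ h) (hd : 0 ≤ d)
    (h1 : |V - V₁| ≤ c0 * h ^ 3) (h1' : |V - V₂| ≤ c0 * h ^ 3)
    (h2 : |V₁ - U - c / 2 * y ^ 2| ≤ K ^ 2 * (d * h) + K ^ 4 * h ^ 3)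
    (h2' : |V₂ - U - c / 2 * y' ^ 2| ≤ K ^ 2 * (d * h) + K ^ 4 * h ^ 3)
    (h3 : |α ^ 2 * y ^ 2 - β ^ 2 * x ^ 2| ≤ c1 * h ^ 3)
    (h3' : |α ^ 2 * y' ^ 2 - β ^ 2 * x' ^ 2| ≤ c1 * h ^ 3)
    (h4 : |x ^ 2 - (w / 2) ^ 2| ≤ c2 * h ^ 2 * (2 * h))
    (h4' : |(w' / 2) ^ 2 - x' ^ 2| ≤ 2 * h * (c2 * h ^ 2))
    (hc : κ ≤ -c) (hα : α ^ 2 ≤ K ^ 2) (hβ : κ ≤ β) :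
    |w ^ 2 - w' ^ 2| ≤ 4 * ((K ^ 2 * (2 / κ * (2 * c0 + 2 * K ^ 2 + 2 * K ^ 4)) + 2 * c1) / κ ^ 2 +
      4 * c2) * (h ^ 3 + d * h) := by
  set c3 := 2 / κ * (2 * c0 + 2 * K ^ 2 + 2 * K ^ 4) with hc3
  set c4 := (K ^ 2 * c3 + 2 * c1) / κ ^ 2 with hc4
  set T := h ^ 3 + d * h with hT
  have hT1 : h ^ 3 ≤ T := by have := mul_nonneg hd hh; linarith
  have hT2 : d * h ≤ T := by have := pow_nonneg hh 3; linarith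
  have hb0 : c0 * h ^ 3 ≤ c0 * T := mul_le_mul_of_nonneg_left hT1 hc0
  have hb1 : K ^ 2 * (d * h) ≤ K ^ 2 * T := mul_le_mul_of_nonneg_left hT2 (by positivity)
  have hb2 : K ^ 4 * h ^ 3 ≤ K ^ 4 * T := mul_le_mul_of_nonneg_left hT1 (by positivity)
  have hb3 : c1 * h ^ 3 ≤ c1 * T := mul_le_mul_of_nonneg_left hT1 hc1
  have hb4 : c2 * h ^ 3 ≤ c2 * T := mul_le_mul_of_nonneg_left hT1 hc2
  -- `V` is the common value at the cutoff and `U` the common ideal payoff; both cancel in the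
  -- difference of the two expansions.
  have hy1 : |c / 2 * (y ^ 2 - y' ^ 2)| ≤ (2 * c0 + 2 * K ^ 2 + 2 * K ^ 4) * T := by
    have p1 := abs_le.1 h1
    have p2 := abs_le.1 h1'
    have p3 := abs_le.1 h2
    have p4 := abs_le.1 h2'
    exact abs_le.2 ⟨by linarith only [p1.2, p2.1, p3.2, p4.1, hb0, hb1, hb2],
      by linarith only [p1.1, p2.2, p3.1, p4.2, hb0, hb1, hb2]⟩
  have hy2 : |y ^ 2 - y' ^ 2| ≤ c3 * T := by
    rw [abs_mul] at hy1
    have e1 : κ / 2 ≤ |c / 2| := by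
      rw [abs_of_nonpos (by linarith)]; linarith
    have e2 := (mul_le_mul_of_nonneg_right e1 (abs_nonneg (y ^ 2 - y' ^ 2))).trans hy1
    rw [hc3, mul_assoc, div_mul_eq_mul_div, le_div_iff₀ hκ]
    linarith only [e2]
  have hx : |x ^ 2 - x' ^ 2| ≤ c4 * T := by
    have e1 : |β ^ 2 * (x ^ 2 - x' ^ 2)| ≤ (K ^ 2 * c3 + 2 * c1) * T := by
      have e2 : |α ^ 2 * (y ^ 2 - y' ^ 2)| ≤ K ^ 2 * (c3 * T) := by
        rw [abs_mul, abs_of_nonneg (sq_nonneg α)]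
        exact mul_le_mul hα hy2 (abs_nonneg _) (sq_nonneg _)
      have p1 := abs_le.1 e2
      have p2 := abs_le.1 h3
      have p3 := abs_le.1 h3'
      exact abs_le.2 ⟨by linarith only [p1.1, p2.2, p3.1, hb3],
        by linarith only [p1.2, p2.1, p3.2, hb3]⟩
    rw [abs_mul, abs_of_nonneg (sq_nonneg β)] at e1
    have e2 : κ ^ 2 ≤ β ^ 2 := by gcongr
    have e3 := (mul_le_mul_of_nonneg_right e2 (abs_nonneg (x ^ 2 - x' ^ 2))).trans e1
    rw [hc4, div_mul_eq_mul_div, le_div_iff₀ (by positivity)]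
    linarith only [e3]
  have p1 := abs_le.1 hx
  have p2 := abs_le.1 h4
  have p3 := abs_le.1 h4'
  exact abs_le.2 ⟨by linarith only [p1.1, p2.2, p3.2, hb4],
    by linarith only [p1.2, p2.1, p3.1, hb4]⟩

/-- Indifference at a cutoff forces the widths of the adjacent cells to agree up to second
order. -/
theorem Bounds.exists_width_comparison (hE : E.Assumptions) (hB : E.Bounds K κ) {k : NNReal}
    (hf : LipschitzOnWith k E.f E.Θ) :
    ∃ C > 0, ∀ d ∈ Icc 0 E.d₀, ∀ (I J : Set ℝ) (u t v : ℝ) (R R' : ℝ → ℝ → ℝ) (a a' : ℝ → ℝ),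
      E.IsCell I u t → E.IsCell J t v → E.IsRegularEq d I R a → E.IsRegularEq d J R' a' →
      E.labelValue d a t = E.labelValue d a' t →
      |(t - u) - (v - t)| ≤ C * (max (t - u) (v - t)) ^ 2 + C * d := by
  have hK := hB.K_one
  have hκ := hB.κ_pos
  have hc0 := valueConst_nonneg hB
  obtain ⟨C, hC⟩ : ∃ C, C = 4 * ((K ^ 2 * (2 / κ * (2 * valueConst K κ + 2 * K ^ 2 + 2 * K ^ 4)) +
      2 * (K * (K + 1) ^ 2 * (K ^ 2 + K))) / κ ^ 2 + 4 * (k / κ)) := ⟨_, rfl⟩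
  have hC0 : 0 ≤ C := by rw [hC]; positivity
  refine ⟨C + 1, by positivity, ?_⟩
  intro d hd I J u t v R R' a a' hI hJ eqI eqJ hind
  have hd0 := hd.1
  have hw0 : 0 < t - u := sub_pos.2 hI.lt
  have hw0' : 0 < v - t := sub_pos.2 hJ.lt
  obtain ⟨h, hh⟩ : ∃ h, h = max (t - u) (v - t) := ⟨_, rfl⟩
  have hwh : t - u ≤ h := hh ▸ le_max_left _ _
  have hwh' : v - t ≤ h := hh ▸ le_max_right _ _
  have hsum : h ≤ (t - u) + (v - t) := hh ▸ max_le (by linarith) (by linarith)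
  rw [← hh]
  clear hh
  -- If both widths are below `d`, their difference is at most `d`, and the constant `C + 1` absorbs
  -- it. Otherwise `d ≤ h`, as the narrow-cell estimates require.
  rcases lt_or_ge h d with hcase | hcase
  · have h3 : |(t - u) - (v - t)| ≤ d := abs_le.2 ⟨by linarith, by linarith⟩
    have h4 := mul_nonneg (add_nonneg hC0 zero_le_one) (sq_nonneg h)
    have h5 := mul_nonneg hC0 hd0
    linarith
  have hh0 : 0 < h := hw0.trans_le hwh
  obtain ⟨m, hm, hm0⟩ := hI.exists_mean hE
  obtain ⟨m', hm', hm0'⟩ := hJ.exists_mean hE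
  have ht : t ∈ E.Θ := hI.v_mem
  have hV := eqI.abs_labelValue_sub_ideal_le hE hB hd hI hwh hcase hm hm0
    (right_mem_Icc.2 hI.lt.le)
  have hV' := eqJ.abs_labelValue_sub_ideal_le hE hB hd hJ hwh' hcase hm' hm0'
    (left_mem_Icc.2 hJ.lt.le)
  rw [hind] at hV
  have hmt : |m - t| ≤ h := abs_le.2 ⟨by linarith [hm.1], by linarith [hm.2]⟩
  have hmt' : |m' - t| ≤ h := abs_le.2 ⟨by linarith [hm'.1], by linarith [hm'.2]⟩
  obtain ⟨e1, e2⟩ := hB.ideal_expansion hE hd ht (hI.Icc_subset hm) hmt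
  obtain ⟨e1', e2'⟩ := hB.ideal_expansion hE hd ht (hJ.Icc_subset hm') hmt'
  have hmid := hI.abs_mean_sub_midpoint_le hE hB hf hm0
  have hmid' := hJ.abs_mean_sub_midpoint_le hE hB hf hm0'
  have hαK : E.UR11 (E.aR t) t ^ 2 ≤ K ^ 2 := by
    have := hB.UR11_bound _ (hE.aR_mem ht) t ht
    exact sq_le_sq' (abs_le.1 this).1 (abs_le.1 this).2
  have hsq : ∀ {x : ℝ}, 0 < x → x ≤ h → k / κ * x ^ 2 ≤ k / κ * h ^ 2 :=
    fun hx hxh => by gcongr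
  have hx1 : |(m - t) ^ 2 - ((t - u) / 2) ^ 2| ≤ k / κ * h ^ 2 * (2 * h) := by
    refine abs_sq_sub_sq_le ?_ ?_
    · refine le_trans (le_of_eq ?_) (hmid.trans (hsq hw0 hwh))
      congr 1; ring
    · exact abs_le.2 ⟨by linarith [(abs_le.1 hmt).1], by linarith [(abs_le.1 hmt).2]⟩
  have hx1' : |((v - t) / 2) ^ 2 - (m' - t) ^ 2| ≤ 2 * h * (k / κ * h ^ 2) := by
    refine abs_sq_sub_sq_le ?_ ?_
    · exact abs_le.2 ⟨by linarith [(abs_le.1 hmt').1], by linarith [(abs_le.1 hmt').2]⟩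
    · rw [abs_sub_comm]
      refine le_trans (le_of_eq ?_) (hmid'.trans (hsq hw0' hwh'))
      congr 1; ring
  have hww := abs_sq_width_sub_le hκ hc0 (by positivity) (by positivity) hh0.le hd0 hV hV'
    e1 e1' e2 e2' hx1 hx1' (by linarith [hB.US11_le _ (hE.aR_mem ht) t ht d hd]) hαK
    (hB.UR12_ge _ (hE.aR_mem ht) t ht)
  rw [← hC] at hww
  -- The difference of squares has the factor `(t - u) + (v - t) ≥ h`, which lowers the order of the
  -- estimate by one.
  have hprod : |(t - u) - (v - t)| * h ≤ (C * (h ^ 2 + d)) * h := by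
    calc |(t - u) - (v - t)| * h ≤ |(t - u) - (v - t)| * ((t - u) + (v - t)) := by gcongr
      _ = |(t - u) ^ 2 - (v - t) ^ 2| := by
          rw [sq_sub_sq, abs_mul, abs_of_pos (show 0 < (t - u) + (v - t) by linarith), mul_comm]
      _ ≤ C * (h ^ 3 + d * h) := hww
      _ = _ := by ring
  have := le_of_mul_le_mul_right hprod hh0
  linarith [sq_nonneg h]

/-! ### Wide cells -/

namespace IsRegularEq

variable {d : ℝ} {I : Set ℝ} {u v : ℝ} {R : ℝ → ℝ → ℝ} {a : ℝ → ℝ} {t σ : ℝ}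

/-- Monotonicity of the distance to the ideal action at an end of the cell. The sign `σ` tells
the right end from the left end. -/
theorem abs_action_sub_end (hE : E.Assumptions) (hB : E.Bounds K κ) (hI : E.IsCell I u v)
    (eq : E.IsRegularEq d I R a) (ht : (σ = 1 ∧ t = v) ∨ (σ = -1 ∧ t = u)) {M r b : ℝ}
    (hr : |r - b| ≤ M) :
    |a (b + σ * M) - E.aR t| ≤ |a r - E.aR t| ∧
      |a r - E.aR t| ≤ |a (b + -σ * M) - E.aR t| := by
  have hrange := eq.a_range hE hB hI
  have hr' := abs_le.1 hr
  rcases ht with ⟨rfl, rfl⟩ | ⟨rfl, rfl⟩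
  · have hs : ∀ x, |a x - E.aR t| = E.aR t - a x := fun x => by
      rw [abs_sub_comm, abs_of_nonneg (sub_nonneg.2 (hrange x).2)]
    simp only [hs, sub_le_sub_iff_left]
    exact ⟨eq.a_mono.monotone (by linarith), eq.a_mono.monotone (by linarith)⟩
  · have hs : ∀ x, |a x - E.aR t| = a x - E.aR t := fun x =>
      abs_of_nonneg (sub_nonneg.2 (hrange x).1)
    simp only [hs, sub_le_sub_iff_right]
    exact ⟨eq.a_mono.monotone (by linarith), eq.a_mono.monotone (by linarith)⟩

/-- The sender's payoff falls quadratically in the distance to the receiver's ideal action, up to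
the misalignment. -/
theorem _root_.HardSoft.Model.Bounds.US_le_ideal (hE : E.Assumptions) (hB : E.Bounds K κ)
    (hd : d ∈ Icc 0 E.d₀) (htΘ : t ∈ E.Θ) {x : ℝ} (hx : x ∈ E.A) :
    E.US x t d ≤ E.US (E.aR t) t d + K ^ 2 * d - κ * |x - E.aR t| ^ 2 := by
  have hK := hB.K_one
  have hta := hE.aR_mem htΘ
  have h1 := hB.US_quad _ hta _ hx t htΘ d hd
  have h2 := hB.US1_bound _ hta t htΘ d hd
  rw [sub_self, abs_zero, zero_add] at h2
  have h3 : E.US1 (E.aR t) t d * (x - E.aR t) ≤ K * d * K :=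
    (le_abs_self _).trans (by
      rw [abs_mul]
      exact mul_le_mul h2 (hB.A_width _ hta _ hx) (abs_nonneg _)
        (mul_nonneg (by linarith) hd.1))
  rw [sq_abs]
  linarith

/-- All actions of the cell lie on one side of `aR t`, so moving the report towards `t` brings the
action closer. A report within the admissible radius is no closer than `a (b + σ * M)`, and farther
reports are worse than the truthful one. -/
theorem senderObj_end_le (hE : E.Assumptions) (hB : E.Bounds K κ) (hd : d ∈ Icc 0 E.d₀)
    (hI : E.IsCell I u v) (eq : E.IsRegularEq d I R a)
    (ht : (σ = 1 ∧ t = v) ∨ (σ = -1 ∧ t = u)) (htΘ : t ∈ E.Θ) (b r : ℝ) :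
    E.senderObj d a t b r ≤ E.US (E.aR t) t d + K ^ 2 * d -
      κ * |a (b + σ * (2 * K / κ + 1)) - E.aR t| ^ 2 := by
  have hK := hB.K_one
  have hκ := hB.κ_pos
  have hM : 0 ≤ 2 * K / κ + 1 := by positivity
  have key : ∀ r', |r' - b| ≤ 2 * K / κ + 1 → E.senderObj d a t b r' ≤
      E.US (E.aR t) t d + K ^ 2 * d -
        κ * |a (b + σ * (2 * K / κ + 1)) - E.aR t| ^ 2 := fun r' hr' => by
    have h1 := (senderObj_le_bound hB hd eq.a_mem htΘ b r').1
    have h2 := (eq.abs_action_sub_end hE hB hI ht hr').1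
    have h3 := mul_le_mul_of_nonneg_left (pow_le_pow_left₀ (abs_nonneg _) h2 2) hκ.le
    have h4 := hB.US_le_ideal hE hd htΘ (eq.a_mem r')
    linarith only [h1, h3, h4]
  rcases lt_or_ge (2 * K / κ + 1) |r - b| with hr | hr
  · exact (hB.senderObj_lt_of_far hE hd eq.a_mem htΘ hr).le.trans
      (key b (by rw [sub_self, abs_zero]; exact hM))
  · exact key r hr

/-- The value of a label at an end of its cell is reduced by the distance of actions to the ideal
action. -/
theorem labelValue_end_le (hE : E.Assumptions) (hB : E.Bounds K κ) (hd : d ∈ Icc 0 E.d₀)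
    (hI : E.IsCell I u v) (eq : E.IsRegularEq d I R a)
    (ht : (σ = 1 ∧ t = v) ∨ (σ = -1 ∧ t = u)) (htΘ : t ∈ E.Θ) :
    E.labelValue d a t ≤ E.US (E.aR t) t d + K ^ 2 * d -
      κ * ∫ b, |a (b + σ * (2 * K / κ + 1)) - E.aR t| ^ 2 ∂(E.anchorLaw t) := by
  have hp := hE.isProbabilityMeasure_anchorLaw t
  have hobj := eq.senderObj_end_le hE hB hd hI ht htΘ
  generalize 2 * K / κ + 1 = M at hobj ⊢
  have hm : Measurable fun b => |a (b + σ * M) - E.aR t| ^ 2 :=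
    ((eq.a_cont.measurable.comp (measurable_id.add_const (σ * M))).sub_const _).abs.pow_const 2
  have hi : Integrable (fun b => |a (b + σ * M) - E.aR t| ^ 2) (E.anchorLaw t) :=
    hE.integrable_anchorLaw t hm (B := K ^ 2) fun b => by
      rw [abs_pow, abs_abs]
      exact pow_le_pow_left₀ (abs_nonneg _)
        (hB.A_width _ (hE.aR_mem htΘ) _ (eq.a_mem _)) 2
  have h := labelValue_le hE hB hd eq.a_mem htΘ
    ((integrable_const (E.US (E.aR t) t d + K ^ 2 * d)).sub (hi.const_mul κ)) hobj
  simp only [Pi.sub_apply] at h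
  rw [integral_sub (integrable_const _) (hi.const_mul κ), integral_const_mul κ] at h
  simp only [integral_const, probReal_univ, one_smul] at h
  exact h

/-- The receiver's first-order condition keeps actions away from the ideal action at an end of
the cell. -/
theorem width_le_of_action_error (hE : E.Assumptions) (hB : E.Bounds K κ)
    (hI : E.IsCell I u v) (eq : E.IsRegularEq d I R a)
    (ht : (σ = 1 ∧ t = v) ∨ (σ = -1 ∧ t = u)) (htΘ : t ∈ E.Θ) {q : ℝ}
    (hq : ∀ θ ∈ I, ∫ b, |a (R θ b) - E.aR t| ^ 2 ∂(E.anchorLaw θ) ≤ q) {l : ℝ} (hl : 0 < l) :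
    κ ^ 2 * (v - u) ≤ K ^ 2 * (l + q / l) := by
  have hK := hB.K_one
  have hκ := hB.κ_pos
  have hta := hE.aR_mem htΘ
  have ham := eq.a_cont.measurable
  have huv := sub_pos.2 hI.lt
  have hσ : |σ| = 1 := by rcases ht with ⟨rfl, -⟩ | ⟨rfl, -⟩ <;> simp
  -- All states lie on one side of `t`, so the marginal payoff at `aR t` has a constant sign and
  -- size at least `κ * |t - θ|`.
  have hend : ∀ θ ∈ I, 0 ≤ σ * (t - θ) ∧ κ * (σ * (t - θ)) ≤ -(σ * E.UR1 (E.aR t) θ) := by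
    intro θ hθ
    have hθ' := hI.subset_Icc hθ
    rcases ht with ⟨rfl, rfl⟩ | ⟨rfl, rfl⟩
    · have h1 := hE.UR1_growth hB.UR12_ge hta (hI.subset hθ) htΘ hθ'.2
      rw [hE.UR1_aR htΘ] at h1
      exact ⟨by linarith [hθ'.2], by linarith⟩
    · have h1 := hE.UR1_growth hB.UR12_ge hta htΘ (hI.subset hθ) hθ'.1
      rw [hE.UR1_aR htΘ] at h1
      exact ⟨by linarith [hθ'.1], by linarith⟩
  have hlin : ∫ θ in I, σ * (t - θ) = (v - u) ^ 2 / 2 := by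
    rw [hI.setIntegral_eq, intervalIntegral.integral_const_mul, intervalIntegral.integral_sub
      (by simp) (by simp), integral_id, intervalIntegral.integral_const, smul_eq_mul]
    rcases ht with ⟨rfl, rfl⟩ | ⟨rfl, rfl⟩ <;> ring
  -- With the constant test function, the marginal payoff of equilibrium actions averages to zero;
  -- actions near `aR t` throughout would contradict the sign in `hend`.
  have horth := eq.orthogonality hE hI (s := fun _ => 1) (B := 1) measurable_const (by simp)
  simp only [one_mul] at horth
  obtain ⟨B1, hB10, hB1⟩ := exists_bound_of_continuousOn Assumptions.isCompact_A_prod_Θ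
    (hE.continuousOn_UR1.mono (prod_mono (subset_univ _) subset_rfl))
  have hUm : Measurable fun p : ℝ × ℝ => E.UR1 (a (R p.1 p.2)) (E.clamp p.1) :=
    hE.measurable_UR1_comp (ham.comp eq.measurable_R) measurable_fst
  have hUB : ∀ p : ℝ × ℝ, |E.UR1 (a (R p.1 p.2)) (E.clamp p.1)| ≤ B1 := fun p =>
    hB1 (a (R p.1 p.2), E.clamp p.1) ⟨eq.a_mem _, hE.clamp_mem _⟩
  have hiU : ∀ θ ∈ I, Integrable (fun b => E.UR1 (a (R θ b)) θ) (E.anchorLaw θ) := by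
    intro θ hθ
    have := hE.integrable_anchorLaw θ
      (hUm.comp (measurable_const (a := θ) |>.prodMk measurable_id)) (fun b => hUB _)
    simpa [Function.comp_def, clamp_of_mem (hI.subset hθ)] using this
  have hIU : IntegrableOn (fun θ => (∫ b, E.UR1 (a (R θ b)) θ ∂(E.anchorLaw θ)) * E.f θ) I := by
    refine (hE.integrableOn_expectation hI.measurable hI.subset hUm hUB).congr_fun
      (fun θ hθ => ?_) hI.measurable
    simp only [clamp_of_mem (hI.subset hθ)]
  have hfi := hE.integrableOn_f.mono_set hI.subset
  have hlini : IntegrableOn (fun θ => σ * (t - θ)) I :=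
    (Continuous.integrableOn_Icc (by fun_prop)).mono_set hI.subset_Icc
  have hpt : ∀ θ ∈ I, κ ^ 2 * (σ * (t - θ)) ≤
      -σ * ((∫ b, E.UR1 (a (R θ b)) θ ∂(E.anchorLaw θ)) * E.f θ) +
        K * (l / 2 + q / (2 * l)) * E.f θ := by
    intro θ hθ
    have hp := hE.isProbabilityMeasure_anchorLaw θ
    have hθΘ := hI.subset hθ
    have hi2 : Integrable (fun b => |a (R θ b) - E.aR t| ^ 2) (E.anchorLaw θ) :=
      hE.integrable_anchorLaw θ (B := K ^ 2)
        (((ham.comp (eq.measurable_report θ)).sub_const _).abs.pow_const 2)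
        fun b => by
          rw [abs_of_nonneg (by positivity)]
          exact pow_le_pow_left₀ (abs_nonneg _) (hB.A_width _ hta _ (eq.a_mem _)) 2
    have i1 := (hiU θ hθ).const_mul (-σ)
    have i2 := hi2.const_mul (K / (2 * l))
    have i3 : Integrable (fun b => -σ * E.UR1 (a (R θ b)) θ +
      K / (2 * l) * |a (R θ b) - E.aR t| ^ 2) (E.anchorLaw θ) := i1.add i2
    have h1 := integral_mono (integrable_const (κ * (σ * (t - θ))))
      (i3.add (integrable_const (K * (l / 2)))) fun b => by
        have h2 := hB.UR1_lip _ hta _ (eq.a_mem (R θ b)) θ hθΘ θ hθΘ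
        rw [sub_self, abs_zero, add_zero] at h2
        have h3 : |σ * (E.UR1 (a (R θ b)) θ - E.UR1 (E.aR t) θ)| ≤
            K * |a (R θ b) - E.aR t| := by rw [abs_mul, hσ, one_mul]; exact h2
        have h4 := (abs_le.1 h3).2
        have h5 := (hend θ hθ).2
        -- Young's inequality passes from the absolute to the squared error; the free parameter `l`
        -- is matched to `q` by the caller.
        have h6 : |a (R θ b) - E.aR t| ≤ l / 2 + |a (R θ b) - E.aR t| ^ 2 / (2 * l) := by
          have h7 := sq_nonneg (|a (R θ b) - E.aR t| - l)
          rw [← sub_nonneg]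
          have : l / 2 + |a (R θ b) - E.aR t| ^ 2 / (2 * l) - |a (R θ b) - E.aR t| =
              (|a (R θ b) - E.aR t| - l) ^ 2 / (2 * l) := by field_simp; ring
          rw [this]
          positivity
        have h7 := mul_le_mul_of_nonneg_left h6 (show 0 ≤ K by linarith)
        simp only [Pi.add_apply]
        have h8 : K / (2 * l) * |a (R θ b) - E.aR t| ^ 2 =
            K * (|a (R θ b) - E.aR t| ^ 2 / (2 * l)) := by ring
        rw [h8]
        linarith
    simp only [Pi.add_apply] at h1
    rw [integral_add i3 (integrable_const _), integral_add i1 i2, integral_const_mul (-σ),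
      integral_const_mul (K / (2 * l))] at h1
    simp only [integral_const, probReal_univ, one_smul] at h1
    have h2 : K / (2 * l) * ∫ b, |a (R θ b) - E.aR t| ^ 2 ∂(E.anchorLaw θ) ≤
        K / (2 * l) * q := by
      have := hq θ hθ
      gcongr
    have h3 : κ * (σ * (t - θ)) ≤ -σ * (∫ b, E.UR1 (a (R θ b)) θ ∂(E.anchorLaw θ)) +
        K * (l / 2 + q / (2 * l)) := by
      have : K / (2 * l) * q = K * (q / (2 * l)) := by ring
      linarith
    have hf0 := hE.f_pos θ hθΘ
    have hfκ := hB.f_lower θ hθΘ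
    calc κ ^ 2 * (σ * (t - θ)) = κ * (σ * (t - θ)) * κ := by ring
      _ ≤ κ * (σ * (t - θ)) * E.f θ :=
          mul_le_mul_of_nonneg_left hfκ (mul_nonneg hκ.le (hend θ hθ).1)
      _ ≤ _ := mul_le_mul_of_nonneg_right h3 hf0.le
      _ = _ := by ring
  have i1 := hIU.const_mul (-σ)
  have i2 := hfi.const_mul (K * (l / 2 + q / (2 * l)))
  have hfin := setIntegral_mono_on (hlini.const_mul (κ ^ 2)) (i1.add i2) hI.measurable hpt
  simp only [Pi.add_apply] at hfin
  rw [integral_add i1 i2, integral_const_mul (κ ^ 2), integral_const_mul (-σ),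
    integral_const_mul (K * (l / 2 + q / (2 * l))), horth, mul_zero, zero_add, hlin] at hfin
  have hq0 : 0 ≤ q := by
    have hu : u ∈ I := hI.Ico_subset (left_mem_Ico.2 hI.lt)
    exact (integral_nonneg fun b => by positivity).trans (hq u hu)
  have hF : ∫ θ in I, E.f θ ≤ K * (v - u) := by
    have := setIntegral_mono_on (μ := volume) (s := I) (g := fun _ => K) hfi
      (integrableOn_const (by rw [measure_congr hI.ae_eq]; simp)) hI.measurable
      fun θ hθ => hB.f_upper θ (hI.subset hθ)
    rw [setIntegral_const, measureReal_def, measure_congr hI.ae_eq, Real.volume_Icc,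
      ENNReal.toReal_ofReal (by linarith), smul_eq_mul] at this
    linarith
  have h1 : K * (l / 2 + q / (2 * l)) * ∫ θ in I, E.f θ ≤
      K * (l / 2 + q / (2 * l)) * (K * (v - u)) :=
    mul_le_mul_of_nonneg_left hF (by positivity)
  have h2 : κ ^ 2 * (v - u) * (v - u) ≤ K ^ 2 * (l + q / l) * (v - u) := by
    have e : K * (l / 2 + q / (2 * l)) * (K * (v - u)) =
        K ^ 2 * (l + q / l) * (v - u) / 2 := by field_simp
    rw [e] at h1
    have := hfin.trans h1
    linarith
  exact le_of_mul_le_mul_right h2 huv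

end IsRegularEq

/-- At the ends of a wide cell the value of its label is bounded away from the payoff of the
ideal action, when the misalignment is small. -/
theorem Bounds.exists_wide_cell_gap (hE : E.Assumptions) (hB : E.Bounds K κ) {w : ℝ}
    (hw : 0 < w) :
    ∃ ε > 0, ∃ d₁ ∈ Ioc 0 E.d₀, ∀ d ∈ Ioo 0 d₁, ∀ (I : Set ℝ) (u v : ℝ) (R : ℝ → ℝ → ℝ)
      (a : ℝ → ℝ) (t : ℝ), E.IsCell I u v → E.IsRegularEq d I R a → w ≤ v - u →
      (t = v ∨ t = u) → E.labelValue d a t ≤ E.US (E.aR t) t d - ε := by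
  have hK := hB.K_one
  have hκ := hB.κ_pos
  have hM : 0 ≤ 2 * K / κ + 1 := by positivity
  -- With `q = l ^ 2` the bound on `κ ^ 2 * (v - u)` becomes `2 * K ^ 2 * l = κ ^ 2 * w / 2`, too
  -- small for a cell of width at least `w`.
  set l := κ ^ 2 * w / (4 * K ^ 2) with hl
  have hl0 : 0 < l := by positivity
  obtain ⟨L, hL0, hL⟩ := hE.exists_contiguity (2 * K / κ + 1) (δ := l ^ 2 / (2 * K ^ 2))
    (by positivity)
  have hd0 := hE.d₀_pos
  refine ⟨κ * l ^ 2 / (4 * L), by positivity, min E.d₀ (κ * l ^ 2 / (4 * L * K ^ 2)),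
    ⟨lt_min hd0 (by positivity), min_le_left _ _⟩, ?_⟩
  intro d hd I u v R a t hI eq hwide ht
  have hd' : d ∈ Icc 0 E.d₀ := ⟨hd.1.le, hd.2.le.trans (min_le_left _ _)⟩
  have hdK : K ^ 2 * d ≤ κ * l ^ 2 / (4 * L) := by
    have : d ≤ κ * l ^ 2 / (4 * L * K ^ 2) := hd.2.le.trans (min_le_right _ _)
    rw [le_div_iff₀ (by positivity)] at this ⊢
    linarith
  obtain ⟨σ, hσ⟩ : ∃ σ : ℝ, (σ = 1 ∧ t = v) ∨ (σ = -1 ∧ t = u) := by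
    rcases ht with h | h
    · exact ⟨1, Or.inl ⟨rfl, h⟩⟩
    · exact ⟨-1, Or.inr ⟨rfl, h⟩⟩
  have htΘ : t ∈ E.Θ := by
    rcases ht with h | h <;> rw [h]
    exacts [hI.v_mem, hI.u_mem]
  have hσ1 : |σ| = 1 := by rcases hσ with ⟨rfl, -⟩ | ⟨rfl, -⟩ <;> simp
  have hta := hE.aR_mem htΘ
  by_contra! hcon
  have h1 := eq.labelValue_end_le hE hB hd' hI hσ htΘ
  obtain ⟨M, hMdef⟩ : ∃ M, M = 2 * K / κ + 1 := ⟨_, rfl⟩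
  rw [← hMdef] at h1 hM hL
  have ham := eq.a_cont.measurable
  set g : ℝ → ℝ := fun b => |a b - E.aR t| ^ 2 with hg
  have hgm : Measurable g := (ham.sub_const _).abs.pow_const 2
  have hgB : ∀ b, g b ≤ K ^ 2 := fun b =>
    pow_le_pow_left₀ (abs_nonneg _) (hB.A_width _ hta _ (eq.a_mem _)) 2
  have hg0 : ∀ b, 0 ≤ g b := fun b => by positivity
  -- If the value were within `ε` of the ideal, `labelValue_end_le` would bound `κ` times this
  -- integral by `ε + K ^ 2 * d`, and each summand is at most `κ * l ^ 2 / (4 * L)`.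
  have h2 : ∫ b, g (b + σ * M) ∂(E.anchorLaw t) ≤ l ^ 2 / (2 * L) := by
    have h3 : κ * ∫ b, g (b + σ * M) ∂(E.anchorLaw t) ≤ κ * (l ^ 2 / (2 * L)) := by
      have e : κ * (l ^ 2 / (2 * L)) = κ * l ^ 2 / (4 * L) + κ * l ^ 2 / (4 * L) := by
        field_simp; norm_num
      rw [e]
      simp only [hg]
      linarith
    exact le_of_mul_le_mul_left h3 hκ
  have hq : ∀ θ ∈ I, ∫ b, |a (R θ b) - E.aR t| ^ 2 ∂(E.anchorLaw θ) ≤ l ^ 2 := by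
    intro θ hθ
    have hθΘ := hI.subset hθ
    -- Smallness is carried from state `t` and the favourable translate to state `θ` and the
    -- unfavourable translate, which dominates the equilibrium error. Half of `l ^ 2` comes from the
    -- factor `L`, half from the tail.
    have h3 := hL θ hθΘ t htΘ (-σ * M) (σ * M) (by rw [abs_mul, abs_neg, hσ1, one_mul,
      abs_of_nonneg hM]) (by rw [abs_mul, hσ1, one_mul, abs_of_nonneg hM]) g (K ^ 2) hgm hg0 hgB
    have h4 : ∫ b, |a (R θ b) - E.aR t| ^ 2 ∂(E.anchorLaw θ) ≤
        ∫ b, g (b + -σ * M) ∂(E.anchorLaw θ) := by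
      refine integral_mono (hE.integrable_anchorLaw θ
        (hgm.comp (eq.measurable_report θ)) (B := K ^ 2) fun b => ?_)
        (hE.integrable_anchorLaw θ (hgm.comp (measurable_id.add_const (-σ * M)))
          (B := K ^ 2) fun b => ?_) fun b => ?_
      · exact (abs_of_nonneg (hg0 _)).trans_le (hgB _)
      · exact (abs_of_nonneg (hg0 _)).trans_le (hgB _)
      · have hr := eq.abs_report_sub_le hθ fun r hr =>
          hB.senderObj_lt_of_far hE hd' eq.a_mem hθΘ (b := b) hr
        exact pow_le_pow_left₀ (abs_nonneg _) (eq.abs_action_sub_end hE hB hI hσ (hMdef ▸ hr)).2 2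
    have h5 : L * ∫ b, g (b + σ * M) ∂(E.anchorLaw t) ≤ L * (l ^ 2 / (2 * L)) :=
      mul_le_mul_of_nonneg_left h2 hL0.le
    have e1 : L * (l ^ 2 / (2 * L)) = l ^ 2 / 2 := by field_simp
    have e2 : K ^ 2 * (l ^ 2 / (2 * K ^ 2)) = l ^ 2 / 2 := by field_simp
    linarith
  have h6 := eq.width_le_of_action_error hE hB hI hσ htΘ hq hl0
  have e3 : K ^ 2 * (l + l ^ 2 / l) = κ ^ 2 * w / 2 := by
    rw [hl]; field_simp; norm_num
  rw [e3] at h6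
  have h7 : κ ^ 2 * w ≤ κ ^ 2 * (v - u) := by gcongr
  have h8 : 0 < κ ^ 2 * w := by positivity
  linarith

/-- The value of a label at a state of its cell is close to the payoff of the ideal action when
the cell is narrow. -/
theorem IsRegularEq.le_labelValue_end (hE : E.Assumptions) (hB : E.Bounds K κ) {d : ℝ}
    (hd : d ∈ Icc 0 E.d₀) {I : Set ℝ} {u v t : ℝ} {R : ℝ → ℝ → ℝ} {a : ℝ → ℝ}
    (hI : E.IsCell I u v) (eq : E.IsRegularEq d I R a) (ht : t ∈ Icc u v) :
    E.US (E.aR t) t d - K ^ 2 * (v - u) ≤ E.labelValue d a t := by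
  have hK := hB.K_one
  have htΘ := hI.Icc_subset ht
  have hp := hE.isProbabilityMeasure_anchorLaw t
  have := le_labelValue hE hB hd eq.a_mem htΘ
    (g := fun _ => E.US (E.aR t) t d - K ^ 2 * (v - u)) (integrable_const _) fun b => by
      have h1 := hB.US_lip _ (hE.aR_mem htΘ) _ (eq.a_mem b) t htΘ t htΘ d hd
      rw [sub_self, abs_zero, add_zero] at h1
      have h2 := mul_le_mul_of_nonneg_left (eq.abs_action_sub_le hE hB hI ht b)
        (show 0 ≤ K by linarith)
      have h3 := (abs_le.1 h1).1
      linarith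
  simpa using this

/-- A cell adjacent to a wide cell is not too narrow. -/
theorem Bounds.exists_adjacent_width (hE : E.Assumptions) (hB : E.Bounds K κ) {w : ℝ}
    (hw : 0 < w) :
    ∃ w' > 0, ∃ d₁ ∈ Ioc 0 E.d₀, ∀ d ∈ Ioo 0 d₁, ∀ (I J : Set ℝ) (u t v : ℝ)
      (R R' : ℝ → ℝ → ℝ) (a a' : ℝ → ℝ),
      E.IsCell I u t → E.IsCell J t v → E.IsRegularEq d I R a → E.IsRegularEq d J R' a' →
      E.labelValue d a t = E.labelValue d a' t →
      (w ≤ t - u → w' ≤ v - t) ∧ (w ≤ v - t → w' ≤ t - u) := by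
  have hK := hB.K_one
  obtain ⟨ε, hε, d₁, hd₁, hgap⟩ := hB.exists_wide_cell_gap hE hw
  -- At the cutoff the wide label is worth at most the ideal minus `ε`, its neighbour at least the
  -- ideal minus `K ^ 2` times its width.
  refine ⟨ε / K ^ 2, by positivity, d₁, hd₁, ?_⟩
  intro d hd I J u t v R R' a a' hI hJ eqI eqJ hind
  have hd' : d ∈ Icc 0 E.d₀ := ⟨hd.1.le, hd.2.le.trans hd₁.2⟩
  constructor
  · intro hwide
    have h1 := hgap d hd I u t R a t hI eqI hwide (Or.inl rfl)
    have h2 := eqJ.le_labelValue_end hE hB hd' hJ (left_mem_Icc.2 hJ.lt.le)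
    rw [div_le_iff₀ (by positivity)]
    linarith
  · intro hwide
    have h1 := hgap d hd J t v R' a' t hJ eqJ hwide (Or.inr rfl)
    have h2 := eqI.le_labelValue_end hE hB hd' hI (right_mem_Icc.2 hI.lt.le)
    rw [div_le_iff₀ (by positivity)]
    linarith

end Model

/-! ### Slowly decaying sequences -/

/-- A positive sequence with bounded sum stays away from zero to the right of an index where it
is not small, if consecutive terms differ by a quadratic expression and a small error. -/
theorem le_of_slow_decay {w : ℕ → ℝ} {N : ℕ} {C d ℒ s v₀ : ℝ} (hC : 0 < C)
    (hpos : ∀ i < N, 0 < w i) (hsum : ∑ i ∈ Finset.range N, w i ≤ ℒ)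
    (hstep : ∀ i, i + 1 < N → w i - w (i + 1) ≤ C * (max (w i) (w (i + 1))) ^ 2 + C * d)
    (hwide : ∀ i, i + 1 < N → 1 / (4 * C) ≤ w i → v₀ ≤ w (i + 1)) {j : ℕ} (hs : 0 < s)
    (hsj : s ≤ w j) (hsv : s ≤ v₀) (hd : d ≤ (s * Real.exp (-(4 * C * ℒ))) ^ 2) {i : ℕ}
    (hji : j ≤ i) (hi : i < N) : s * Real.exp (-(4 * C * ℒ)) ≤ w i := by
  have hle : ∀ i < N, ∑ l ∈ Finset.Ico j i, w l ≤ ℒ := fun i hi => by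
    refine le_trans (Finset.sum_le_sum_of_subset_of_nonneg (fun l hl => ?_) fun l hl _ => ?_) hsum
    · rw [Finset.mem_Ico] at hl; rw [Finset.mem_range]; omega
    · exact (hpos l (Finset.mem_range.1 hl)).le
  have hconv : ∀ i < N, s ≤ w i * Real.exp (4 * C * ∑ l ∈ Finset.Ico j i, w l) →
      s * Real.exp (-(4 * C * ℒ)) ≤ w i := fun i hi h => by
    have h1 : w i * Real.exp (4 * C * ∑ l ∈ Finset.Ico j i, w l) ≤
        w i * Real.exp (4 * C * ℒ) := by
      have := hle i hi
      have := (hpos i hi).le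
      gcongr
    rw [Real.exp_neg, ← div_eq_mul_inv, div_le_iff₀ (Real.exp_pos _)]
    exact h.trans h1
  -- The induction carries the iterated form of `w (i + 1) ≥ w i * exp (-4 * C * w i)`. The
  -- exponents add up to at most `4 * C * ℒ` whatever the number of terms.
  refine hconv i hi ?_
  induction i, hji using Nat.le_induction with
  | base => simpa using hsj
  | succ i hji ih =>
    have hi' : i < N := by omega
    have ih := ih hi'
    have hlow := hconv i hi' ih
    have hwi := hpos i hi'
    have hwi' := hpos (i + 1) hi
    have hS : 0 ≤ ∑ l ∈ Finset.Ico j i, w l := Finset.sum_nonneg fun l hl =>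
      (hpos l (by rw [Finset.mem_Ico] at hl; omega)).le
    rw [Finset.sum_Ico_succ_top hji]
    -- For large `w i` the quadratic error says nothing, and `hwide` supplies a fresh bound `v₀`
    -- instead.
    rcases le_or_gt (1 / (4 * C)) (w i) with h | h
    · have h1 := hsv.trans (hwide i hi h)
      have h2 : 1 ≤ Real.exp (4 * C * (∑ l ∈ Finset.Ico j i, w l + w i)) :=
        Real.one_le_exp (by positivity)
      exact h1.trans (le_mul_of_one_le_right hwi'.le h2)
    · suffices hmain : w i ≤ w (i + 1) * Real.exp (4 * C * w i) by
        rw [mul_add, Real.exp_add, mul_comm (Real.exp _), ← mul_assoc]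
        exact ih.trans (mul_le_mul_of_nonneg_right hmain (Real.exp_pos _).le)
      rcases le_or_gt (w i) (w (i + 1)) with h1 | h1
      · exact h1.trans (le_mul_of_one_le_right hwi'.le (Real.one_le_exp (by positivity)))
      · have h2 := hstep i hi
        rw [max_eq_left h1.le] at h2
        -- The lower bound already proved for `w i` absorbs `C * d`, so the drop is at most `2 * C *
        -- w i ^ 2`. The conclusion uses `(1 - x) * (1 + 2 * x) ≥ 1` for `0 ≤ x ≤ 1 / 2`, with `x =
        -- 2 * C * w i`.
        have h3 : d ≤ w i ^ 2 := hd.trans (by gcongr)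
        have h4 := mul_le_mul_of_nonneg_left h3 hC.le
        have h5 : w i * (1 - 2 * C * w i) ≤ w (i + 1) := by linarith
        have h6 : 2 * C * w i ≤ 1 / 2 := by
          rw [lt_div_iff₀ (by positivity)] at h
          linarith
        have h7 := Real.add_one_le_exp (4 * C * w i)
        have h8 : 0 ≤ 2 * C * w i := by positivity
        calc w i ≤ w i * (1 + 2 * C * w i * (1 - 2 * (2 * C * w i))) :=
              le_mul_of_one_le_right hwi.le
                (le_add_of_nonneg_right (mul_nonneg h8 (by linarith)))
          _ = w i * (1 - 2 * C * w i) * (4 * C * w i + 1) := by ring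
          _ ≤ w (i + 1) * Real.exp (4 * C * w i) :=
              mul_le_mul h5 h7 (by positivity) hwi'.le

/-- A two-sided version of `le_of_slow_decay`. -/
theorem le_of_slow_variation {w : ℕ → ℝ} {N : ℕ} {C d ℒ s v₀ : ℝ} (hC : 0 < C)
    (hpos : ∀ i < N, 0 < w i) (hsum : ∑ i ∈ Finset.range N, w i ≤ ℒ)
    (hstep : ∀ i, i + 1 < N → |w i - w (i + 1)| ≤ C * (max (w i) (w (i + 1))) ^ 2 + C * d)
    (hright : ∀ i, i + 1 < N → 1 / (4 * C) ≤ w i → v₀ ≤ w (i + 1))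
    (hleft : ∀ i, i + 1 < N → 1 / (4 * C) ≤ w (i + 1) → v₀ ≤ w i) {j : ℕ} (hj : j < N)
    (hs : 0 < s) (hsj : s ≤ w j) (hsv : s ≤ v₀)
    (hd : d ≤ (s * Real.exp (-(4 * C * ℒ))) ^ 2) {i : ℕ} (hi : i < N) :
    s * Real.exp (-(4 * C * ℒ)) ≤ w i := by
  rcases le_total j i with hji | hij
  · exact le_of_slow_decay hC hpos hsum (fun i hi => (le_abs_self _).trans (hstep i hi)) hright
      hs hsj hsv hd hji hi
  · have e : ∀ l, l + 1 < N → N - 1 - (l + 1) + 1 = N - 1 - l := fun l hl => by omega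
    have h := le_of_slow_decay (w := fun l => w (N - 1 - l)) (N := N) (j := N - 1 - j)
      (i := N - 1 - i) (v₀ := v₀) (ℒ := ℒ) (d := d) (s := s) hC
      (fun l hl => hpos _ (by omega))
      ((Finset.sum_range_reflect w N).trans_le hsum)
      (fun l hl => by
        have h1 := hstep (N - 1 - (l + 1)) (by omega)
        rw [e l hl, max_comm, abs_sub_comm] at h1
        exact (le_abs_self _).trans h1)
      (fun l hl hw => hleft (N - 1 - (l + 1)) (by omega) (by rw [e l hl]; exact hw))
      hs (by rw [show N - 1 - (N - 1 - j) = j by omega]; exact hsj) hsv hd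
      (by omega) (by omega)
    rwa [show N - 1 - (N - 1 - i) = i by omega] at h

namespace Model

variable {E : Model} {K κ : ℝ}

/-! ### Widths of the labels of a hybrid equilibrium -/

namespace Hybrid

variable {d : ℝ} {N : ℕ}

/-- The width of the label with index `i`. -/
noncomputable def width (H : E.Hybrid d N) (i : ℕ) : ℝ :=
  H.cut ⟨min (i + 1) N, by omega⟩ - H.cut ⟨min i N, by omega⟩

theorem width_val (H : E.Hybrid d N) (k : Fin N) :
    H.width k = H.cut k.succ - H.cut k.castSucc := by
  unfold width
  congr 2 <;> ext <;> simp

theorem width_eq (H : E.Hybrid d N) {i : ℕ} (hi : i < N) :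
    H.width i = H.cut (Fin.succ ⟨i, hi⟩) - H.cut (Fin.castSucc ⟨i, hi⟩) :=
  H.width_val ⟨i, hi⟩

theorem width_pos (H : E.Hybrid d N) {i : ℕ} (hi : i < N) : 0 < H.width i := by
  rw [H.width_eq hi]
  exact sub_pos.2 (H.cut_strictMono Fin.castSucc_lt_succ)

theorem sum_width (H : E.Hybrid d N) : ∑ i ∈ Finset.range N, H.width i = E.hi - E.lo := by
  have h := Finset.sum_range_sub (fun i => H.cut ⟨min i N, by omega⟩) N
  rw [← H.cut_first, ← H.cut_last]
  refine h.trans ?_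
  congr 2
  ext
  simp

/-- At a cutoff the two adjacent labels are equally good. -/
theorem indifferent (hE : E.Assumptions) (hB : E.Bounds K κ) (hd : d ∈ Icc 0 E.d₀)
    (H : E.Hybrid d N) {i : ℕ} (hi : i + 1 < N) :
    E.labelValue d (H.a ⟨i, by omega⟩) (H.cut (Fin.succ ⟨i, by omega⟩)) =
      E.labelValue d (H.a ⟨i + 1, hi⟩) (H.cut (Fin.succ ⟨i, by omega⟩)) := by
  have hK := hB.K_one
  obtain ⟨k, hk⟩ : ∃ k : Fin N, k = ⟨i, by omega⟩ := ⟨_, rfl⟩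
  obtain ⟨k', hk'⟩ : ∃ k' : Fin N, k' = ⟨i + 1, hi⟩ := ⟨_, rfl⟩
  have hkk : k'.castSucc = k.succ := by rw [hk, hk']; rfl
  rw [← hk, ← hk']
  have hI := H.isCell k
  have hJ := H.isCell k'
  rw [hkk] at hJ
  -- The cutoff belongs to the half-open cell on its right, which gives one inequality at once. The
  -- other is a limit from the left, where values are Lipschitz in the state.
  refine le_antisymm (H.label_ic k' _ (hJ.Ico_subset (left_mem_Ico.2 hJ.lt)) k) ?_
  refine le_of_forall_pos_le_add fun ε hε => ?_
  set t := H.cut k.succ with ht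
  set u := H.cut k.castSucc with hu
  have hC : 0 < K + K * K := by positivity
  obtain ⟨θ, hθ⟩ : ∃ θ, θ = max u (t - ε / (2 * (K + K * K))) := ⟨_, rfl⟩
  have h1 : θ ∈ Ico u t := by
    rw [hθ]
    exact ⟨le_max_left _ _, max_lt hI.lt (sub_lt_self _ (by positivity))⟩
  have h2 : (K + K * K) * |t - θ| ≤ ε / 2 := by
    rw [abs_of_pos (sub_pos.2 h1.2)]
    have h3 : t - θ ≤ ε / (2 * (K + K * K)) := by
      have := le_max_right u (t - ε / (2 * (K + K * K)))
      rw [hθ]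
      linarith
    calc _ ≤ (K + K * K) * (ε / (2 * (K + K * K))) := by gcongr
      _ = _ := by field_simp
  have hθΘ := hI.subset (hI.Ico_subset h1)
  have h3 := H.label_ic k θ (hI.Ico_subset h1) k'
  have h4 := (abs_le.1 ((abs_labelValue_sub_le hE hB hd (H.regular k).a_mem hθΘ
    hI.v_mem).trans h2)).1
  have h5 := (abs_le.1 ((abs_labelValue_sub_le hE hB hd (H.regular k').a_mem hθΘ
    hI.v_mem).trans h2)).2
  linarith

end Hybrid

/-- When the misalignment is small and one label is wide, all labels are. -/
theorem Assumptions.exists_label_width (hE : E.Assumptions) {k : NNReal}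
    (hf : LipschitzOnWith k E.f E.Θ) {w : ℝ} (hw : 0 < w) :
    ∃ s > 0, ∃ d₁ ∈ Ioc 0 E.d₀, ∀ d ∈ Ioo 0 d₁, ∀ (N : ℕ) (H : E.Hybrid d N), ∀ j < N,
      w ≤ H.width j → ∀ i < N, s ≤ H.width i := by
  obtain ⟨K, κ, hB⟩ := hE.exists_bounds
  obtain ⟨C, hC, hcomp⟩ := hB.exists_width_comparison hE hf
  obtain ⟨v₀, hv₀, d₂, hd₂, hadj⟩ := hB.exists_adjacent_width hE
    (show 0 < 1 / (4 * C) by positivity)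
  have hs : 0 < min w v₀ := lt_min hw hv₀
  obtain ⟨s, hsdef⟩ : ∃ s, s = min w v₀ * Real.exp (-(4 * C * (E.hi - E.lo))) := ⟨_, rfl⟩
  have hs0 : 0 < s := by rw [hsdef]; exact mul_pos hs (Real.exp_pos _)
  -- The bound `s ^ 2` lets the misalignment be absorbed in the decay estimate; `d₂` controls the
  -- neighbours of wide labels.
  refine ⟨s, hs0, min d₂ (s ^ 2), ⟨lt_min hd₂.1 (by positivity),
    (min_le_left _ _).trans hd₂.2⟩, ?_⟩
  intro d hd N H j hj hwj i hi
  have hd1 : d ∈ Ioo 0 d₂ := ⟨hd.1, hd.2.trans_le (min_le_left _ _)⟩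
  have hd' : d ∈ Icc 0 E.d₀ := ⟨hd.1.le, hd1.2.le.trans hd₂.2⟩
  have hds : d ≤ s ^ 2 := hd.2.le.trans (min_le_right _ _)
  rw [hsdef] at hds ⊢
  refine le_of_slow_variation (w := H.width) (v₀ := v₀) (d := d) hC (fun i hi => H.width_pos hi)
    H.sum_width.le ?_ ?_ ?_ hj hs ((min_le_left _ _).trans hwj) (min_le_right _ _) hds hi
  · intro i hi
    rw [H.width_eq hi, H.width_eq (show i < N by omega)]
    exact hcomp d hd' _ _ _ _ _ _ _ _ _ (H.isCell _) (H.isCell ⟨i + 1, hi⟩) (H.regular _)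
      (H.regular _) (H.indifferent hE hB hd' hi)
  · intro i hi
    rw [H.width_eq hi, H.width_eq (show i < N by omega)]
    exact (hadj d hd1 _ _ _ _ _ _ _ _ _ (H.isCell _) (H.isCell ⟨i + 1, hi⟩) (H.regular _)
      (H.regular _) (H.indifferent hE hB hd' hi)).1
  · intro i hi
    rw [H.width_eq hi, H.width_eq (show i < N by omega)]
    exact (hadj d hd1 _ _ _ _ _ _ _ _ _ (H.isCell _) (H.isCell ⟨i + 1, hi⟩) (H.regular _)
      (H.regular _) (H.indifferent hE hB hd' hi)).2

/-- Hybrid equilibria with many labels have narrow labels when the misalignment is small. -/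
theorem Assumptions.exists_finerThan (hE : E.Assumptions) {k : NNReal}
    (hf : LipschitzOnWith k E.f E.Θ) {w : ℝ} (hw : 0 < w) :
    ∃ n : ℕ, ∃ d₁ ∈ Ioc 0 E.d₀, ∀ d ∈ Ioo 0 d₁, ∀ N ≥ n, ∀ H : E.Hybrid d N,
      H.FinerThan w := by
  obtain ⟨s, hs, d₁, hd₁, h⟩ := hE.exists_label_width hf hw
  -- One label of width at least `w` makes all labels at least `s` wide, and `n` of these do not fit
  -- into the state space.
  obtain ⟨n, hn⟩ := exists_nat_gt ((E.hi - E.lo) / s)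
  refine ⟨n, d₁, hd₁, fun d hd N hN H j => ?_⟩
  by_contra! hj
  rw [← H.width_val] at hj
  have h1 := Finset.sum_le_sum fun i (hi : i ∈ Finset.range N) =>
    h d hd N H j j.2 hj i (Finset.mem_range.1 hi)
  rw [H.sum_width, Finset.sum_const, Finset.card_range, nsmul_eq_mul] at h1
  rw [div_lt_iff₀ hs] at hn
  have h2 : (n : ℝ) * s ≤ N * s := by gcongr
  linarith

/-! ### The largest number of labels -/

/-- When the sender is biased upwards, actions below the ideal action are worse than it. -/
theorem IsRegularEq.labelValue_le_ideal (hE : E.Assumptions) (hB : E.Bounds K κ) {d : ℝ}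
    (hd : d ∈ Icc 0 E.d₀) {I : Set ℝ} {u t : ℝ} {R : ℝ → ℝ → ℝ} {a : ℝ → ℝ}
    (hI : E.IsCell I u t) (eq : E.IsRegularEq d I R a) (hp : 0 ≤ E.US1 (E.aR t) t d) :
    E.labelValue d a t ≤ E.US (E.aR t) t d := by
  have htΘ := hI.v_mem
  have hprob := hE.isProbabilityMeasure_anchorLaw t
  have := labelValue_le hE hB hd eq.a_mem htΘ (integrable_const (E.US (E.aR t) t d))
    fun b r => by
      have h1 := hB.US_quad _ (hE.aR_mem htΘ) _ (eq.a_mem r) t htΘ d hd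
      have h2 := (senderObj_le_bound hB hd eq.a_mem htΘ b r).1
      have h3 := (eq.a_range hE hB hI r).2
      have h4 := mul_nonpos_of_nonneg_of_nonpos hp (sub_nonpos.2 h3)
      have h5 := mul_nonneg hB.κ_pos.le (sq_nonneg (a r - E.aR t))
      linarith only [h1, h2, h4, h5]
  simp only [integral_const, probReal_univ, one_smul] at this
  exact this

/-- When the sender is biased upwards, actions slightly above the ideal action are better
than it. -/
theorem IsRegularEq.ideal_lt_labelValue (hE : E.Assumptions) (hB : E.Bounds K κ) {d : ℝ}
    (hd : d ∈ Icc 0 E.d₀) {J : Set ℝ} {t v : ℝ} {R : ℝ → ℝ → ℝ} {a : ℝ → ℝ}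
    (hJ : E.IsCell J t v) (eq : E.IsRegularEq d J R a)
    (hp : (v - t) * K ^ 2 ≤ E.US1 (E.aR t) t d) :
    E.US (E.aR t) t d < E.labelValue d a t := by
  have hK := hB.K_one
  have htΘ := hJ.u_mem
  have hta := hE.aR_mem htΘ
  have hprob := hE.isProbabilityMeasure_anchorLaw t
  -- The range bound is weak; strictness comes from comparing with the smaller report `b - 1`.
  have hpos : ∀ b, 0 < a b - E.aR t := fun b =>
    sub_pos.2 ((eq.a_range hE hB hJ (b - 1)).1.trans_lt (eq.a_mono (by linarith)))
  have hm : Measurable fun b => (a b - E.aR t) ^ 2 :=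
    (eq.a_cont.measurable.sub_const _).pow_const 2
  have hi : Integrable (fun b => (a b - E.aR t) ^ 2) (E.anchorLaw t) :=
    hE.integrable_anchorLaw t hm (B := K ^ 2) fun b => by
      rw [abs_pow]
      exact pow_le_pow_left₀ (abs_nonneg _) (hB.A_width _ hta _ (eq.a_mem _)) 2
  have hpt : ∀ b, E.US (E.aR t) t d + κ * (a b - E.aR t) ^ 2 ≤ E.US (a b) t d := fun b => by
    have h1 := hB.US_quad _ (eq.a_mem b) _ hta t htΘ d hd
    -- The cell is so narrow that the marginal payoff is still nonnegative at `a b`; the quadratic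
    -- bound centred at `a b` then makes the ideal action strictly worse.
    have h2 := hB.US1_lip _ hta _ (eq.a_mem b) t htΘ t htΘ d hd
    rw [sub_self, abs_zero, add_zero, abs_of_pos (hpos b)] at h2
    have h3 := (abs_le.1 h2).1
    have h4 := hB.aR_lip t htΘ v hJ.v_mem
    rw [abs_of_pos (sub_pos.2 hJ.lt)] at h4
    have h5 := (le_abs_self _).trans h4
    have h6 := (eq.a_range hE hB hJ b).2
    have h7 : K * (a b - E.aR t) ≤ K * (K * (v - t)) :=
      mul_le_mul_of_nonneg_left (by linarith only [h5, h6]) (by linarith only [hK])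
    have h8 : 0 ≤ E.US1 (a b) t d := by linarith only [h3, h7, hp]
    have h9 := mul_nonneg h8 (hpos b).le
    linarith only [h1, h9]
  have hge := le_labelValue hE hB hd eq.a_mem htΘ
    ((integrable_const (E.US (E.aR t) t d)).add (hi.const_mul κ)) hpt
  simp only [Pi.add_apply] at hge
  rw [integral_add (integrable_const _) (hi.const_mul κ), integral_const_mul κ] at hge
  simp only [integral_const, probReal_univ, one_smul] at hge
  have hint : 0 < ∫ b, (a b - E.aR t) ^ 2 ∂(E.anchorLaw t) := by
    rw [integral_pos_iff_support_of_nonneg (fun b => sq_nonneg _) hi]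
    have : Function.support (fun b => (a b - E.aR t) ^ 2) = univ :=
      eq_univ_of_forall fun b => (pow_pos (hpos b) 2).ne'
    rw [this, measure_univ]
    exact one_pos
  have := mul_pos hB.κ_pos hint
  linarith only [hge, this]

/-- A label to the right of a cutoff with indifference is not too narrow. -/
theorem Bounds.le_right_width (hE : E.Assumptions) (hB : E.Bounds K κ) {d : ℝ}
    (hd : d ∈ Icc 0 E.d₀) {I J : Set ℝ} {u t v : ℝ} {R R' : ℝ → ℝ → ℝ} {a a' : ℝ → ℝ}
    (hI : E.IsCell I u t) (hJ : E.IsCell J t v) (eqI : E.IsRegularEq d I R a)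
    (eqJ : E.IsRegularEq d J R' a') (hind : E.labelValue d a t = E.labelValue d a' t) {p : ℝ}
    (hp0 : 0 < p) (hp : p ≤ E.US1 (E.aR t) t d) : p / K ^ 2 ≤ v - t := by
  have hK := hB.K_one
  by_contra! hlt
  rw [lt_div_iff₀ (by positivity)] at hlt
  have h1 := eqI.labelValue_le_ideal hE hB hd hI (hp0.le.trans hp)
  have h2 := eqJ.ideal_lt_labelValue hE hB hd hJ (hlt.le.trans hp)
  linarith only [h1, h2, hind]

/-- At small positive misalignment the number of labels is bounded. -/
theorem Assumptions.exists_bound_labels (hE : E.Assumptions) :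
    ∃ d₁ ∈ Ioc 0 E.d₀, ∀ d ∈ Ioo 0 d₁, ∃ M : ℕ, ∀ N, Nonempty (E.Hybrid d N) → N ≤ M := by
  obtain ⟨K, κ, hB⟩ := hE.exists_bounds
  have hK := hB.K_one
  obtain ⟨d₁, hd₁, hpos⟩ := hE.exists_US1_pos
  refine ⟨d₁, hd₁, fun d hd => ?_⟩
  have hd' : d ∈ Icc 0 E.d₀ := ⟨hd.1.le, hd.2.le.trans hd₁.2⟩
  have hc : ContinuousOn (fun θ => E.US1 (E.aR θ) θ d) E.Θ := by
    refine (LipschitzOnWith.of_dist_le_mul (K := (K * (K + 1)).toNNReal)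
      fun x hx y hy => ?_).continuousOn
    rw [Real.coe_toNNReal _ (by positivity), Real.dist_eq, Real.dist_eq]
    have h1 := hB.US1_lip _ (hE.aR_mem hy) _ (hE.aR_mem hx) y hy x hx d hd'
    have h2 := mul_le_mul_of_nonneg_left (hB.aR_lip y hy x hx) (show 0 ≤ K by linarith)
    linarith
  -- At fixed `d` the sender's marginal gain at the ideal action has a positive minimum `p` over
  -- states, so one minimal width serves every cutoff.
  obtain ⟨θ₀, hθ₀, hmin⟩ := (isCompact_Icc (a := E.lo) (b := E.hi)).exists_isMinOn
    ⟨E.lo, hE.lo_mem⟩ hc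
  obtain ⟨p, hp⟩ : ∃ p, p = E.US1 (E.aR θ₀) θ₀ d := ⟨_, rfl⟩
  have hp0 : 0 < p := hp ▸ hpos d hd θ₀ hθ₀
  obtain ⟨M, hM⟩ := exists_nat_gt ((E.hi - E.lo) / (p / K ^ 2))
  refine ⟨M + 1, ?_⟩
  rintro N ⟨H⟩
  by_contra! hN
  obtain ⟨n, rfl⟩ : ∃ n, N = n + 1 := ⟨N - 1, by omega⟩
  have hsum := H.sum_width
  -- The first label is split off: it has no cutoff on its left, so only the others are bounded
  -- below.
  rw [Finset.sum_range_succ'] at hsum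
  have h0 := H.width_pos (i := 0) (by omega)
  have h1 := Finset.sum_le_sum fun i (hi : i ∈ Finset.range n) => by
    have hi' : i + 1 < n + 1 := by rw [Finset.mem_range] at hi; omega
    have h2 := hB.le_right_width hE hd' (H.isCell ⟨i, by omega⟩) (H.isCell ⟨i + 1, hi'⟩)
      (H.regular _) (H.regular _) (H.indifferent hE hB hd' hi') hp0
      (hp.trans_le (hmin (H.isCell ⟨i, by omega⟩).v_mem))
    exact (show p / K ^ 2 ≤ H.width (i + 1) by rw [H.width_eq hi']; exact h2)
  rw [Finset.sum_const, Finset.card_range, nsmul_eq_mul] at h1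
  have hq : 0 < p / K ^ 2 := by positivity
  rw [div_lt_iff₀ hq] at hM
  have h3 : (M : ℝ) * (p / K ^ 2) ≤ n * (p / K ^ 2) := by
    have : M ≤ n := by omega
    gcongr
  linarith

theorem exists_maxLabels {d : ℝ} {M N : ℕ} (hM : ∀ N, Nonempty (E.Hybrid d N) → N ≤ M)
    (hN : Nonempty (E.Hybrid d N)) : ∃ N, E.MaxLabels d N := by
  have hb : BddAbove {n : ℕ | Nonempty (E.Hybrid d n)} := ⟨M, fun n hn => hM n hn⟩
  exact ⟨_, Nat.sSup_mem ⟨N, hN⟩ hb, fun n hn => le_csSup hb hn⟩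

/-- Most informative hybrid equilibria have narrow labels at small misalignment, if equilibria
with arbitrarily many labels exist. -/
theorem Assumptions.maxLabels_finerThan (hE : E.Assumptions) {k : NNReal}
    (hf : LipschitzOnWith k E.f E.Θ)
    (hex : ∀ n : ℕ, ∀ᶠ d in 𝓝[>] (0 : ℝ), ∃ N ≥ n, Nonempty (E.Hybrid d N)) {w : ℝ}
    (hw : 0 < w) :
    ∃ d₁ ∈ Ioc 0 E.d₀, ∀ d ∈ Ioo 0 d₁, ∀ N : ℕ, E.MaxLabels d N → ∀ H : E.Hybrid d N,
      H.FinerThan w := by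
  obtain ⟨n, d₁, hd₁, h⟩ := hE.exists_finerThan hf hw
  obtain ⟨d₂, hd₂, hsub⟩ := mem_nhdsGT_iff_exists_Ioo_subset.1 (hex n)
  refine ⟨min d₁ d₂, ⟨lt_min hd₁.1 hd₂, (min_le_left _ _).trans hd₁.2⟩, ?_⟩
  intro d hd N hN H
  -- The maximal number of labels is at least that of any existing equilibrium, hence at least `n`.
  obtain ⟨m, hm, hH⟩ := hsub ⟨hd.1, hd.2.trans_le (min_le_right _ _)⟩
  exact h d ⟨hd.1, hd.2.trans_le (min_le_left _ _)⟩ N (hm.trans (hN.2 hH)) H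

end Model

end HardSoft

/-! ### Assembly of the theorem -/

theorem mainTheorem6 (E : Model) (hE : E.Assumptions) :
    ∃ dbar : ℝ, 0 < dbar ∧ dbar ≤ E.d₀ ∧
      -- the anchor-only loss is bounded away from zero
      (∃ ℓ > 0, ∀ d ∈ Ioo 0 dbar, ∀ (X : E.AnchorOnly d) (i : Player), ℓ ≤ X.loss i) ∧
      -- hybrid equilibria with fine labels: strict ranking, and vanishing loss
      (∃ w > 0, ∀ d ∈ Ioo 0 dbar, ∀ (N : ℕ) (H : E.Hybrid d N) (X : E.AnchorOnly d) (i : Player),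
        H.FinerThan w → X.surplus i < H.surplus i) ∧
      (∀ ε > 0, ∃ w > 0, ∃ d₁ ∈ Ioc 0 E.d₀, ∀ d ∈ Ioo 0 d₁, ∀ (N : ℕ) (H : E.Hybrid d N)
        (i : Player), H.FinerThan w → |H.loss i| < ε) ∧
      ((∃ K, LipschitzOnWith K E.f E.Θ) →
        -- as the number of labels grows and `d` vanishes, all labels become narrow
        (∀ w > 0, ∃ n : ℕ, ∃ d₁ ∈ Ioc 0 E.d₀, ∀ d ∈ Ioo 0 d₁, ∀ N ≥ n, ∀ H : E.Hybrid d N,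
          H.FinerThan w) ∧
        -- the most informative hybrid equilibria: strict ranking, and vanishing loss
        ((∀ n : ℕ, ∀ᶠ d in 𝓝[>] (0 : ℝ), ∃ N ≥ n, Nonempty (E.Hybrid d N)) →
          (∃ d₂ ∈ Ioc 0 E.d₀, ∀ d ∈ Ioo 0 d₂, ∃ N : ℕ, E.MaxLabels d N ∧
            ∀ (H : E.Hybrid d N) (X : E.AnchorOnly d) (i : Player), X.surplus i < H.surplus i) ∧
          (∀ ε > 0, ∃ d₁ ∈ Ioc 0 E.d₀, ∀ d ∈ Ioo 0 d₁, ∀ N : ℕ, E.MaxLabels d N →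
            ∀ (H : E.Hybrid d N) (i : Player), |H.loss i| < ε))) := by
  obtain ⟨dA, hdA, ℓ, hℓ, hA⟩ := hE.exists_anchorOnly_loss
  -- The mesh bound is the one that pushes hybrid losses below the anchor-only bound `ℓ`; since both
  -- losses use the same benchmark, surpluses are then ranked.
  obtain ⟨w, hw, dH, hdH, hH⟩ := hE.hybrid_loss_vanishes hℓ
  have hrank : ∀ d ∈ Ioo 0 (min dA dH), ∀ (N : ℕ) (H : E.Hybrid d N) (X : E.AnchorOnly d)
      (i : Player), H.FinerThan w → X.surplus i < H.surplus i := by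
    intro d hd N H X i hfine
    have h1 := hA d ⟨hd.1, hd.2.trans_le (min_le_left _ _)⟩ X i
    have h2 := (le_abs_self _).trans_lt
      (hH d ⟨hd.1, hd.2.trans_le (min_le_right _ _)⟩ N H i hfine)
    unfold Model.AnchorOnly.loss at h1
    unfold Model.Hybrid.loss at h2
    linarith
  refine ⟨min dA dH, lt_min hdA.1 hdH.1, (min_le_left _ _).trans hdA.2,
    ⟨ℓ, hℓ, fun d hd => hA d ⟨hd.1, hd.2.trans_le (min_le_left _ _)⟩⟩, ⟨w, hw, hrank⟩,
    fun ε hε => hE.hybrid_loss_vanishes hε, ?_⟩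
  rintro ⟨k, hf⟩
  refine ⟨fun w hw => hE.exists_finerThan hf hw, fun hex => ⟨?_, fun ε hε => ?_⟩⟩
  · obtain ⟨d₁, hd₁, hfine⟩ := hE.maxLabels_finerThan hf hex hw
    obtain ⟨d₂, hd₂, hbd⟩ := hE.exists_bound_labels
    -- Taking `n = 0` gives the existence of some hybrid equilibrium, which together with the bound
    -- on labels yields a maximum.
    obtain ⟨d₃, hd₃, hsub⟩ := mem_nhdsGT_iff_exists_Ioo_subset.1 (hex 0)
    refine ⟨min (min dA dH) (min d₁ (min d₂ d₃)),
      ⟨lt_min (lt_min hdA.1 hdH.1) (lt_min hd₁.1 (lt_min hd₂.1 hd₃)),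
        (min_le_left _ _).trans ((min_le_left _ _).trans hdA.2)⟩, ?_⟩
    intro d hd
    simp only [mem_Ioo, lt_min_iff] at hd
    obtain ⟨M, hM⟩ := hbd d ⟨hd.1, hd.2.2.2.1⟩
    obtain ⟨N₀, -, hN₀⟩ := hsub ⟨hd.1, hd.2.2.2.2⟩
    obtain ⟨N, hN⟩ := Model.exists_maxLabels hM hN₀
    exact ⟨N, hN, fun H X i => hrank d ⟨hd.1, lt_min hd.2.1.1 hd.2.1.2⟩ N H X i
      (hfine d ⟨hd.1, hd.2.2.1⟩ N hN H)⟩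
  · obtain ⟨w', hw', d₂, hd₂, hloss⟩ := hE.hybrid_loss_vanishes hε
    obtain ⟨d₁, hd₁, hfine⟩ := hE.maxLabels_finerThan hf hex hw'
    refine ⟨min d₁ d₂, ⟨lt_min hd₁.1 hd₂.1, (min_le_left _ _).trans hd₁.2⟩, ?_⟩
    intro d hd N hN H i
    exact hloss d ⟨hd.1, hd.2.trans_le (min_le_right _ _)⟩ N H i
      (hfine d ⟨hd.1, hd.2.trans_le (min_le_left _ _)⟩ N hN H)
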